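/- Let $n\ge 0$, let $\Xi=\mathbb R^n\times\mathbb R^n$ carry the symplectic form $\sigma((x,\xi),(y,\eta))=y\cdot\xi-x\cdot\eta$ and the measure $dX=(2\pi)^{-n}\,dx\,d\xi$, and put $\langle f,g\rangle=\int_\Xi fg\,dX$ (bilinear, no complex conjugation), $\langle\!\langle F,G\rangle\!\rangle=\int_{\Xi\times\Xi}FG\,dX\,dY$, $\widehat g(Y)=\int_\Xi e^{-i\sigma(Y,Z)}g(Z)\,dZ$, $\mathfrak e_X(Z)=e^{i\sigma(X,Z)}$. Schwartz functions are regarded as tempered distributions through these bilinear forms, and the spaces of tempered distributions carry the weak (pointwise) topology. Let $\#$ be a composition law on $\mathcal S(\Xi)$ such that (A) $\#$ is bilinear, associative and separately continuous, $\overline{f\# g}=\overline g\#\overline f$, and $\int f\# g\,dX=\int fg\,dX$. It is extended to distributions by $\langle T\# g,h\rangle=\langle T,g\# h\rangle$ and $\langle g\# T,h\rangle=\langle T,h\# g\rangle$ for $T\in\mathcal S'(\Xi)$, $g,h\in\mathcal S(\Xi)$; (B) $\mathcal S(\Xi)\#\mathcal S'(\Xi)\#\mathcal S(\Xi)\subset\mathcal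 S(\Xi)$; (C) $\int_\Xi\langle \mathfrak e_{-Z}\# f\#\mathfrak e_Z,g\rangle\,dZ=\int_\Xi f\,dX\int_\Xi g\,dX$ for all $f,g\in\mathcal S(\Xi)$, where $\langle \mathfrak e_{-Z}\# f\#\mathfrak e_Z,g\rangle:=\langle\mathfrak e_{-Z},f\#\mathfrak e_Z\# g\rangle$. Let $\mathbf N$ be the continuous linear map of $\mathcal S(\Xi\times\Xi)$ determined by $\langle\!\langle\mathbf N(f_1\otimes f_2),g_1\otimes g_2\rangle\!\rangle=\langle\widehat g_1\# f_1,\widehat g_2\# f_2\rangle$. Let $\mathbf M$ be the modulation mapping $(\mathbf MF)(X,Y)=(\mathbf NF)(-X,X-Y)$, so that $[\mathbf M(f\otimes g)](X,Y)=\langle\mathfrak e_{-X}\# f,\mathfrak e_{X-Y}\# g\rangle$, and denote its continuous linear extension to $\mathcal S'(\Xi\times\Xi)$ by $\mathbf M$ as well. For a window $h\in\mathcal S(\Xi)\setminus\{0\}$ put $\mathbf M_h(f)=\mathbf M(f\otimes h)$ for $f\in\mathcal S'(\Xi)$, and $\widetilde{\mathbf M}_h=\widetilde J_h\circ\mathbf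 M^{-1}:\mathcal S'(\Xi\times\Xi)\to\mathcal S'(\Xi)$ with $\langle\widetilde J_h(F),f\rangle=\langle\!\langle F,f\otimes h\rangle\!\rangle$. For a vector subspace $\mathfrak L\subset\mathcal S'(\Xi\times\Xi)$ put $\mathfrak L^{\mathbf M}_h=\mathbf M_h^{-1}(\mathfrak L)\subset\mathcal S'(\Xi)$; if $\mathfrak L$ is a Banach space continuously embedded in $\mathcal S'(\Xi\times\Xi)$, then $\mathfrak L^{\mathbf M}_h$ carries the norm $\|f\|_{\mathfrak L^{\mathbf M}_h}=\|\mathbf M_hf\|_{\mathfrak L}$. Then: 0. $\mathbf N$ exists and is unique, $\mathbf M$ has exactly one continuous linear extension to $\mathcal S'(\Xi\times\Xi)$, and this extension is a topological isomorphism. 1. Let $h,k$ be windows with $\langle h,h\rangle=\int_\Xi h^2\,dX\neq0$ (for example $h$ real), and suppose that $(\mathbf M_k\widetilde{\mathbf M}_h)\mathfrak L\subset\mathfrak L$ for a vector subspace $\mathfrak L$ of $\mathcal S'(\Xi\times\Xi)$. Then $\mathfrak L^{\mathbf M}_h\subset\mathfrak L^{\mathbf M}_k$. If, in addition, $\mathfrak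 L$ is a Banach space continuously embedded in $\mathcal S'(\Xi\times\Xi)$, then the embedding of $\mathfrak L^{\mathbf M}_h$ in $\mathfrak L^{\mathbf M}_k$ is continuous. 2. For arbitrary windows $h,k$, without the restriction on $\langle h,h\rangle$, both conclusions of 1 hold under the hypothesis $(\mathbf M_k\widetilde{\mathbf M}_{\overline h})\mathfrak L\subset\mathfrak L$. 3. Let $\mathfrak L$ be a Banach space continuously embedded in $\mathcal S'(\Xi\times\Xi)$ that is admissible, that is, $(\mathbf M_k\widetilde{\mathbf M}_h)\mathfrak L\subset\mathfrak L$ for all windows $h,k$. Then each $\mathfrak L^{\mathbf M}_h$ is a Banach space continuously embedded in $\mathcal S'(\Xi)$, and for all windows $h,k$ one has $\mathfrak L^{\mathbf M}_h=\mathfrak L^{\mathbf M}_k$ as vector spaces and as topological spaces: the induced space does not depend on the window. -/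

import Mathlib

open MeasureTheory SchwartzMap
open scoped ContDiff

set_option linter.unusedSectionVars false

noncomputable section

namespace SchwartzTensor

section Tensor
variable {E F : Type} [NormedAddCommGroup E] [NormedSpace ℝ E] [NormedAddCommGroup F]
  [NormedSpace ℝ F]

theorem norm_iteratedFDeriv_fst_le (f : 𝓢(E, ℂ)) (i : ℕ) (z : E × F) :
    ‖iteratedFDeriv ℝ i (fun z : E × F => f z.1) z‖ ≤ ‖iteratedFDeriv ℝ i f z.1‖ := by
  have h := (ContinuousLinearMap.fst ℝ E F).iteratedFDeriv_comp_right (f.smooth ⊤) z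
    (i := i) (mod_cast le_top)
  have h2 : (fun z : E × F => f z.1) = f ∘ (ContinuousLinearMap.fst ℝ E F) := rfl
  rw [h2, h]
  refine (ContinuousMultilinearMap.norm_compContinuousLinearMap_le _ _).trans ?_
  refine mul_le_of_le_one_right (norm_nonneg _) ?_
  exact Finset.prod_le_one (fun _ _ => norm_nonneg _)
    (fun _ _ => ContinuousLinearMap.norm_fst_le ℝ E F)

theorem norm_iteratedFDeriv_snd_le (f : 𝓢(F, ℂ)) (i : ℕ) (z : E × F) :
    ‖iteratedFDeriv ℝ i (fun z : E × F => f z.2) z‖ ≤ ‖iteratedFDeriv ℝ i f z.2‖ := by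
  have h := (ContinuousLinearMap.snd ℝ E F).iteratedFDeriv_comp_right (f.smooth ⊤) z
    (i := i) (mod_cast le_top)
  have h2 : (fun z : E × F => f z.2) = f ∘ (ContinuousLinearMap.snd ℝ E F) := rfl
  rw [h2, h]
  refine (ContinuousMultilinearMap.norm_compContinuousLinearMap_le _ _).trans ?_
  refine mul_le_of_le_one_right (norm_nonneg _) ?_
  exact Finset.prod_le_one (fun _ _ => norm_nonneg _)
    (fun _ _ => ContinuousLinearMap.norm_snd_le ℝ E F)

theorem contDiff_tensor (f : 𝓢(E, ℂ)) (h : 𝓢(F, ℂ)) :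
    ContDiff ℝ ∞ (fun z : E × F => f z.1 * h z.2) :=
  ((f.smooth ⊤).comp contDiff_fst).mul ((h.smooth ⊤).comp contDiff_snd)

theorem tensor_bound (h : 𝓢(F, ℂ)) (n : ℕ × ℕ) :
    ∃ (s : Finset (ℕ × ℕ)) (C : ℝ), 0 ≤ C ∧ ∀ (f : 𝓢(E, ℂ)) (z : E × F),
      ‖z‖ ^ n.1 * ‖iteratedFDeriv ℝ n.2 (fun z : E × F => f z.1 * h z.2) z‖ ≤
        C * s.sup (schwartzSeminormFamily ℂ E ℂ) f := by
  obtain ⟨k, n⟩ := n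
  refine ⟨Finset.Iic (k, n), ∑ i ∈ Finset.range (n + 1), (n.choose i : ℝ) *
    (SchwartzMap.seminorm ℂ 0 (n - i) h + SchwartzMap.seminorm ℂ k (n - i) h),
    Finset.sum_nonneg fun i _ => mul_nonneg (Nat.cast_nonneg _)
      (add_nonneg (apply_nonneg _ _) (apply_nonneg _ _)), fun f z => ?_⟩
  have hmul := norm_iteratedFDeriv_mul_le (𝕜 := ℝ) (N := ∞)
    ((f.smooth ⊤).comp (contDiff_fst (E := E) (F := F)))
    ((h.smooth ⊤).comp (contDiff_snd (E := E) (F := F))) z (n := n) (mod_cast le_top)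
  refine (mul_le_mul_of_nonneg_left hmul (by positivity)).trans ?_
  rw [Finset.mul_sum, Finset.sum_mul]
  refine Finset.sum_le_sum fun i hi => ?_
  have hi' : i ≤ n := Nat.lt_succ_iff.mp (Finset.mem_range.mp hi)
  set P := (Finset.Iic (k, n)).sup (schwartzSeminormFamily ℂ E ℂ) f with hP
  have hle : ∀ a ≤ k, ‖z.1‖ ^ a * ‖iteratedFDeriv ℝ i f z.1‖ ≤ P := fun a ha =>
    (f.le_seminorm ℂ a i z.1).trans
      (Seminorm.le_def.mp (Finset.le_sup (f := schwartzSeminormFamily ℂ E ℂ)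
        (Finset.mem_Iic.mpr (show (a, i) ≤ (k, n) from ⟨ha, hi'⟩))) f)
  have h0 := hle 0 (Nat.zero_le _)
  have hk := hle k le_rfl
  have g0 := h.le_seminorm ℂ 0 (n - i) z.2
  have gk := h.le_seminorm ℂ k (n - i) z.2
  rw [pow_zero, one_mul] at h0 g0
  have e1 := norm_iteratedFDeriv_fst_le (F := F) f i z
  have e2 := norm_iteratedFDeriv_snd_le (E := E) h (n - i) z
  have hP0 : 0 ≤ P := (norm_nonneg _).trans h0
  have hz : ‖z‖ ^ k ≤ ‖z.1‖ ^ k + ‖z.2‖ ^ k := by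
    rw [Prod.norm_def]
    rcases max_choice ‖z.1‖ ‖z.2‖ with h | h <;> rw [h]
    · exact le_add_of_nonneg_right (by positivity)
    · exact le_add_of_nonneg_left (by positivity)
  have hmain : ‖z‖ ^ k * (‖iteratedFDeriv ℝ i (fun z : E × F => f z.1) z‖ *
      ‖iteratedFDeriv ℝ (n - i) (fun z : E × F => h z.2) z‖) ≤
      (SchwartzMap.seminorm ℂ 0 (n - i) h + SchwartzMap.seminorm ℂ k (n - i) h) * P := by
    calc _ ≤ (‖z.1‖ ^ k + ‖z.2‖ ^ k) * (‖iteratedFDeriv ℝ i f z.1‖ *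
          ‖iteratedFDeriv ℝ (n - i) h z.2‖) := by gcongr
      _ = (‖z.1‖ ^ k * ‖iteratedFDeriv ℝ i f z.1‖) * ‖iteratedFDeriv ℝ (n - i) h z.2‖ +
          ‖iteratedFDeriv ℝ i f z.1‖ * (‖z.2‖ ^ k * ‖iteratedFDeriv ℝ (n - i) h z.2‖) := by ring
      _ ≤ P * SchwartzMap.seminorm ℂ 0 (n - i) h + P * SchwartzMap.seminorm ℂ k (n - i) h := by
          gcongr
      _ = _ := by ring
  calc _ = (n.choose i : ℝ) * (‖z‖ ^ k * (‖iteratedFDeriv ℝ i (fun z : E × F => f z.1) z‖ *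
      ‖iteratedFDeriv ℝ (n - i) (fun z : E × F => h z.2) z‖)) := by
        simp only [Function.comp_def]; ring
    _ ≤ (n.choose i : ℝ) * ((SchwartzMap.seminorm ℂ 0 (n - i) h +
        SchwartzMap.seminorm ℂ k (n - i) h) * P) := by gcongr
    _ = _ := by ring

/-- The map `f ↦ f ⊗ h` between Schwartz spaces, `(f ⊗ h)(x, y) = f x * h y`. -/
def tensorRight (h : 𝓢(F, ℂ)) : 𝓢(E, ℂ) →L[ℂ] 𝓢(E × F, ℂ) :=
  mkCLM (fun f z => f z.1 * h z.2) (fun f g z => by simp [add_mul])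
    (fun a f z => by simp [mul_assoc]) (fun f => contDiff_tensor f h) (tensor_bound h)

@[simp]
theorem tensorRight_apply (h : 𝓢(F, ℂ)) (f : 𝓢(E, ℂ)) (z : E × F) :
    tensorRight h f z = f z.1 * h z.2 := rfl

end Tensor

section PartialIntegral
variable {E F : Type} [NormedAddCommGroup E] [NormedSpace ℝ E] [NormedAddCommGroup F]
  [NormedSpace ℝ F] [MeasurableSpace F] [BorelSpace F] [SecondCountableTopology F]
  (μ : Measure F) [hμ : μ.HasTemperateGrowth]

theorem norm_pow_mul_iteratedFDeriv_le {V : Type} [NormedAddCommGroup V] [NormedSpace ℝ V]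
    [NormedSpace ℂ V] [SMulCommClass ℝ ℂ V] (G : 𝓢(E × F, V)) (k n : ℕ) (x : E) (y : F) :
    ‖x‖ ^ k * ‖iteratedFDeriv ℝ n G (x, y)‖ ≤
      2 ^ (k + μ.integrablePower) *
        (Finset.Iic (k + μ.integrablePower, n)).sup (schwartzSeminormFamily ℂ (E × F) V) G *
        (1 + ‖y‖) ^ (-(μ.integrablePower : ℝ)) := by
  have h := one_add_le_sup_seminorm_apply (𝕜 := ℂ) (m := (k + μ.integrablePower, n)) le_rfl le_rfl
    G (x, y)
  rw [Real.rpow_neg (by positivity), Real.rpow_natCast, ← div_eq_mul_inv,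
    le_div_iff₀ (by positivity)]
  refine le_trans ?_ h
  rw [pow_add]
  have hx : ‖x‖ ≤ 1 + ‖(x, y)‖ := (norm_fst_le (x, y)).trans (by linarith)
  have hy : 1 + ‖y‖ ≤ 1 + ‖(x, y)‖ := by linarith [norm_snd_le (x, y)]
  calc _ = ‖x‖ ^ k * (1 + ‖y‖) ^ μ.integrablePower * ‖iteratedFDeriv ℝ n G (x, y)‖ := by ring
    _ ≤ _ := by gcongr

theorem integrable_slice_iteratedFDeriv {V : Type} [NormedAddCommGroup V] [NormedSpace ℝ V]
    [NormedSpace ℂ V] [SMulCommClass ℝ ℂ V] (G : 𝓢(E × F, V)) (n : ℕ) (x : E) :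
    Integrable (fun y => iteratedFDeriv ℝ n G (x, y)) μ := by
  refine Integrable.mono' ((Measure.integrable_pow_neg_integrablePower μ).const_mul
    (2 ^ (0 + μ.integrablePower) * (Finset.Iic (0 + μ.integrablePower, n)).sup
      (schwartzSeminormFamily ℂ (E × F) V) G)) ?_ (.of_forall fun y => ?_)
  · have : Continuous (fun y => iteratedFDeriv ℝ n G (x, y)) :=
      ((G.smooth ⊤).continuous_iteratedFDeriv (mod_cast le_top)).comp (by fun_prop)
    exact this.aestronglyMeasurable
  · simpa using norm_pow_mul_iteratedFDeriv_le μ G 0 n x y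

theorem integrable_slice {V : Type} [NormedAddCommGroup V] [NormedSpace ℝ V]
    [NormedSpace ℂ V] [SMulCommClass ℝ ℂ V] (G : 𝓢(E × F, V)) (x : E) :
    Integrable (fun y => G (x, y)) μ := by
  have h := (integrable_slice_iteratedFDeriv μ G 0 x).norm
  simp only [norm_iteratedFDeriv_zero] at h
  refine (integrable_norm_iff ?_).mp h
  exact (G.continuous.comp (by fun_prop : Continuous fun y : F => (x, y))).aestronglyMeasurable

/-- The partial derivative in the first variable. -/
def fderivFst {V : Type} [NormedAddCommGroup V] [NormedSpace ℝ V]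
    (G : 𝓢(E × F, V)) : 𝓢(E × F, E →L[ℝ] V) :=
  postcompCLM (ContinuousLinearMap.precomp V (ContinuousLinearMap.inl ℝ E F))
    (fderivCLM ℝ (E × F) V G)

theorem fderivFst_apply {V : Type} [NormedAddCommGroup V] [NormedSpace ℝ V]
    (G : 𝓢(E × F, V)) (z : E × F) :
    fderivFst G z = (fderiv ℝ G z).comp (ContinuousLinearMap.inl ℝ E F) := rfl

theorem norm_iteratedFDeriv_fderivFst_le {V : Type} [NormedAddCommGroup V] [NormedSpace ℝ V]
    (G : 𝓢(E × F, V)) (n : ℕ) (z : E × F) :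
    ‖iteratedFDeriv ℝ n (fderivFst G) z‖ ≤ ‖iteratedFDeriv ℝ (n + 1) G z‖ := by
  have h2 : (fderivFst G : E × F → E →L[ℝ] V) =
    (ContinuousLinearMap.precomp V (ContinuousLinearMap.inl ℝ E F)) ∘ (fderiv ℝ G) := rfl
  rw [h2, ← norm_iteratedFDeriv_fderiv]
  have hd : ContDiff ℝ ∞ (fderiv ℝ G) := (fderivCLM ℝ (E × F) V G).smooth ⊤
  refine ((ContinuousLinearMap.precomp V (ContinuousLinearMap.inl ℝ E F)).norm_iteratedFDeriv_comp_left
    hd.contDiffAt (n := n) (mod_cast le_top)).trans ?_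
  refine mul_le_of_le_one_left (norm_nonneg _) ?_
  refine ContinuousLinearMap.opNorm_le_bound _ zero_le_one fun T => ?_
  rw [one_mul]
  refine (ContinuousLinearMap.opNorm_comp_le T _).trans ?_
  exact mul_le_of_le_one_right (norm_nonneg _) (ContinuousLinearMap.norm_inl_le_one ℝ E F)

theorem hasFDerivAt_partialIntegral {V : Type} [NormedAddCommGroup V] [NormedSpace ℝ V]
    [NormedSpace ℂ V] [SMulCommClass ℝ ℂ V] (G : 𝓢(E × F, V)) (x : E) :
    HasFDerivAt (fun x => ∫ y, G (x, y) ∂μ) (∫ y, fderivFst G (x, y) ∂μ) x := by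
  refine hasFDerivAt_integral_of_dominated_of_fderiv_le (𝕜 := ℝ) (s := Set.univ)
    (F' := fun x y => fderivFst G (x, y))
    (bound := fun y => 2 ^ (0 + μ.integrablePower) * (Finset.Iic (0 + μ.integrablePower, 0)).sup
      (schwartzSeminormFamily ℂ (E × F) (E →L[ℝ] V)) (fderivFst G) *
        (1 + ‖y‖) ^ (-(μ.integrablePower : ℝ)))
    Filter.univ_mem (.of_forall fun x => (integrable_slice μ G x).aestronglyMeasurable)
    (integrable_slice μ G x) (integrable_slice μ (fderivFst G) x).aestronglyMeasurable
    (.of_forall fun y x _ => ?_) ((Measure.integrable_pow_neg_integrablePower μ).const_mul _)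
    (.of_forall fun y x _ => ?_)
  · simpa using norm_pow_mul_iteratedFDeriv_le μ (fderivFst G) 0 0 x y
  · exact (G.hasFDerivAt (x, y)).comp x (hasFDerivAt_prodMk_left x y)

theorem partialIntegral_aux (n : ℕ) : ∀ {V : Type} [NormedAddCommGroup V] [NormedSpace ℝ V]
    [NormedSpace ℂ V] [SMulCommClass ℝ ℂ V] (G : 𝓢(E × F, V)),
    ContDiff ℝ n (fun x => ∫ y, G (x, y) ∂μ) ∧ ∀ x,
      ‖iteratedFDeriv ℝ n (fun x => ∫ y, G (x, y) ∂μ) x‖ ≤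
        ∫ y, ‖iteratedFDeriv ℝ n G (x, y)‖ ∂μ := by
  induction n with
  | zero =>
    intro V _ _ _ _ G
    refine ⟨?_, fun x => ?_⟩
    · rw [Nat.cast_zero, contDiff_zero]
      exact continuous_iff_continuousAt.mpr fun x =>
        (hasFDerivAt_partialIntegral μ G x).continuousAt
    · simp only [norm_iteratedFDeriv_zero]
      exact norm_integral_le_integral_norm _
  | succ n ih =>
    intro V _ _ _ _ G
    obtain ⟨h1, h2⟩ := ih (fderivFst G)
    refine ⟨?_, fun x => ?_⟩
    · rw [Nat.cast_succ]
      exact contDiff_succ_iff_hasFDerivAt.mpr ⟨_, h1, hasFDerivAt_partialIntegral μ G⟩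
    · have hfd : fderiv ℝ (fun x => ∫ y, G (x, y) ∂μ) = fun x => ∫ y, fderivFst G (x, y) ∂μ :=
        funext fun x => (hasFDerivAt_partialIntegral μ G x).fderiv
      rw [← norm_iteratedFDeriv_fderiv, hfd]
      refine (h2 x).trans (integral_mono (integrable_slice_iteratedFDeriv μ _ n x).norm
        (integrable_slice_iteratedFDeriv μ G (n + 1) x).norm fun y => ?_)
      exact norm_iteratedFDeriv_fderivFst_le G n (x, y)

theorem partialIntegral_bound (n : ℕ × ℕ) :
    ∃ (s : Finset (ℕ × ℕ)) (C : ℝ), 0 ≤ C ∧ ∀ (G : 𝓢(E × F, ℂ)) (x : E),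
      ‖x‖ ^ n.1 * ‖iteratedFDeriv ℝ n.2 (fun x => ∫ y, G (x, y) ∂μ) x‖ ≤
        C * s.sup (schwartzSeminormFamily ℂ (E × F) ℂ) G := by
  obtain ⟨k, n⟩ := n
  refine ⟨Finset.Iic (k + μ.integrablePower, n), 2 ^ (k + μ.integrablePower) *
    ∫ y, (1 + ‖y‖) ^ (-(μ.integrablePower : ℝ)) ∂μ,
    mul_nonneg (by positivity) (integral_nonneg fun y => by positivity), fun G x => ?_⟩
  refine (mul_le_mul_of_nonneg_left ((partialIntegral_aux μ n G).2 x) (by positivity)).trans ?_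
  rw [← integral_const_mul]
  refine (integral_mono ((integrable_slice_iteratedFDeriv μ G n x).norm.const_mul _)
    ((Measure.integrable_pow_neg_integrablePower μ).const_mul _)
    fun y => norm_pow_mul_iteratedFDeriv_le μ G k n x y).trans_eq ?_
  rw [integral_const_mul]
  ring

/-- Integration of a Schwartz function of two variables in the second one. -/
def partialIntegral : 𝓢(E × F, ℂ) →L[ℂ] 𝓢(E, ℂ) :=
  mkCLM (fun G x => ∫ y, G (x, y) ∂μ)
    (fun f g x => integral_add (integrable_slice μ f x) (integrable_slice μ g x))
    (fun a _ _ => integral_const_mul a _)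
    (fun G => contDiff_infty.mpr fun n => (partialIntegral_aux μ n G).1)
    (partialIntegral_bound μ)

/-- The map `F ↦ ∫ F(·, y) h(y) dy`, the transpose of `T ↦ T ⊗ h`. -/
def slicePairing (h : 𝓢(F, ℂ)) : 𝓢(E × F, ℂ) →L[ℂ] 𝓢(E, ℂ) :=
  (partialIntegral μ).comp (smulLeftCLM ℂ fun z : E × F => h z.2)

theorem slicePairing_apply (h : 𝓢(F, ℂ)) (G : 𝓢(E × F, ℂ)) (x : E) :
    slicePairing μ h G x = ∫ y, h y * G (x, y) ∂μ := by
  have hg : (fun z : E × F => h z.2).HasTemperateGrowth :=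
    h.hasTemperateGrowth.comp (ContinuousLinearMap.snd ℝ E F).hasTemperateGrowth
  change ∫ y, smulLeftCLM ℂ (fun z : E × F => h z.2) G (x, y) ∂μ = _
  simp [smulLeftCLM_apply_apply hg]

end PartialIntegral

end SchwartzTensor

namespace PhaseSpace

/-- The phase space `Ξ = ℝⁿ × ℝⁿ`; `X (.inl i)` are the positions `x`, `X (.inr i)` the momenta `ξ`. -/
abbrev Xi (n : ℕ) : Type := EuclideanSpace ℝ (Fin n ⊕ Fin n)

variable {n : ℕ}

/-- The symplectic form `σ((x, ξ), (y, η)) = y · ξ - x · η`. -/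
def sigma (X Y : Xi n) : ℝ := ∑ i, (Y (.inl i) * X (.inr i) - X (.inl i) * Y (.inr i))

/-- The Haar measure `dX` on `Ξ` for which the symplectic Fourier transformation is unitary:
`(2π)⁻ⁿ` times the Lebesgue measure. -/
def dX (n : ℕ) : Measure (Xi n) := ENNReal.ofReal ((2 * Real.pi) ^ n)⁻¹ • volume

instance : (dX n).IsAddHaarMeasure :=
  Measure.IsAddHaarMeasure.smul _ (by simp; positivity) ENNReal.ofReal_ne_top

/-- The product measure `dX dY` on `Ξ × Ξ`. -/
abbrev dXdY (n : ℕ) : Measure (Xi n × Xi n) := (dX n).prod (dX n)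

instance : SigmaFinite (dX n) := inferInstance

instance : (dXdY n).IsAddHaarMeasure := Measure.prod.instIsAddHaarMeasure _ _

/-- Complex conjugation on the Schwartz space. -/
def conjS (f : 𝓢(Xi n, ℂ)) : 𝓢(Xi n, ℂ) :=
  postcompCLM (Complex.conjCLE : ℂ →L[ℝ] ℂ) f

/-- The bilinear form `⟨f, g⟩ = ∫ f g` on `𝓢(Ξ)`. -/
def pair (f g : 𝓢(Xi n, ℂ)) : ℂ := ∫ X, f X * g X ∂dX n

/-- The bilinear form `⟪F, G⟫ = ∫∫ F G` on `𝓢(Ξ × Ξ)`. -/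
def pair₂ (F G : 𝓢(Xi n × Xi n, ℂ)) : ℂ := ∫ Z, F Z * G Z ∂dXdY n

/-- The embedding `𝓢(Ξ) ⊂ 𝓢'(Ξ)` given by `⟨·, ·⟩`. -/
def toDist (f : 𝓢(Xi n, ℂ)) : 𝓢'(Xi n, ℂ) := toTemperedDistributionCLM (Xi n) ℂ (dX n) f

theorem toDist_apply (f g : 𝓢(Xi n, ℂ)) : toDist f g = pair f g := by
  simp [toDist, pair, mul_comm]

/-- The embedding `𝓢(Ξ × Ξ) ⊂ 𝓢'(Ξ × Ξ)` given by `⟪·, ·⟫`. -/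
def toDist₂ (F : 𝓢(Xi n × Xi n, ℂ)) : 𝓢'(Xi n × Xi n, ℂ) :=
  toTemperedDistributionCLM (Xi n × Xi n) ℂ (dXdY n) F

theorem toDist₂_apply (F G : 𝓢(Xi n × Xi n, ℂ)) : toDist₂ F G = pair₂ F G := by
  simp [toDist₂, pair₂, mul_comm]

/-- The linear change of variables `(y, η) ↦ (2π)⁻¹ (η, -y)`. -/
def symplecticJ (n : ℕ) : Xi n ≃L[ℝ] Xi n :=
  LinearEquiv.toContinuousLinearEquiv
    { toFun := fun Y => WithLp.toLp 2 (Sum.elim (fun i => (2 * Real.pi)⁻¹ * Y (.inr i))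
        (fun i => -((2 * Real.pi)⁻¹ * Y (.inl i))))
      invFun := fun Y => WithLp.toLp 2 (Sum.elim (fun i => -(2 * Real.pi * Y (.inr i)))
        (fun i => 2 * Real.pi * Y (.inl i)))
      map_add' := fun X Y => by ext (i | i) <;> simp <;> ring
      map_smul' := fun c X => by ext (i | i) <;> simp <;> ring
      left_inv := fun X => by ext (i | i) <;> simp <;> field_simp
      right_inv := fun X => by ext (i | i) <;> simp <;> field_simp }

/-- The symplectic Fourier transformation on `𝓢(Ξ)`, see `symplecticFourier_apply`. -/
def symplecticFourier : 𝓢(Xi n, ℂ) →L[ℂ] 𝓢(Xi n, ℂ) :=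
  (((2 * Real.pi) ^ n)⁻¹ : ℂ) •
    (compCLMOfContinuousLinearEquiv ℂ (symplecticJ n)).comp (fourierTransformCLM ℂ)

theorem symplecticFourier_apply (f : 𝓢(Xi n, ℂ)) (Y : Xi n) :
    symplecticFourier f Y = ∫ Z, Complex.exp (-(Complex.I * sigma Y Z)) * f Z ∂dX n := by
  have h : symplecticFourier f Y =
      (((2 * Real.pi) ^ n)⁻¹ : ℂ) * (FourierTransform.fourier (f : Xi n → ℂ)) (symplecticJ n Y) := rfl
  rw [h, Real.fourier_eq', dX, integral_smul_measure, ENNReal.toReal_ofReal (by positivity),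
    Complex.real_smul]
  push_cast
  congr 1
  refine integral_congr_ae (.of_forall fun Z => ?_)
  simp only [smul_eq_mul]
  congr 2
  have : 2 * Real.pi * inner ℝ Z (symplecticJ n Y) = sigma Y Z := by
    have hp : (2 * Real.pi) ≠ 0 := by positivity
    rw [PiLp.inner_apply, Fintype.sum_sum_type, ← Finset.sum_add_distrib, Finset.mul_sum, sigma]
    refine Finset.sum_congr rfl fun i _ => ?_
    simp only [symplecticJ, LinearEquiv.coe_toContinuousLinearEquiv', LinearEquiv.coe_mk,
      LinearMap.coe_mk, AddHom.coe_mk, Sum.elim_inl, Sum.elim_inr, RCLike.inner_apply, conj_trivial]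
    field_simp
    ring
  rw [← this]
  push_cast
  ring

/-- The tempered distribution `e_X = 𝔉 δ_X`, i.e. the function `Z ↦ exp(i σ(X, Z))`;
see `expDist_apply`. -/
def expDist (X : Xi n) : 𝓢'(Xi n, ℂ) :=
  PointwiseConvergenceCLM.precomp ℂ symplecticFourier (TemperedDistribution.delta (-X))

theorem expDist_apply (X : Xi n) (h : 𝓢(Xi n, ℂ)) :
    expDist X h = ∫ Z, Complex.exp (Complex.I * sigma X Z) * h Z ∂dX n := by
  change symplecticFourier h (-X) = _
  rw [symplecticFourier_apply]
  refine integral_congr_ae (.of_forall fun Z => ?_)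
  have : sigma (-X) Z = -sigma X Z := by
    rw [sigma, sigma, ← Finset.sum_neg_distrib]
    refine Finset.sum_congr rfl fun i _ => ?_
    simp only [PiLp.neg_apply]
    ring
  simp [this]

/-- The elementary tensor `f ⊗ g` in `𝓢(Ξ × Ξ)`. -/
def tensor (f g : 𝓢(Xi n, ℂ)) : 𝓢(Xi n × Xi n, ℂ) := SchwartzTensor.tensorRight g f

/-- `J_h : 𝓢'(Ξ) → 𝓢'(Ξ × Ξ)`, `J_h f = f ⊗ h`, that is
`⟪f ⊗ h, F⟫ = ⟨f, X ↦ ∫ h(Y) F(X, Y) dY⟩`. -/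
def J (h : 𝓢(Xi n, ℂ)) : 𝓢'(Xi n, ℂ) →L[ℂ] 𝓢'(Xi n × Xi n, ℂ) :=
  PointwiseConvergenceCLM.precomp ℂ (SchwartzTensor.slicePairing (dX n) h)

/-- `J̃_h : 𝓢'(Ξ × Ξ) → 𝓢'(Ξ)`, `⟨J̃_h F, f⟩ = ⟪F, f ⊗ h⟫`. -/
def Jt (h : 𝓢(Xi n, ℂ)) : 𝓢'(Xi n × Xi n, ℂ) →L[ℂ] 𝓢'(Xi n, ℂ) :=
  PointwiseConvergenceCLM.precomp ℂ (SchwartzTensor.tensorRight h)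

/-- The change of variables `C(X, Y) = (-X, X - Y)` of `Ξ × Ξ`. -/
def changeVar (n : ℕ) : (Xi n × Xi n) ≃L[ℝ] (Xi n × Xi n) :=
  LinearEquiv.toContinuousLinearEquiv
    { toFun := fun Z => (-Z.1, Z.1 - Z.2)
      invFun := fun Z => (-Z.1, -Z.1 - Z.2)
      map_add' := fun Z W => by ext <;> simp <;> ring
      map_smul' := fun c Z => by simp [smul_sub]
      left_inv := fun Z => by simp
      right_inv := fun Z => by simp }

/-- A composition law `#` on `𝓢(Ξ)`: bilinear, separately continuous, associative, a `*`-algebra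
product for the complex conjugation, and such that `∫ f # g = ∫ f g`. -/
structure CompositionLaw (n : ℕ) where
  /-- The product `f # g`. -/
  mul : 𝓢(Xi n, ℂ) →ₗ[ℂ] 𝓢(Xi n, ℂ) →ₗ[ℂ] 𝓢(Xi n, ℂ)
  continuous_left : ∀ g, Continuous fun f => mul f g
  continuous_right : ∀ f, Continuous fun g => mul f g
  assoc : ∀ f g h, mul (mul f g) h = mul f (mul g h)
  conj_mul : ∀ f g, conjS (mul f g) = mul (conjS g) (conjS f)
  integral_mul : ∀ f g, ∫ X, mul f g X ∂dX n = ∫ X, f X * g X ∂dX n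

namespace CompositionLaw

variable (P : CompositionLaw n)

/-- `g ↦ f # g`. -/
def leftMul (f : 𝓢(Xi n, ℂ)) : 𝓢(Xi n, ℂ) →L[ℂ] 𝓢(Xi n, ℂ) :=
  ⟨P.mul f, P.continuous_right f⟩

/-- `f ↦ f # g`. -/
def rightMul (g : 𝓢(Xi n, ℂ)) : 𝓢(Xi n, ℂ) →L[ℂ] 𝓢(Xi n, ℂ) :=
  ⟨P.mul.flip g, P.continuous_left g⟩

/-- `T # g` for a tempered distribution `T`: `⟨T # g, h⟩ = ⟨T, g # h⟩`. -/
def distMul (T : 𝓢'(Xi n, ℂ)) (g : 𝓢(Xi n, ℂ)) : 𝓢'(Xi n, ℂ) :=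
  PointwiseConvergenceCLM.precomp ℂ (P.leftMul g) T

/-- `g # T` for a tempered distribution `T`: `⟨g # T, h⟩ = ⟨T, h # g⟩`. -/
def mulDist (g : 𝓢(Xi n, ℂ)) (T : 𝓢'(Xi n, ℂ)) : 𝓢'(Xi n, ℂ) :=
  PointwiseConvergenceCLM.precomp ℂ (P.rightMul g) T

/-- The hypothesis `𝓢(Ξ) # 𝓢'(Ξ) # 𝓢(Ξ) ⊂ 𝓢(Ξ)`. -/
def Regularizing : Prop :=
  ∀ (f g : 𝓢(Xi n, ℂ)) (T : 𝓢'(Xi n, ℂ)),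
    ∃ u : 𝓢(Xi n, ℂ), toDist u = P.distMul (P.mulDist f T) g

variable {P}

/-- The Schwartz function `f # T # g`. -/
def sandwich (hB : P.Regularizing) (f : 𝓢(Xi n, ℂ)) (T : 𝓢'(Xi n, ℂ)) (g : 𝓢(Xi n, ℂ)) :
    𝓢(Xi n, ℂ) := (hB f g T).choose

/-- The pairing `⟨Θ_Z(f), g⟩` of the distribution `Θ_Z(f) = e_{-Z} # f # e_Z` with `g`, where
`⟨T₁ # f # T₂, g⟩ = ⟨T₁, f # T₂ # g⟩` for tempered distributions `T₁, T₂`. -/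
def thetaPair (hB : P.Regularizing) (Z : Xi n) (f g : 𝓢(Xi n, ℂ)) : ℂ :=
  expDist (-Z) (sandwich hB f (expDist Z) g)

/-- The hypothesis `∫∫ [Θ_Z(f)](Y) g(Y) dY dZ = ∫ f ∫ g`. -/
def Orthogonality (hB : P.Regularizing) : Prop :=
  ∀ f g : 𝓢(Xi n, ℂ), ∫ Z, thetaPair hB Z f g ∂dX n = (∫ Z, f Z ∂dX n) * ∫ Y, g Y ∂dX n

variable (P)

/-- The property that determines the map `𝐍` on `𝓢(Ξ × Ξ)`:
`⟪𝐍(f₁ ⊗ f₂), g₁ ⊗ g₂⟫ = ⟨ĝ₁ # f₁, ĝ₂ # f₂⟩`. -/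
def IsNMap (N : 𝓢(Xi n × Xi n, ℂ) →L[ℂ] 𝓢(Xi n × Xi n, ℂ)) : Prop :=
  ∀ f₁ f₂ g₁ g₂ : 𝓢(Xi n, ℂ), pair₂ (N (tensor f₁ f₂)) (tensor g₁ g₂) =
    pair (P.mul (symplecticFourier g₁) f₁) (P.mul (symplecticFourier g₂) f₂)

open Classical in
/-- The map `𝐍` on `𝓢(Ξ × Ξ)`. -/
def NMap : 𝓢(Xi n × Xi n, ℂ) →L[ℂ] 𝓢(Xi n × Xi n, ℂ) :=
  if h : ∃ N, P.IsNMap N then h.choose else 0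

/-- The modulation mapping `𝐌` on `𝓢(Ξ × Ξ)`: `[𝐌 F](X, Y) = [𝐍 F](-X, X - Y)`. -/
def MMap : 𝓢(Xi n × Xi n, ℂ) →L[ℂ] 𝓢(Xi n × Xi n, ℂ) :=
  (compCLMOfContinuousLinearEquiv ℂ (changeVar n)).comp P.NMap

/-- `T` is a continuous extension of `𝐌` to `𝓢'(Ξ × Ξ)`. -/
def IsMExtension (T : 𝓢'(Xi n × Xi n, ℂ) →L[ℂ] 𝓢'(Xi n × Xi n, ℂ)) : Prop :=
  ∀ F : 𝓢(Xi n × Xi n, ℂ), T (toDist₂ F) = toDist₂ (P.MMap F)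

open Classical in
/-- The modulation mapping `𝐌` on `𝓢'(Ξ × Ξ)`. -/
def M : 𝓢'(Xi n × Xi n, ℂ) →L[ℂ] 𝓢'(Xi n × Xi n, ℂ) :=
  if h : ∃ T, P.IsMExtension T then h.choose else 0

/-- The modulation mapping is well defined: `𝐍` exists and is unique, `𝐌` has exactly one
continuous linear extension to `𝓢'(Ξ × Ξ)`, and this is a topological isomorphism. -/
def ModulationWellDefined : Prop :=
  (∃! N, P.IsNMap N) ∧ (∃! T, P.IsMExtension T) ∧ P.M.IsInvertible

/-- `𝐌_h : 𝓢'(Ξ) → 𝓢'(Ξ × Ξ)`, `𝐌_h f = 𝐌(f ⊗ h)`. -/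
def Mw (h : 𝓢(Xi n, ℂ)) : 𝓢'(Xi n, ℂ) →L[ℂ] 𝓢'(Xi n × Xi n, ℂ) := P.M.comp (J h)

/-- `𝐌̃_h = J̃_h ∘ 𝐌⁻¹ : 𝓢'(Ξ × Ξ) → 𝓢'(Ξ)`. -/
def Mt (h : 𝓢(Xi n, ℂ)) : 𝓢'(Xi n × Xi n, ℂ) →L[ℂ] 𝓢'(Xi n, ℂ) := (Jt h).comp P.M.inverse

/-- The induced space `𝔏_h = 𝐌_h⁻¹(𝔏)` of a vector subspace `𝔏` of `𝓢'(Ξ × Ξ)`. -/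
def induced (L : Submodule ℂ 𝓢'(Xi n × Xi n, ℂ)) (h : 𝓢(Xi n, ℂ)) : Submodule ℂ 𝓢'(Xi n, ℂ) :=
  L.comap (P.Mw h).toLinearMap

end CompositionLaw

/-- A continuous embedding of the normed space `𝔏` into `𝓢'(Ξ × Ξ)`. -/
structure DistEmbedding (n : ℕ) (𝔏 : Type*) [NormedAddCommGroup 𝔏] [NormedSpace ℂ 𝔏] where
  /-- The embedding. -/
  toCLM : 𝔏 →L[ℂ] 𝓢'(Xi n × Xi n, ℂ)
  injective : Function.Injective toCLM

namespace DistEmbedding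

variable {𝔏 : Type*} [NormedAddCommGroup 𝔏] [NormedSpace ℂ 𝔏]

/-- `𝔏` as a vector subspace of `𝓢'(Ξ × Ξ)`. -/
def space (ι : DistEmbedding n 𝔏) : Submodule ℂ 𝓢'(Xi n × Xi n, ℂ) :=
  LinearMap.range ι.toCLM.toLinearMap

/-- The induced space `𝔏_h`, as a type of its own that carries the norm `‖f‖ = ‖𝐌_h f‖_𝔏`. -/
def Induced (P : CompositionLaw n) (ι : DistEmbedding n 𝔏) (h : 𝓢(Xi n, ℂ)) : Type :=
  ↥(P.induced ι.space h)

variable (P : CompositionLaw n) (ι : DistEmbedding n 𝔏) (h : 𝓢(Xi n, ℂ))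

instance : AddCommGroup (ι.Induced P h) := inferInstanceAs (AddCommGroup ↥(P.induced ι.space h))

instance : Module ℂ (ι.Induced P h) := inferInstanceAs (Module ℂ ↥(P.induced ι.space h))

variable {P ι h}

/-- An element of the induced space, as a tempered distribution. -/
def Induced.toDist : ι.Induced P h →ₗ[ℂ] 𝓢'(Xi n, ℂ) := (P.induced ι.space h).subtype

/-- `𝐌_h f` as an element of `𝔏`. -/
def Induced.image : ι.Induced P h →ₗ[ℂ] 𝔏 :=
  (LinearEquiv.ofInjective ι.toCLM.toLinearMap ι.injective).symm.toLinearMap.comp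
    ((P.Mw h).toLinearMap.restrict (p := P.induced ι.space h) (q := ι.space) fun _ hf => hf)

theorem Induced.toCLM_image (f : ι.Induced P h) : ι.toCLM f.image = P.Mw h f.toDist :=
  congrArg Subtype.val ((LinearEquiv.ofInjective ι.toCLM.toLinearMap ι.injective).apply_symm_apply
    ((P.Mw h).toLinearMap.restrict (p := P.induced ι.space h) (q := ι.space) (fun _ hf => hf) f))

instance : SeminormedAddCommGroup (ι.Induced P h) :=
  SeminormedAddCommGroup.induced (ι.Induced P h) 𝔏 (Induced.image (ι := ι) (P := P) (h := h))

theorem Induced.norm_def (f : ι.Induced P h) : ‖f‖ = ‖f.image‖ := rfl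

instance : NormedSpace ℂ (ι.Induced P h) :=
  NormedSpace.induced ℂ (ι.Induced P h) 𝔏 (Induced.image (ι := ι) (P := P) (h := h))

/-- `𝔏` is admissible: `(𝐌_k 𝐌̃_h) 𝔏 ⊂ 𝔏` for all windows `h, k`. -/
def Admissible (P : CompositionLaw n) (ι : DistEmbedding n 𝔏) : Prop :=
  ∀ h k : 𝓢(Xi n, ℂ), h ≠ 0 → k ≠ 0 → ∀ G ∈ ι.space, P.Mw k (P.Mt h G) ∈ ι.space

end DistEmbedding

end PhaseSpace

end

open PhaseSpace

open Filter Topology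

noncomputable section

/-! Let q(f₁, g, f₂, h) = ∫ f₁ # g # f₂ # h (`quad`). Associativity and ∫ u # v = ∫ uv make q
cyclically invariant, and ⟨f₁ # T # f₂, h⟩ = T(f₂ # h # f₁). Everything rests on a continuous map W
of 𝓢(Ξ × Ξ) with ⟪W(f₁ ⊗ f₂), g ⊗ h⟫ = q(f₁, g, f₂, h): the map T ↦ f₁ # T # f₂ has a Schwartz
kernel.

Existence of W (`exists_wMap`). Schwartz functions have expansions f = Σ (∫ θⱼ f) φⱼ with rapidly
decreasing coefficients (`SchwartzFrame`). By (B), for each T the numbers T(f₂ # θₖ # f₁) are the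
coefficients of the Schwartz function f₁ # T # f₂, hence rapidly decreasing in k. Letting T run
through the superpositions Σ tⱼ ρⱼᴺ θⱼ with t in ℓ¹, uniform boundedness gives joint rapid decrease
of q(f₁, θⱼ, f₂, θₖ) in (j, k) (`exists_pow_mul_norm_coeff_le`). A second Banach–Steinhaus argument,
on the barrelled space 𝓢(Ξ), controls the dependence on f₁ and f₂ (`exists_quad_bound`), so the
double series defines W.

Invertibility. By cyclicity the transpose of W is flip ∘ W. By Fourier inversion at 0, (C) says that
the kernel W(f₁ ⊗ f₂) has trace ∫ f₁ ∫ f₂ (`traceCLM_wMap`). Inserting g # f₁ and f₂ # h polarises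
this to ⟪W F, flip W G⟫ = ⟪F, G⟫, so flip ∘ W is an involution. Now 𝐍 is flip ∘ W followed by a
transposed Fourier transformation in each variable, and 𝐌 adds a linear change of variables. Its
transpose is thus an isomorphism of 𝓢(Ξ × Ξ), whose own transpose is the extension to 𝓢'(Ξ × Ξ);
uniqueness holds because Schwartz functions are dense.

Windows. As 𝐌⁻¹𝐌 cancels, 𝐌̃_{h'} 𝐌_h = ⟨h', h⟩ (`Mt_Mw`). If ⟨h', h⟩ ≠ 0, then 𝐌_k = ⟨h', h⟩⁻¹ (𝐌_k
𝐌̃_{h'}) 𝐌_h, so invariance of 𝔏 under 𝐌_k 𝐌̃_{h'} gives the inclusion of induced spaces, and the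
closed graph theorem its continuity. The choice h' = h̄ always works, since ⟨h̄, h⟩ = ∫ |h|². -/

namespace SchwartzTensor

/-! ### Schwartz seminorms, completeness and Banach–Steinhaus -/

section Seminorms
variable {E F : Type} [NormedAddCommGroup E] [NormedSpace ℝ E] [NormedAddCommGroup F]
  [NormedSpace ℝ F]

/-- The supremum of the Schwartz seminorms of order at most `(n, n)`. -/
def pnorm (n : ℕ) : Seminorm ℂ 𝓢(E, ℂ) :=
  (Finset.Iic (n, n)).sup (schwartzSeminormFamily ℂ E ℂ)

theorem pnorm_mono {m n : ℕ} (h : m ≤ n) (f : 𝓢(E, ℂ)) : pnorm m f ≤ pnorm n f :=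
  Seminorm.le_def.mp (Finset.sup_mono (Finset.Iic_subset_Iic.mpr (Prod.mk_le_mk.mpr ⟨h, h⟩))) f

theorem seminorm_le_pnorm {k l n : ℕ} (hk : k ≤ n) (hl : l ≤ n) (f : 𝓢(E, ℂ)) :
    SchwartzMap.seminorm ℂ k l f ≤ pnorm n f :=
  Seminorm.le_def.mp (Finset.le_sup (f := schwartzSeminormFamily ℂ E ℂ)
    (Finset.mem_Iic.mpr (show (k, l) ≤ (n, n) from ⟨hk, hl⟩))) f

theorem pnorm_le {n : ℕ} {f : 𝓢(E, ℂ)} {a : ℝ} (ha : 0 ≤ a)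
    (h : ∀ k ≤ n, ∀ l ≤ n, SchwartzMap.seminorm ℂ k l f ≤ a) : pnorm n f ≤ a :=
  Seminorm.finset_sup_apply_le ha fun i hi =>
    h i.1 (Finset.mem_Iic.mp hi).1 i.2 (Finset.mem_Iic.mp hi).2

/-- Since these seminorms increase with `n`, continuity estimates need only one of them instead of a
finite supremum. -/
theorem withSeminorms_pnorm : WithSeminorms fun n : ℕ => pnorm (E := E) n := by
  refine (schwartz_withSeminorms ℂ E ℂ).congr (fun n => ⟨Finset.Iic (n, n), 1, ?_⟩)
    (fun i => ⟨{max i.1 i.2}, 1, ?_⟩)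
  · rw [one_smul]; exact le_rfl
  · rw [one_smul, Finset.sup_singleton]
    exact Seminorm.le_def.mpr fun f => seminorm_le_pnorm (le_max_left _ _) (le_max_right _ _) f

theorem continuous_pnorm (n : ℕ) : Continuous (pnorm (E := E) n) :=
  withSeminorms_pnorm.continuous_seminorm n

theorem exists_le_pnorm (q : Seminorm ℂ 𝓢(E, ℂ)) (hq : Continuous q) :
    ∃ (n : ℕ) (C : ℝ), 0 < C ∧ ∀ f, q f ≤ C * pnorm n f := by
  obtain ⟨s, C, hC, h⟩ := Seminorm.bound_of_continuous withSeminorms_pnorm q hq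
  refine ⟨s.sup id, C, by positivity, fun f => (Seminorm.le_def.mp h f).trans ?_⟩
  change (C : ℝ) * _ ≤ _
  gcongr
  exact Seminorm.finset_sup_apply_le (apply_nonneg _ _) fun i hi =>
    pnorm_mono (Finset.le_sup (f := id) hi) f

theorem exists_pnorm_le_pnorm (T : 𝓢(E, ℂ) →L[ℂ] 𝓢(F, ℂ)) (m : ℕ) :
    ∃ (n : ℕ) (C : ℝ), 0 < C ∧ ∀ f, pnorm m (T f) ≤ C * pnorm n f :=
  exists_le_pnorm ((pnorm m).comp T.toLinearMap) ((continuous_pnorm m).comp T.continuous)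

theorem continuous_of_norm_le_pnorm (T : 𝓢(E, ℂ) →ₗ[ℂ] ℂ) {n : ℕ} {C : ℝ}
    (h : ∀ f, ‖T f‖ ≤ C * pnorm n f) : Continuous T := by
  refine withSeminorms_pnorm.continuous_normedSpace_rng ℂ T
    ⟨{n}, ⟨max C 0, le_max_right _ _⟩, Seminorm.le_def.mpr fun f => (h f).trans ?_⟩
  rw [Finset.sup_singleton]
  exact mul_le_mul_of_nonneg_right (le_max_left _ _) (apply_nonneg _ _)

theorem continuous_of_pnorm_le_pnorm (T : 𝓢(E, ℂ) →ₗ[ℂ] 𝓢(F, ℂ))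
    (h : ∀ m, ∃ (n : ℕ) (C : ℝ), ∀ f, pnorm m (T f) ≤ C * pnorm n f) : Continuous T := by
  refine withSeminorms_pnorm.continuous_of_isBounded withSeminorms_pnorm T fun m => ?_
  obtain ⟨n, C, hC⟩ := h m
  refine ⟨{n}, ⟨max C 0, le_max_right _ _⟩, Seminorm.le_def.mpr fun f => (hC f).trans ?_⟩
  rw [Finset.sup_singleton]
  exact mul_le_mul_of_nonneg_right (le_max_left _ _) (apply_nonneg _ _)

theorem tendsto_zero_iff_pnorm {α : Type*} {l : Filter α} {u : α → 𝓢(E, ℂ)} :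
    Tendsto u l (𝓝 0) ↔ ∀ n, Tendsto (fun a => pnorm n (u a)) l (𝓝 0) := by
  refine ⟨fun h n => ?_, fun h => (withSeminorms_pnorm.tendsto_nhds u 0).mpr fun n ε hε => ?_⟩
  · have := ((continuous_pnorm n).tendsto (0 : 𝓢(E, ℂ))).comp h
    rwa [map_zero] at this
  · simpa using (h n).eventually_lt_const hε

/-- The sum of a series of Schwartz functions whose seminorms are summable. -/
theorem exists_tsum_of_summable_pnorm {ι : Type*} {u : ι → 𝓢(E, ℂ)}
    (hu : ∀ n, Summable fun j => pnorm n (u j)) :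
    ∃ f : 𝓢(E, ℂ), (∀ x, f x = ∑' j, u j x) ∧ ∀ n, pnorm n f ≤ ∑' j, pnorm n (u j) := by
  have hsm : ∀ k l, Summable fun j => SchwartzMap.seminorm ℂ k l (u j) := fun k l =>
    Summable.of_nonneg_of_le (fun j => apply_nonneg _ _)
      (fun j => seminorm_le_pnorm (le_max_left k l) (le_max_right k l) (u j)) (hu (max k l))
  have hb : ∀ (k : ℕ) (j : ι) (x : E), (k : ℕ∞) ≤ (⊤ : ℕ∞) →
      ‖iteratedFDeriv ℝ k (u j) x‖ ≤ SchwartzMap.seminorm ℂ 0 k (u j) := fun k j x _ =>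
    (u j).norm_iteratedFDeriv_le_seminorm ℂ k x
  have hcd : ∀ j, ContDiff ℝ ((⊤ : ℕ∞) : WithTop ℕ∞) (u j) := fun j => (u j).smooth ⊤
  have hc : ContDiff ℝ ((⊤ : ℕ∞) : WithTop ℕ∞) fun x => ∑' j, u j x :=
    contDiff_tsum (v := fun k j => SchwartzMap.seminorm ℂ 0 k (u j)) hcd (fun k _ => hsm 0 k) hb
  have key : ∀ (k l : ℕ) (x : E), ‖x‖ ^ k * ‖iteratedFDeriv ℝ l (fun x => ∑' j, u j x) x‖ ≤
      ∑' j, SchwartzMap.seminorm ℂ k l (u j) := by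
    intro k l x
    rw [iteratedFDeriv_tsum_apply (v := fun k j => SchwartzMap.seminorm ℂ 0 k (u j)) hcd
      (fun k _ => hsm 0 k) hb (k := l) le_top]
    have hs : Summable fun j => ‖iteratedFDeriv ℝ l (u j) x‖ :=
      Summable.of_nonneg_of_le (fun j => norm_nonneg _) (fun j => hb l j x le_top) (hsm 0 l)
    calc _ ≤ ‖x‖ ^ k * ∑' j, ‖iteratedFDeriv ℝ l (u j) x‖ := by
          gcongr; exact norm_tsum_le_tsum_norm hs
      _ = ∑' j, ‖x‖ ^ k * ‖iteratedFDeriv ℝ l (u j) x‖ := tsum_mul_left.symm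
      _ ≤ _ := (hs.mul_left _).tsum_le_tsum (fun j => (u j).le_seminorm ℂ k l x) (hsm k l)
  let f : 𝓢(E, ℂ) :=
    { toFun := fun x => ∑' j, u j x
      smooth' := hc
      decay' := fun k l => ⟨_, key k l⟩ }
  refine ⟨f, fun x => rfl, fun n => ?_⟩
  refine pnorm_le (tsum_nonneg fun j => apply_nonneg _ _) fun k hk l hl => ?_
  exact (SchwartzMap.seminorm_le_bound ℂ k l f (tsum_nonneg fun j => apply_nonneg _ _)
    (key k l)).trans ((hsm k l).tsum_le_tsum (fun j => seminorm_le_pnorm hk hl _) (hu n))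

theorem norm_apply_le_pnorm (f : 𝓢(E, ℂ)) (n : ℕ) (x : E) : ‖f x‖ ≤ pnorm n f :=
  (f.norm_le_seminorm ℂ x).trans (seminorm_le_pnorm (Nat.zero_le _) (Nat.zero_le _) f)

/-- A pointwise convergent series of Schwartz functions converges in the Schwartz space if the
seminorms are summable. -/
theorem hasSum_of_summable_pnorm {ι : Type*} {u : ι → 𝓢(E, ℂ)} {f : 𝓢(E, ℂ)}
    (hu : ∀ n, Summable fun j => pnorm n (u j)) (hf : ∀ x, HasSum (fun j => u j x) (f x)) :
    HasSum u f := by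
  classical
  rw [HasSum, SummationFilter.unconditional_filter, ← tendsto_sub_nhds_zero_iff]
  refine tendsto_zero_iff_pnorm.mpr fun n => ?_
  refine squeeze_zero (fun s => apply_nonneg _ _) (fun s => ?_)
    (tendsto_tsum_compl_atTop_zero fun j => pnorm n (u j))
  have hs : ∀ m, Summable fun j : {j // j ∉ s} => pnorm m (u j) := fun m =>
    (hu m).comp_injective Subtype.val_injective
  -- The error of a partial sum is, up to sign, the sum of the remaining terms, whose seminorms are
  -- bounded by the tails of convergent series.
  obtain ⟨g, hg, hgn⟩ := exists_tsum_of_summable_pnorm (u := fun j : {j // j ∉ s} => u j) hs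
  have : (∑ j ∈ s, u j) - f = -g := by
    ext x
    have h1 := (hf x).summable.sum_add_tsum_subtype_compl s
    rw [(hf x).tsum_eq] at h1
    have h2 : (∑ j ∈ s, u j) x = ∑ j ∈ s, u j x := by simp
    rw [_root_.sub_apply, _root_.neg_apply, h2, hg, ← h1]
    ring
  rw [this, map_neg_eq_map]
  exact hgn n

theorem exists_hasSum_of_summable_pnorm {ι : Type*} {u : ι → 𝓢(E, ℂ)}
    (hu : ∀ n, Summable fun j => pnorm n (u j)) :
    ∃ f : 𝓢(E, ℂ), HasSum u f ∧ ∀ n, pnorm n f ≤ ∑' j, pnorm n (u j) := by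
  obtain ⟨f, hf, hfn⟩ := exists_tsum_of_summable_pnorm hu
  refine ⟨f, hasSum_of_summable_pnorm hu fun x => ?_, hfn⟩
  rw [hf]
  exact (Summable.of_norm_bounded (hu 0) fun j => norm_apply_le_pnorm _ _ _).hasSum

instance : (uniformity 𝓢(E, ℂ)).IsCountablyGenerated :=
  IsUniformAddGroup.uniformity_countably_generated

/-- A sequence whose consecutive differences are controlled by powers of 1/2 is a telescoping series
with summable seminorms. -/
instance : CompleteSpace 𝓢(E, ℂ) := by
  have hU : ∀ n : ℕ, {p : 𝓢(E, ℂ) × 𝓢(E, ℂ) | pnorm n (p.2 - p.1) < (1 / 2) ^ n} ∈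
      uniformity 𝓢(E, ℂ) := fun n => by
    rw [uniformity_eq_comap_nhds_zero]
    refine ⟨{f | pnorm n f < (1 / 2) ^ n}, ?_, fun p hp => hp⟩
    exact ((continuous_pnorm n).tendsto' 0 0 (map_zero _)).eventually_lt_const (by positivity)
  refine UniformSpace.complete_of_convergent_controlled_sequences _ hU fun u hu => ?_
  -- After a shift by `n`, `pnorm n` is dominated by `pnorm (j + n)`, which the controlled sequence
  -- makes geometric.
  have hd : ∀ n, Summable fun j => pnorm n (u (j + 1) - u j) := fun n => by
    rw [← summable_nat_add_iff n]
    refine Summable.of_nonneg_of_le (fun j => apply_nonneg _ _) (fun j => ?_)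
      ((summable_nat_add_iff n).mpr summable_geometric_two)
    exact (pnorm_mono (Nat.le_add_left n j) _).trans
      (hu (j + n) (j + n) (j + n + 1) le_rfl (Nat.le_succ _)).le
  obtain ⟨f, hf, -⟩ := exists_hasSum_of_summable_pnorm hd
  refine ⟨f + u 0, ?_⟩
  have := hf.tendsto_sum_nat.add_const (u 0)
  simp only [Finset.sum_range_sub u, sub_add_cancel] at this
  exact this

/-- Completeness and a countably generated uniformity give a Baire space. -/
instance : BarrelledSpace ℂ 𝓢(E, ℂ) :=
  haveI : BaireSpace 𝓢(E, ℂ) := by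
    let _ := UniformSpace.pseudoMetricSpace 𝓢(E, ℂ)
    exact BaireSpace.of_completelyPseudoMetrizable
  inferInstance

/-- Banach-Steinhaus for linear forms on the Schwartz space. -/
theorem exists_norm_le_pnorm_of_pointwise_bounded {ι : Type*} (T : ι → 𝓢(E, ℂ) →L[ℂ] ℂ)
    (h : ∀ f, ∃ C, ∀ i, ‖T i f‖ ≤ C) :
    ∃ (n : ℕ) (C : ℝ), 0 < C ∧ ∀ i f, ‖T i f‖ ≤ C * pnorm n f := by
  have h1 := (norm_withSeminorms ℂ ℂ).banach_steinhaus (𝓕 := T) fun _ f => by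
    obtain ⟨C, hC⟩ := h f
    exact ⟨C, by rintro _ ⟨i, rfl⟩; exact hC i⟩
  obtain ⟨p, hp, hpT⟩ := ((norm_withSeminorms ℂ ℂ).uniformEquicontinuous_iff_exists_continuous_seminorm
    (fun i => (T i).toLinearMap)).mp h1 0
  obtain ⟨n, C, hC, hb⟩ := exists_le_pnorm p hp
  exact ⟨n, C, hC, fun i f => (Seminorm.le_def.mp (hpT i) f).trans (hb f)⟩

/-- Banach-Steinhaus for separately continuous bilinear forms on Schwartz spaces. -/
theorem exists_norm_le_pnorm_mul_pnorm {ι : Type*} (T : ι → 𝓢(E, ℂ) →ₗ[ℂ] 𝓢(F, ℂ) →ₗ[ℂ] ℂ)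
    (hl : ∀ i g, Continuous fun f => T i f g) (hr : ∀ i f, Continuous fun g => T i f g)
    (h : ∀ f g, ∃ C, ∀ i, ‖T i f g‖ ≤ C) :
    ∃ (n : ℕ) (C : ℝ), 0 < C ∧ ∀ i f g, ‖T i f g‖ ≤ C * pnorm n f * pnorm n g := by
  by_contra! hcon
  have hseq : ∀ n : ℕ, ∃ (i : ι) (f : 𝓢(E, ℂ)) (g : 𝓢(F, ℂ)), pnorm n f ≤ ((n : ℝ) + 1)⁻¹ ∧
      pnorm n g ≤ 1 ∧ 1 < ‖T i f g‖ := by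
    intro n
    obtain ⟨i, f, g, h⟩ := hcon n (n + 1) (by positivity)
    -- The `ε` keeps the normalising factors invertible if a seminorm vanishes; the strict
    -- inequality leaves room for it.
    have hlim : ∀ᶠ ε : ℝ in 𝓝[>] 0, ((n : ℝ) + 1) * (pnorm n f + ε) * (pnorm n g + ε) < ‖T i f g‖ := by
      have hc : Continuous fun ε : ℝ => ((n : ℝ) + 1) * (pnorm n f + ε) * (pnorm n g + ε) := by
        fun_prop
      exact ((hc.tendsto' 0 _ (by simp)).mono_left nhdsWithin_le_nhds).eventually_lt_const h
    obtain ⟨ε, hε, hε0⟩ := (hlim.and self_mem_nhdsWithin).exists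
    have hε0 : 0 < ε := hε0
    have ha : 0 < pnorm n f + ε := add_pos_of_nonneg_of_pos (apply_nonneg _ _) hε0
    have hb : 0 < pnorm n g + ε := add_pos_of_nonneg_of_pos (apply_nonneg _ _) hε0
    refine ⟨i, (((n + 1) * (pnorm n f + ε))⁻¹ : ℝ) • f, ((pnorm n g + ε)⁻¹ : ℝ) • g, ?_, ?_, ?_⟩
    · rw [← Complex.coe_smul, map_smul_eq_mul, Complex.norm_real, Real.norm_of_nonneg (by positivity),
        mul_inv, mul_assoc]
      refine mul_le_of_le_one_right (by positivity) ?_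
      rw [inv_mul_le_iff₀ ha]; linarith
    · rw [← Complex.coe_smul, map_smul_eq_mul, Complex.norm_real, Real.norm_of_nonneg (by positivity),
        inv_mul_le_iff₀ hb]
      linarith
    · rw [← Complex.coe_smul, ← Complex.coe_smul, map_smul, map_smul, LinearMap.smul_apply, norm_smul,
        norm_smul, Complex.norm_real, Complex.norm_real, Real.norm_of_nonneg (by positivity),
        Real.norm_of_nonneg (by positivity), ← mul_assoc, ← mul_inv, lt_inv_mul_iff₀ (by positivity),
        mul_one]
      calc _ = ((n : ℝ) + 1) * (pnorm n f + ε) * (pnorm n g + ε) := by ring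
        _ < _ := hε
  choose i f g hf hg hT using hseq
  -- The sequence `g` is bounded in every seminorm, as only the indices `n < m` escape `pnorm m ≤
  -- pnorm n`.
  have hgb : ∀ m, ∃ C, ∀ n, pnorm m (g n) ≤ C := fun m => by
    refine ⟨1 + ∑ n ∈ Finset.range m, pnorm m (g n), fun n => ?_⟩
    have hs : 0 ≤ ∑ n ∈ Finset.range m, pnorm m (g n) := Finset.sum_nonneg fun _ _ => apply_nonneg _ _
    rcases le_or_gt m n with h | h
    · linarith [pnorm_mono h (g n), hg n]
    · linarith [Finset.single_le_sum (f := fun n => pnorm m (g n)) (fun _ _ => apply_nonneg _ _)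
        (Finset.mem_range.mpr h)]
  -- Uniform boundedness in the second variable makes the forms `T i · (g n)` pointwise bounded;
  -- uniform boundedness in the first then gives a common seminorm. It is at most 1/(n + 1) on `f n`
  -- for large `n`, a contradiction.
  obtain ⟨M, C, hC, hb⟩ := exists_norm_le_pnorm_of_pointwise_bounded
    (fun p : ι × ℕ => (⟨(T p.1).flip (g p.2), hl p.1 (g p.2)⟩ : 𝓢(E, ℂ) →L[ℂ] ℂ)) fun f => by
      obtain ⟨m, C, hC, hb⟩ := exists_norm_le_pnorm_of_pointwise_bounded
        (fun i : ι => (⟨T i f, hr i f⟩ : 𝓢(F, ℂ) →L[ℂ] ℂ)) (h f)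
      obtain ⟨D, hD⟩ := hgb m
      exact ⟨C * D, fun p => (hb p.1 (g p.2)).trans (by gcongr; exact hD _)⟩
  obtain ⟨n, hn⟩ := exists_nat_ge (max (M : ℝ) C)
  have h1 : ‖T (i n) (f n) (g n)‖ ≤ C * pnorm M (f n) := hb (i n, n) (f n)
  have h2 : pnorm M (f n) ≤ ((n : ℝ) + 1)⁻¹ :=
    (pnorm_mono (by exact_mod_cast (le_max_left _ _).trans hn) _).trans (hf n)
  have h3 : C * ((n : ℝ) + 1)⁻¹ ≤ 1 := by
    rw [mul_inv_le_iff₀ (by positivity)]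
    linarith [(le_max_right (M : ℝ) C).trans hn]
  linarith [hT n, mul_le_mul_of_nonneg_left h2 hC.le]

end Seminorms

end SchwartzTensor

namespace SchwartzTensor

/-! ### Slices and tensor products of Schwartz functions -/

section Affine
variable {E H : Type} [NormedAddCommGroup E] [NormedSpace ℝ E] [NormedAddCommGroup H]
  [NormedSpace ℝ H]

/-- Each derivative costs a factor ‖L‖ ≤ 1 and `ha` moves the weight to the argument of `G`. The
bound does not involve `a`, so all slices of a function are controlled at once. -/
theorem norm_pow_mul_iteratedFDeriv_comp_affine_le (G : 𝓢(H, ℂ)) (L : E →L[ℝ] H) (hL : ‖L‖ ≤ 1)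
    (a : H) (ha : ∀ x, ‖x‖ ≤ ‖L x + a‖) (k l : ℕ) (x : E) :
    ‖x‖ ^ k * ‖iteratedFDeriv ℝ l (fun x => G (L x + a)) x‖ ≤ SchwartzMap.seminorm ℂ k l G := by
  have hG : ContDiff ℝ ∞ fun z => G (z + a) := (G.smooth ⊤).comp (contDiff_id.add contDiff_const)
  have h : iteratedFDeriv ℝ l (fun x => G (L x + a)) x =
      (iteratedFDeriv ℝ l (fun z => G (z + a)) (L x)).compContinuousLinearMap fun _ => L :=
    L.iteratedFDeriv_comp_right hG x (i := l) (mod_cast le_top)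
  rw [h, iteratedFDeriv_comp_add_right]
  refine le_trans ?_ (G.le_seminorm ℂ k l (L x + a))
  refine mul_le_mul (pow_le_pow_left₀ (norm_nonneg _) (ha x) _) ?_ (norm_nonneg _) (by positivity)
  refine (ContinuousMultilinearMap.norm_compContinuousLinearMap_le _ _).trans ?_
  refine mul_le_of_le_one_right (norm_nonneg _) ?_
  exact Finset.prod_le_one (fun _ _ => norm_nonneg _) fun _ _ => hL

/-- The composition of a Schwartz function with an affine map that increases norms. -/
def compAffine (G : 𝓢(H, ℂ)) (L : E →L[ℝ] H) (hL : ‖L‖ ≤ 1) (a : H)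
    (ha : ∀ x, ‖x‖ ≤ ‖L x + a‖) : 𝓢(E, ℂ) where
  toFun x := G (L x + a)
  smooth' := (G.smooth ⊤).comp (L.contDiff.add contDiff_const)
  decay' k l := ⟨_, norm_pow_mul_iteratedFDeriv_comp_affine_le G L hL a ha k l⟩

theorem pnorm_compAffine_le (G : 𝓢(H, ℂ)) (L : E →L[ℝ] H) (hL : ‖L‖ ≤ 1) (a : H)
    (ha : ∀ x, ‖x‖ ≤ ‖L x + a‖) (n : ℕ) : pnorm n (compAffine G L hL a ha) ≤ pnorm n G := by
  refine pnorm_le (apply_nonneg _ _) fun k hk l hl => ?_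
  have h : ∀ x, ‖x‖ ^ k * ‖iteratedFDeriv ℝ l (compAffine G L hL a ha) x‖ ≤
      SchwartzMap.seminorm ℂ k l G := norm_pow_mul_iteratedFDeriv_comp_affine_le G L hL a ha k l
  exact (SchwartzMap.seminorm_le_bound ℂ k l _ (apply_nonneg _ _) h).trans
    (seminorm_le_pnorm hk hl G)

end Affine

section Slices
variable {E F : Type} [NormedAddCommGroup E] [NormedSpace ℝ E] [NormedAddCommGroup F]
  [NormedSpace ℝ F]

/-- The slice `x ↦ G (x, y)`. -/
def sliceFst (G : 𝓢(E × F, ℂ)) (y : F) : 𝓢(E, ℂ) :=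
  compAffine G (ContinuousLinearMap.inl ℝ E F) (ContinuousLinearMap.norm_inl_le_one ℝ E F) (0, y)
    fun x => by simp

/-- The slice `y ↦ G (x, y)`. -/
def sliceSnd (G : 𝓢(E × F, ℂ)) (x : E) : 𝓢(F, ℂ) :=
  compAffine G (ContinuousLinearMap.inr ℝ E F) (ContinuousLinearMap.norm_inr_le_one ℝ E F) (x, 0)
    fun y => by simp

@[simp]
theorem sliceFst_apply (G : 𝓢(E × F, ℂ)) (x : E) (y : F) : sliceFst G y x = G (x, y) := by
  change G _ = _
  simp

@[simp]
theorem sliceSnd_apply (G : 𝓢(E × F, ℂ)) (x : E) (y : F) : sliceSnd G x y = G (x, y) := by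
  change G _ = _
  simp

theorem pnorm_sliceFst_le (G : 𝓢(E × F, ℂ)) (y : F) (n : ℕ) : pnorm n (sliceFst G y) ≤ pnorm n G :=
  pnorm_compAffine_le _ _ _ _ _ n

theorem pnorm_sliceSnd_le (G : 𝓢(E × F, ℂ)) (x : E) (n : ℕ) : pnorm n (sliceSnd G x) ≤ pnorm n G :=
  pnorm_compAffine_le _ _ _ _ _ n

/-- A bound for the seminorms of a tensor product. -/
theorem pnorm_tensorRight_le (n : ℕ) : ∃ C : ℝ, 0 ≤ C ∧ ∀ (f : 𝓢(E, ℂ)) (g : 𝓢(F, ℂ)),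
    pnorm n (tensorRight g f) ≤ C * (pnorm n f * pnorm n g) := by
  -- Summing over all orders `i ≤ n` dominates the Leibniz sum of each order `l ≤ n`. The factor 2
  -- comes from ‖z‖ᵏ ≤ ‖z.1‖ᵏ + ‖z.2‖ᵏ.
  refine ⟨∑ i ∈ Finset.range (n + 1), ∑ j ∈ Finset.range (i + 1), (i.choose j : ℝ) * 2,
    by positivity, fun f g => ?_⟩
  have hP : 0 ≤ pnorm n f := apply_nonneg _ _
  have hQ : 0 ≤ pnorm n g := apply_nonneg _ _
  refine pnorm_le (mul_nonneg (by positivity) (by positivity)) fun k hk l hl => ?_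
  refine SchwartzMap.seminorm_le_bound ℂ k l _ (mul_nonneg (by positivity) (by positivity)) fun z => ?_
  have hmul : ‖iteratedFDeriv ℝ l (fun z : E × F => f z.1 * g z.2) z‖ ≤ _ :=
    norm_iteratedFDeriv_mul_le (𝕜 := ℝ) (N := ∞)
    ((f.smooth ⊤).comp (contDiff_fst (E := E) (F := F)))
    ((g.smooth ⊤).comp (contDiff_snd (E := E) (F := F))) z (n := l) (mod_cast le_top)
  refine (mul_le_mul_of_nonneg_left hmul (by positivity)).trans ?_
  have hl' : ∑ j ∈ Finset.range (l + 1), (l.choose j : ℝ) * 2 ≤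
      ∑ i ∈ Finset.range (n + 1), ∑ j ∈ Finset.range (i + 1), (i.choose j : ℝ) * 2 :=
    Finset.single_le_sum (f := fun i => ∑ j ∈ Finset.range (i + 1), (i.choose j : ℝ) * 2)
      (fun _ _ => by positivity) (Finset.mem_range.mpr (Nat.lt_succ_of_le hl))
  refine le_trans ?_ (mul_le_mul_of_nonneg_right hl' (by positivity))
  rw [Finset.mul_sum, Finset.sum_mul]
  refine Finset.sum_le_sum fun i hi => ?_
  have hi' : i ≤ n := (Nat.lt_succ_iff.mp (Finset.mem_range.mp hi)).trans hl
  have hf : ∀ a ≤ n, ‖z.1‖ ^ a * ‖iteratedFDeriv ℝ i f z.1‖ ≤ pnorm n f := fun a ha =>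
    (f.le_seminorm ℂ a i z.1).trans (seminorm_le_pnorm ha hi' f)
  have hg : ∀ a ≤ n, ‖z.2‖ ^ a * ‖iteratedFDeriv ℝ (l - i) g z.2‖ ≤ pnorm n g := fun a ha =>
    (g.le_seminorm ℂ a (l - i) z.2).trans (seminorm_le_pnorm ha ((Nat.sub_le _ _).trans hl) g)
  have f0 := hf 0 (Nat.zero_le _)
  have g0 := hg 0 (Nat.zero_le _)
  rw [pow_zero, one_mul] at f0 g0
  have e1 := norm_iteratedFDeriv_fst_le (F := F) f i z
  have e2 := norm_iteratedFDeriv_snd_le (E := E) g (l - i) z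
  have hz : ‖z‖ ^ k ≤ ‖z.1‖ ^ k + ‖z.2‖ ^ k := by
    rw [Prod.norm_def]
    rcases max_choice ‖z.1‖ ‖z.2‖ with h | h <;> rw [h]
    · exact le_add_of_nonneg_right (by positivity)
    · exact le_add_of_nonneg_left (by positivity)
  calc _ = (l.choose i : ℝ) * (‖z‖ ^ k * (‖iteratedFDeriv ℝ i (fun z : E × F => f z.1) z‖ *
      ‖iteratedFDeriv ℝ (l - i) (fun z : E × F => g z.2) z‖)) := by
        simp only [Function.comp_def]; ring
    _ ≤ (l.choose i : ℝ) * ((‖z.1‖ ^ k + ‖z.2‖ ^ k) * (‖iteratedFDeriv ℝ i f z.1‖ *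
          ‖iteratedFDeriv ℝ (l - i) g z.2‖)) := by gcongr
    _ = (l.choose i : ℝ) * ((‖z.1‖ ^ k * ‖iteratedFDeriv ℝ i f z.1‖) *
          ‖iteratedFDeriv ℝ (l - i) g z.2‖ +
          ‖iteratedFDeriv ℝ i f z.1‖ * (‖z.2‖ ^ k * ‖iteratedFDeriv ℝ (l - i) g z.2‖)) := by ring
    _ ≤ (l.choose i : ℝ) * (pnorm n f * pnorm n g + pnorm n f * pnorm n g) := by
          have := hf k hk
          have := hg k hk
          gcongr
    _ = _ := by ring

end Slices

/-- Rapid decrease beats polynomial growth: two spare powers of the weight are left over to make a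
series summable. -/
theorem mul_le_mul_inv_sq {r a b A C : ℝ} {N : ℕ} (hr : 0 < r) (ha : 0 ≤ a) (hb : 0 ≤ b)
    (h1 : r ^ (2 + N) * a ≤ A) (h2 : b ≤ C * r ^ N) : a * b ≤ A * C * (r ^ 2)⁻¹ := by
  have hC : 0 ≤ C := nonneg_of_mul_nonneg_left (hb.trans h2) (pow_pos hr N)
  rw [← div_eq_mul_inv, le_div_iff₀ (by positivity)]
  calc a * b * r ^ 2 ≤ a * (C * r ^ N) * r ^ 2 := by gcongr
    _ = r ^ (2 + N) * a * C := by ring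
    _ ≤ A * C := by gcongr

/-- Countable expansions `f = ∑ⱼ (∫ θⱼ f) φⱼ` of Schwartz functions with rapidly decreasing
coefficients. -/
structure SchwartzFrame (E : Type) [NormedAddCommGroup E] [NormedSpace ℝ E] [MeasurableSpace E]
    (μ : Measure E) where
  /-- The index set. -/
  index : Type
  /-- The functions in which one expands. -/
  φ : index → 𝓢(E, ℂ)
  /-- The functions that give the coefficients. -/
  θ : index → 𝓢(E, ℂ)
  /-- The weights. -/
  ρ : index → ℝ
  one_le : ∀ j, 1 ≤ ρ j
  summable : Summable fun j => (ρ j ^ 2)⁻¹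
  pnorm_φ_le : ∀ n, ∃ (C : ℝ) (N : ℕ), 0 ≤ C ∧ ∀ j, pnorm n (φ j) ≤ C * ρ j ^ N
  -- This bound serves products of frames: it controls one factor while the decay in the index of
  -- the other is extracted.
  integral_θ_le : ∃ C : ℝ, 0 ≤ C ∧ ∀ j, ∫ x, ‖θ j x‖ ∂μ ≤ C
  coeff_le : ∀ N : ℕ, ∃ (n : ℕ) (C : ℝ), 0 ≤ C ∧
    ∀ (j : index) (f : 𝓢(E, ℂ)), ρ j ^ N * ‖∫ x, θ j x * f x ∂μ‖ ≤ C * pnorm n f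
  hasSum_apply : ∀ (f : 𝓢(E, ℂ)) (x : E), HasSum (fun j => (∫ y, θ j y * f y ∂μ) * φ j x) (f x)

/-! ### Transport, rescaling and products of frames -/

namespace SchwartzFrame

section Maps
variable {E F : Type} [NormedAddCommGroup E] [NormedSpace ℝ E] [MeasurableSpace E]
  [NormedAddCommGroup F] [NormedSpace ℝ F] [MeasurableSpace F] {μ : Measure E}

/-- Transport of a frame along a linear isomorphism. -/
def map [BorelSpace E] [BorelSpace F] (S : SchwartzFrame E μ) (e : E ≃L[ℝ] F) :
    SchwartzFrame F (μ.map e) :=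
  have hi : ∀ g : F → ℂ, ∫ y, g y ∂μ.map e = ∫ x, g (e x) ∂μ := fun g =>
    e.toHomeomorph.measurableEmbedding.integral_map g
  have hi' : ∀ g : F → ℝ, ∫ y, g y ∂μ.map e = ∫ x, g (e x) ∂μ := fun g =>
    e.toHomeomorph.measurableEmbedding.integral_map g
  { index := S.index
    φ := fun j => compCLMOfContinuousLinearEquiv ℂ e.symm (S.φ j)
    θ := fun j => compCLMOfContinuousLinearEquiv ℂ e.symm (S.θ j)
    ρ := S.ρ
    one_le := S.one_le
    summable := S.summable
    pnorm_φ_le := fun n => by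
      obtain ⟨m, C, hC, h⟩ := exists_pnorm_le_pnorm
        (compCLMOfContinuousLinearEquiv ℂ e.symm : 𝓢(E, ℂ) →L[ℂ] 𝓢(F, ℂ)) n
      obtain ⟨D, N, hD, hb⟩ := S.pnorm_φ_le m
      exact ⟨C * D, N, by positivity, fun j => (h _).trans (by rw [mul_assoc]; gcongr; exact hb j)⟩
    integral_θ_le := by
      obtain ⟨C, hC, h⟩ := S.integral_θ_le
      exact ⟨C, hC, fun j => by rw [hi']; simpa using h j⟩
    coeff_le := fun N => by
      obtain ⟨m, C, hC, h⟩ := S.coeff_le N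
      obtain ⟨n, D, hD, hb⟩ := exists_pnorm_le_pnorm
        (compCLMOfContinuousLinearEquiv ℂ e : 𝓢(F, ℂ) →L[ℂ] 𝓢(E, ℂ)) m
      refine ⟨n, C * D, by positivity, fun j f => ?_⟩
      rw [hi]
      have := h j (compCLMOfContinuousLinearEquiv ℂ e f)
      simp only [compCLMOfContinuousLinearEquiv_apply, Function.comp_apply,
        ContinuousLinearEquiv.symm_apply_apply] at this ⊢
      refine this.trans ?_
      rw [mul_assoc]; gcongr; exact hb f
    hasSum_apply := fun f y => by
      have := S.hasSum_apply (compCLMOfContinuousLinearEquiv ℂ e f) (e.symm y)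
      simp only [hi]
      simpa using this }

/-- Rescaling of the measure. -/
def smul (S : SchwartzFrame E μ) (c : ENNReal) (h0 : c ≠ 0) (h1 : c ≠ ⊤) :
    SchwartzFrame E (c • μ) :=
  have hc : 0 < c.toReal := ENNReal.toReal_pos h0 h1
  have hi : ∀ (j : S.index) (f : 𝓢(E, ℂ)),
      ∫ x, ((c.toReal : ℂ)⁻¹ • S.θ j) x * f x ∂(c • μ) = ∫ x, S.θ j x * f x ∂μ := fun j f => by
    have hc' : (c.toReal : ℂ) ≠ 0 := by exact_mod_cast hc.ne'
    simp only [smul_apply, smul_eq_mul, mul_assoc]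
    rw [integral_const_mul, integral_smul_measure, Complex.real_smul, inv_mul_cancel_left₀ hc']
  { index := S.index
    φ := S.φ
    θ := fun j => (c.toReal : ℂ)⁻¹ • S.θ j
    ρ := S.ρ
    one_le := S.one_le
    summable := S.summable
    pnorm_φ_le := S.pnorm_φ_le
    integral_θ_le := by
      obtain ⟨C, hC, h⟩ := S.integral_θ_le
      refine ⟨C, hC, fun j => ?_⟩
      simp only [smul_apply, norm_smul, norm_inv, Complex.norm_real,
        Real.norm_of_nonneg hc.le]
      rw [integral_const_mul, integral_smul_measure, smul_eq_mul, inv_mul_cancel_left₀ hc.ne']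
      exact h j
    coeff_le := fun N => by
      simpa only [hi] using S.coeff_le N
    hasSum_apply := fun f x => by
      simpa only [hi] using S.hasSum_apply f x }

/-- The frame on a space of dimension zero. -/
def ofSubsingleton [Subsingleton E] (μ : Measure E) (h0 : μ Set.univ ≠ 0) (h1 : μ Set.univ ≠ ⊤) :
    SchwartzFrame E μ :=
  let one : 𝓢(E, ℂ) := HasCompactSupport.toSchwartzMap (f := fun _ => (1 : ℂ))
    (HasCompactSupport.of_compactSpace _) contDiff_const
  have hone : ∀ x, one x = 1 := fun x => rfl
  let c : ℂ := ((μ Set.univ).toReal : ℂ)⁻¹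
  have hpos : 0 < (μ Set.univ).toReal := ENNReal.toReal_pos h0 h1
  have hint : ∀ f : 𝓢(E, ℂ), ∫ x, (c • one) x * f x ∂μ = f 0 := fun f => by
    have : ∀ x, (c • one) x * f x = c * f 0 := fun x => by
      rw [smul_apply, hone, Subsingleton.elim x 0, smul_eq_mul, mul_one]
    simp only [this]
    rw [integral_const, Complex.real_smul, Measure.real, ← mul_assoc, mul_inv_cancel₀, one_mul]
    exact_mod_cast hpos.ne'
  { index := Unit
    φ := fun _ => one
    θ := fun _ => c • one
    ρ := fun _ => 1
    one_le := fun _ => le_rfl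
    summable := .of_finite
    pnorm_φ_le := fun n => ⟨pnorm n one, 0, apply_nonneg _ _, fun _ => by simp⟩
    integral_θ_le := ⟨_, integral_nonneg fun _ => norm_nonneg _, fun _ => le_rfl⟩
    coeff_le := fun N => ⟨0, 1, zero_le_one, fun _ f => by
      rw [hint, one_pow]; simpa using norm_apply_le_pnorm f 0 0⟩
    hasSum_apply := fun f x => by
      simp only [hint, hone, mul_one, Subsingleton.elim x 0]
      exact hasSum_unique _ }

end Maps

section Prod
variable {E F : Type} [NormedAddCommGroup E] [NormedSpace ℝ E] [MeasurableSpace E] [BorelSpace E]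
  [SecondCountableTopology E] [NormedAddCommGroup F] [NormedSpace ℝ F] [MeasurableSpace F]
  [BorelSpace F] [SecondCountableTopology F] {μ : Measure E} {ν : Measure F} [SFinite μ] [SFinite ν]
  [hμ : μ.HasTemperateGrowth] [hν : ν.HasTemperateGrowth] [hμν : (μ.prod ν).HasTemperateGrowth]

theorem integrable_mul (f g : 𝓢(E, ℂ)) : Integrable (fun x => f x * g x) μ :=
  (SchwartzMap.pairing (ContinuousLinearMap.mul ℂ ℂ) f g).integrable.congr
    (.of_forall fun x => by simp [SchwartzMap.pairing_apply_apply])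

theorem integral_tensor_mul (f : 𝓢(E, ℂ)) (g : 𝓢(F, ℂ)) (G : 𝓢(E × F, ℂ)) :
    ∫ z, tensorRight g f z * G z ∂μ.prod ν = ∫ x, f x * slicePairing ν g G x ∂μ := by
  have hint := integrable_mul (μ := μ.prod ν) (tensorRight g f) G
  rw [integral_prod _ hint]
  refine integral_congr_ae (.of_forall fun x => ?_)
  simp only [slicePairing_apply, tensorRight_apply, mul_assoc]
  rw [integral_const_mul]

theorem integral_tensor_mul' (f : 𝓢(E, ℂ)) (g : 𝓢(F, ℂ)) (G : 𝓢(E × F, ℂ)) :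
    ∫ z, tensorRight g f z * G z ∂μ.prod ν = ∫ y, g y * ∫ x, f x * G (x, y) ∂μ ∂ν := by
  have hint := integrable_mul (μ := μ.prod ν) (tensorRight g f) G
  rw [integral_prod_symm _ hint]
  refine integral_congr_ae (.of_forall fun y => ?_)
  simp only [tensorRight_apply]
  rw [← integral_const_mul]
  exact integral_congr_ae (.of_forall fun x => by ring)

/-- Since 2(ab)ᴺ ≤ a²ᴺ + b²ᴺ, decay in each weight separately yields decay in their product. -/
theorem pow_mul_pow_mul_le {a b c A : ℝ} (hc : 0 ≤ c) (N : ℕ)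
    (h1 : a ^ (2 * N) * c ≤ A) (h2 : b ^ (2 * N) * c ≤ A) : (a * b) ^ N * c ≤ A := by
  rw [pow_mul'] at h1 h2
  have := mul_nonneg (sq_nonneg (a ^ N - b ^ N)) hc
  rw [mul_pow]
  nlinarith

theorem norm_integral_mul_le {f : 𝓢(E, ℂ)} {g : E → ℂ} {A : ℝ} (hg : ∀ x, ‖g x‖ ≤ A) :
    ‖∫ x, f x * g x ∂μ‖ ≤ (∫ x, ‖f x‖ ∂μ) * A := by
  rw [← integral_mul_const]
  refine (norm_integral_le_integral_norm _).trans (integral_mono_of_nonneg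
    (.of_forall fun x => norm_nonneg _) (f.integrable.norm.mul_const A) (.of_forall fun x => ?_))
  simp only [norm_mul]
  gcongr
  exact hg x

/-- The product of two frames. -/
def prod (S : SchwartzFrame E μ) (R : SchwartzFrame F ν) : SchwartzFrame (E × F) (μ.prod ν) :=
  -- Each weight is treated alone: integrating first in its own variable, the coefficient bound of
  -- its frame holds uniformly over slices, and the other variable costs only an L¹ norm.
  have hcoeff : ∀ N : ℕ, ∃ (n : ℕ) (C : ℝ), 0 ≤ C ∧ ∀ (j : S.index × R.index) (G : 𝓢(E × F, ℂ)),
      (S.ρ j.1 * R.ρ j.2) ^ N * ‖∫ z, tensorRight (R.θ j.2) (S.θ j.1) z * G z ∂μ.prod ν‖ ≤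
        C * pnorm n G := fun N => by
    obtain ⟨n₁, C₁, hC₁, h₁⟩ := S.coeff_le (2 * N)
    obtain ⟨n₂, C₂, hC₂, h₂⟩ := R.coeff_le (2 * N)
    obtain ⟨D₁, hD₁, i₁⟩ := S.integral_θ_le
    obtain ⟨D₂, hD₂, i₂⟩ := R.integral_θ_le
    refine ⟨max n₁ n₂, max (D₂ * C₁) (D₁ * C₂), by positivity, fun j G => ?_⟩
    have hn : 0 ≤ pnorm (max n₁ n₂) G := apply_nonneg _ _
    have p₁ : 0 < S.ρ j.1 ^ (2 * N) := pow_pos (zero_lt_one.trans_le (S.one_le j.1)) _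
    have p₂ : 0 < R.ρ j.2 ^ (2 * N) := pow_pos (zero_lt_one.trans_le (R.one_le j.2)) _
    refine pow_mul_pow_mul_le (norm_nonneg _) N ?_ ?_
    · rw [integral_tensor_mul']
      have hb : ∀ y, ‖∫ x, S.θ j.1 x * G (x, y) ∂μ‖ ≤
          (S.ρ j.1 ^ (2 * N))⁻¹ * (C₁ * pnorm n₁ G) := fun y => by
        rw [le_inv_mul_iff₀ p₁]
        refine le_trans ?_ ((h₁ j.1 (sliceFst G y)).trans
          (mul_le_mul_of_nonneg_left (pnorm_sliceFst_le G y n₁) hC₁))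
        simp
      calc _ ≤ S.ρ j.1 ^ (2 * N) * (D₂ * ((S.ρ j.1 ^ (2 * N))⁻¹ * (C₁ * pnorm n₁ G))) := by
            gcongr
            refine (norm_integral_mul_le hb).trans ?_
            gcongr
            exact i₂ j.2
        _ = D₂ * C₁ * pnorm n₁ G := by field_simp
        _ ≤ _ := mul_le_mul (le_max_left _ _) (pnorm_mono (le_max_left _ _) G) (apply_nonneg _ _)
            (by positivity)
    · rw [integral_tensor_mul]
      have hb : ∀ x, ‖slicePairing ν (R.θ j.2) G x‖ ≤
          (R.ρ j.2 ^ (2 * N))⁻¹ * (C₂ * pnorm n₂ G) := fun x => by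
        rw [le_inv_mul_iff₀ p₂, slicePairing_apply]
        refine le_trans ?_ ((h₂ j.2 (sliceSnd G x)).trans
          (mul_le_mul_of_nonneg_left (pnorm_sliceSnd_le G x n₂) hC₂))
        simp
      calc _ ≤ R.ρ j.2 ^ (2 * N) * (D₁ * ((R.ρ j.2 ^ (2 * N))⁻¹ * (C₂ * pnorm n₂ G))) := by
            gcongr
            refine (norm_integral_mul_le hb).trans ?_
            gcongr
            exact i₁ j.1
        _ = D₁ * C₂ * pnorm n₂ G := by field_simp
        _ ≤ _ := mul_le_mul (le_max_right _ _) (pnorm_mono (le_max_right _ _) G) (apply_nonneg _ _)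
            (by positivity)
  have hone : ∀ j : S.index × R.index, 1 ≤ S.ρ j.1 * R.ρ j.2 := fun j =>
    one_le_mul_of_one_le_of_one_le (S.one_le j.1) (R.one_le j.2)
  have hsum : Summable fun j : S.index × R.index => ((S.ρ j.1 * R.ρ j.2) ^ 2)⁻¹ := by
    have := S.summable.mul_of_nonneg R.summable (fun j => by positivity) (fun j => by positivity)
    simpa only [mul_pow, mul_inv] using this
  have hφ : ∀ n, ∃ (C : ℝ) (N : ℕ), 0 ≤ C ∧ ∀ j : S.index × R.index,
      pnorm n (tensorRight (R.φ j.2) (S.φ j.1)) ≤ C * (S.ρ j.1 * R.ρ j.2) ^ N := fun n => by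
    obtain ⟨C, hC, h⟩ := pnorm_tensorRight_le (E := E) (F := F) n
    obtain ⟨C₁, N₁, hC₁, h₁⟩ := S.pnorm_φ_le n
    obtain ⟨C₂, N₂, hC₂, h₂⟩ := R.pnorm_φ_le n
    refine ⟨C * (C₁ * C₂), max N₁ N₂, by positivity, fun j => (h _ _).trans ?_⟩
    have a₁ := S.one_le j.1
    have a₂ := R.one_le j.2
    have b₁ := (h₁ j.1).trans (mul_le_mul_of_nonneg_left
      (pow_le_pow_right₀ a₁ (le_max_left N₁ N₂)) hC₁)
    have b₂ := (h₂ j.2).trans (mul_le_mul_of_nonneg_left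
      (pow_le_pow_right₀ a₂ (le_max_right N₁ N₂)) hC₂)
    calc _ ≤ C * ((C₁ * S.ρ j.1 ^ max N₁ N₂) * (C₂ * R.ρ j.2 ^ max N₁ N₂)) := by
          gcongr
      _ = _ := by ring
  { index := S.index × R.index
    φ := fun j => tensorRight (R.φ j.2) (S.φ j.1)
    θ := fun j => tensorRight (R.θ j.2) (S.θ j.1)
    ρ := fun j => S.ρ j.1 * R.ρ j.2
    one_le := hone
    summable := hsum
    pnorm_φ_le := hφ
    integral_θ_le := by
      obtain ⟨D₁, hD₁, i₁⟩ := S.integral_θ_le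
      obtain ⟨D₂, hD₂, i₂⟩ := R.integral_θ_le
      refine ⟨D₁ * D₂, by positivity, fun j => ?_⟩
      simp only [tensorRight_apply, norm_mul]
      rw [integral_prod_mul (fun x => ‖S.θ j.1 x‖) (fun y => ‖R.θ j.2 y‖)]
      exact mul_le_mul (i₁ _) (i₂ _) (integral_nonneg fun _ => norm_nonneg _) hD₁
    coeff_le := hcoeff
    hasSum_apply := fun G z => by
      obtain ⟨x, y⟩ := z
      -- With the indices swapped, the outer sum expands in `y` and the inner sums expand the
      -- resulting coefficient functions in `x`. Absolute summability identifies the double sum with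
      -- the iterated one.
      rw [← (Equiv.prodComm R.index S.index).hasSum_iff]
      have hs : Summable ((fun j : S.index × R.index =>
          (∫ z, tensorRight (R.θ j.2) (S.θ j.1) z * G z ∂μ.prod ν) *
            tensorRight (R.φ j.2) (S.φ j.1) (x, y)) ∘ Equiv.prodComm R.index S.index) := by
        rw [Equiv.summable_iff]
        obtain ⟨C, N, hC, h⟩ := hφ 0
        obtain ⟨n, D, hD, h'⟩ := hcoeff (2 + N)
        refine Summable.of_norm_bounded (hsum.mul_left (D * pnorm n G * C)) fun j => ?_
        rw [norm_mul]
        exact mul_le_mul_inv_sq (zero_lt_one.trans_le (hone j)) (norm_nonneg _) (norm_nonneg _)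
          (h' j G) ((norm_apply_le_pnorm _ 0 (x, y)).trans (h j))
      have h1 : HasSum (fun k => slicePairing ν (R.θ k) G x * R.φ k y) (G (x, y)) := by
        simpa [slicePairing_apply] using R.hasSum_apply (sliceSnd G x) y
      refine (hs.hasSum.prod_fiberwise fun k => ?_).unique h1 ▸ hs.hasSum
      have h2 := (S.hasSum_apply (slicePairing ν (R.θ k) G) x).mul_right (R.φ k y)
      simp only [Function.comp_def, Equiv.prodComm_apply, Prod.swap_prod_mk, integral_tensor_mul]
      simpa only [tensorRight_apply, mul_assoc] using h2 }

end Prod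

end SchwartzFrame

end SchwartzTensor

namespace SchwartzTensor

/-! ### The frame on the real line: local Fourier series -/

section RealLine

theorem one_add_pow_mul_le_pnorm {E : Type} [NormedAddCommGroup E] [NormedSpace ℝ E] (f : 𝓢(E, ℂ))
    {k l n : ℕ} (hk : k ≤ n) (hl : l ≤ n) (x : E) :
    (1 + ‖x‖) ^ k * ‖iteratedFDeriv ℝ l f x‖ ≤ 2 ^ n * pnorm n f :=
  one_add_le_sup_seminorm_apply (𝕜 := ℂ) (m := (n, n)) hk hl f x

theorem one_add_norm_le {E : Type} [NormedAddCommGroup E] (x a : E) :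
    1 + ‖x‖ ≤ (1 + ‖a‖) * (1 + ‖x - a‖) := by
  have : ‖x‖ ≤ ‖x - a‖ + ‖a‖ := by simpa using norm_add_le (x - a) a
  nlinarith [norm_nonneg a, norm_nonneg (x - a)]

theorem iteratedDeriv_exp_ofReal_mul (c : ℂ) (n : ℕ) :
    iteratedDeriv n (fun x : ℝ => Complex.exp (c * x)) =
      fun x : ℝ => c ^ n * Complex.exp (c * x) := by
  induction n with
  | zero => simp
  | succ n ih =>
    rw [iteratedDeriv_succ, ih]
    funext x
    have h : HasDerivAt (fun x : ℝ => c ^ n * Complex.exp (c * x))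
        (c ^ n * (Complex.exp (c * x) * (c * 1))) x :=
      ((Complex.ofRealCLM.hasDerivAt.const_mul c).cexp).const_mul _
    rw [h.deriv]
    ring

theorem norm_iteratedFDeriv_exp_le (b : ℝ) (n : ℕ) (x : ℝ) :
    ‖iteratedFDeriv ℝ n (fun x : ℝ => Complex.exp (2 * Real.pi * Complex.I * b * x)) x‖ ≤
      (2 * Real.pi * (1 + |b|)) ^ n := by
  rw [norm_iteratedFDeriv_eq_norm_iteratedDeriv, iteratedDeriv_exp_ofReal_mul, norm_mul, norm_pow]
  have h1 : ‖Complex.exp (2 * Real.pi * Complex.I * b * x)‖ = 1 := by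
    rw [Complex.norm_exp]
    simp
  have h2 : ‖(2 * Real.pi * Complex.I * b : ℂ)‖ = 2 * Real.pi * |b| := by
    simp [abs_of_pos Real.pi_pos]
  rw [h1, h2, mul_one]
  have := Real.pi_pos
  gcongr
  linarith

theorem contDiff_exp_ofReal_mul (c : ℂ) : ContDiff ℝ ∞ fun x : ℝ => Complex.exp (c * x) :=
  (contDiff_const.mul Complex.ofRealCLM.contDiff).cexp

theorem contDiff_comp_sub {E : Type} [NormedAddCommGroup E] [NormedSpace ℝ E] (u : 𝓢(E, ℂ)) (a : E) :
    ContDiff ℝ ∞ fun x => u (x - a) :=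
  (u.smooth ⊤).comp (contDiff_id.sub contDiff_const)

/-- The constant in `norm_modulate_le`. -/
def modulateConst (n : ℕ) : ℝ := ∑ i ∈ Finset.range (n + 1), ∑ j ∈ Finset.range (i + 1),
  (i.choose j : ℝ) * (2 * Real.pi) ^ n * 2 ^ n

theorem sum_le_modulateConst {l n : ℕ} (hl : l ≤ n) :
    ∑ j ∈ Finset.range (l + 1), (l.choose j : ℝ) * (2 * Real.pi) ^ n * 2 ^ n ≤ modulateConst n :=
  Finset.single_le_sum (f := fun i => ∑ j ∈ Finset.range (i + 1),
    (i.choose j : ℝ) * (2 * Real.pi) ^ n * 2 ^ n) (fun _ _ => by positivity)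
    (Finset.mem_range.mpr (Nat.lt_succ_of_le hl))

theorem modulateConst_nonneg (n : ℕ) : 0 ≤ modulateConst n := by
  unfold modulateConst
  positivity

/-- The growth in `a` and `b` is polynomial: derivatives of the exponential produce powers of `b`,
and moving the weight from `x` to `x - a` costs powers of 1 + |a|. -/
theorem norm_modulate_le (u : 𝓢(ℝ, ℂ)) (a b : ℝ) {k l n : ℕ} (hk : k ≤ n) (hl : l ≤ n) (x : ℝ) :
    ‖x‖ ^ k * ‖iteratedFDeriv ℝ l
      (fun x : ℝ => Complex.exp (2 * Real.pi * Complex.I * b * x) * u (x - a)) x‖ ≤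
      modulateConst n * pnorm n u * ((1 + |a|) * (1 + |b|)) ^ n := by
  have hmul := norm_iteratedFDeriv_mul_le (𝕜 := ℝ) (N := ∞)
    (contDiff_exp_ofReal_mul (2 * Real.pi * Complex.I * b)) (contDiff_comp_sub u a) x (n := l)
    (mod_cast le_top)
  refine (mul_le_mul_of_nonneg_left hmul (by positivity)).trans ?_
  have hn : 0 ≤ pnorm n u := apply_nonneg _ _
  rw [mul_assoc (modulateConst n)]
  refine le_trans ?_ (mul_le_mul_of_nonneg_right (sum_le_modulateConst hl) (by positivity))
  rw [Finset.mul_sum, Finset.sum_mul]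
  refine Finset.sum_le_sum fun i hi => ?_
  have hi' : i ≤ n := (Nat.lt_succ_iff.mp (Finset.mem_range.mp hi)).trans hl
  have h1 := norm_iteratedFDeriv_exp_le b i x
  -- A base of at least 1 is needed to raise the exponent from `i` to `n`.
  have hpi : 1 ≤ 2 * Real.pi * (1 + |b|) := by nlinarith [Real.pi_gt_three, abs_nonneg b]
  have h1' := h1.trans (pow_le_pow_right₀ hpi hi')
  rw [iteratedFDeriv_comp_sub]
  have h2 := one_add_pow_mul_le_pnorm u hk ((Nat.sub_le l i).trans hl) (x - a)
  have h3 : ‖x‖ ^ k ≤ (1 + |a|) ^ n * (1 + ‖x - a‖) ^ k :=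
    calc ‖x‖ ^ k ≤ ((1 + |a|) * (1 + ‖x - a‖)) ^ k := by
          gcongr
          have := one_add_norm_le x a
          rw [Real.norm_eq_abs a] at this
          linarith
      _ = (1 + |a|) ^ k * (1 + ‖x - a‖) ^ k := mul_pow _ _ _
      _ ≤ _ := by
          gcongr
          linarith [abs_nonneg a]
  calc _ ≤ ((1 + |a|) ^ n * (1 + ‖x - a‖) ^ k) * ((l.choose i : ℝ) *
        (2 * Real.pi * (1 + |b|)) ^ n * ‖iteratedFDeriv ℝ (l - i) u (x - a)‖) := by gcongr
    _ = (1 + |a|) ^ n * ((l.choose i : ℝ) * (2 * Real.pi * (1 + |b|)) ^ n) *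
        ((1 + ‖x - a‖) ^ k * ‖iteratedFDeriv ℝ (l - i) u (x - a)‖) := by ring
    _ ≤ (1 + |a|) ^ n * ((l.choose i : ℝ) * (2 * Real.pi * (1 + |b|)) ^ n) * (2 ^ n * pnorm n u) := by
        gcongr
    _ = _ := by rw [mul_pow, mul_pow (1 + |a|)]; ring

/-- The function `x ↦ exp(2πibx) u(x - a)`. -/
def modulate (u : 𝓢(ℝ, ℂ)) (a b : ℝ) : 𝓢(ℝ, ℂ) where
  toFun x := Complex.exp (2 * Real.pi * Complex.I * b * x) * u (x - a)
  smooth' := (contDiff_exp_ofReal_mul _).mul (contDiff_comp_sub u a)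
  decay' k l := ⟨_, norm_modulate_le u a b (le_max_left k l) (le_max_right k l)⟩

theorem modulate_apply (u : 𝓢(ℝ, ℂ)) (a b x : ℝ) :
    modulate u a b x = Complex.exp (2 * Real.pi * Complex.I * b * x) * u (x - a) := rfl

theorem norm_modulate_apply (u : 𝓢(ℝ, ℂ)) (a b x : ℝ) : ‖modulate u a b x‖ = ‖u (x - a)‖ := by
  rw [modulate_apply, norm_mul, Complex.norm_exp]
  simp

theorem pnorm_modulate_le (u : 𝓢(ℝ, ℂ)) (a b : ℝ) (n : ℕ) :
    pnorm n (modulate u a b) ≤ modulateConst n * pnorm n u * ((1 + |a|) * (1 + |b|)) ^ n := by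
  have h0 : 0 ≤ modulateConst n * pnorm n u * ((1 + |a|) * (1 + |b|)) ^ n :=
    mul_nonneg (mul_nonneg (modulateConst_nonneg n) (apply_nonneg _ _)) (by positivity)
  refine pnorm_le h0 fun k hk l hl => ?_
  have h : ∀ x, ‖x‖ ^ k * ‖iteratedFDeriv ℝ l (modulate u a b) x‖ ≤ _ := norm_modulate_le u a b hk hl
  exact SchwartzMap.seminorm_le_bound ℂ k l _ h0 h

/-- The product of two Schwartz functions. -/
def smulS {E : Type} [NormedAddCommGroup E] [NormedSpace ℝ E] (f g : 𝓢(E, ℂ)) : 𝓢(E, ℂ) :=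
  SchwartzMap.pairing (ContinuousLinearMap.mul ℂ ℂ) f g

@[simp]
theorem smulS_apply {E : Type} [NormedAddCommGroup E] [NormedSpace ℝ E] (f g : 𝓢(E, ℂ)) (x : E) :
    smulS f g x = f x * g x := by
  simp [smulS, SchwartzMap.pairing_apply_apply]

/-- One factor decays away from `a`, the other away from 0, and 1 + |a| ≤ (1 + |x - a|)(1 + |x|). So
`N` additional orders of decay pay for the weight in `a`. -/
theorem pnorm_translate_mul_le (u : 𝓢(ℝ, ℂ)) (n N : ℕ) : ∃ C : ℝ, 0 ≤ C ∧
    ∀ (a : ℝ) (f : 𝓢(ℝ, ℂ)), (1 + |a|) ^ N * pnorm n (smulS (modulate u a 0) f) ≤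
      C * pnorm (n + N) f := by
  have hu : 0 ≤ pnorm (n + N) u := apply_nonneg _ _
  refine ⟨(∑ i ∈ Finset.range (n + 1), ∑ j ∈ Finset.range (i + 1), (i.choose j : ℝ)) *
    (2 ^ (n + N) * pnorm (n + N) u) * 2 ^ (n + N), by positivity, fun a f => ?_⟩
  have hf : 0 ≤ pnorm (n + N) f := apply_nonneg _ _
  have hpos : 0 < (1 + |a|) ^ N := by positivity
  rw [← le_inv_mul_iff₀ hpos]
  have h0 : 0 ≤ ((1 + |a|) ^ N)⁻¹ * ((∑ i ∈ Finset.range (n + 1), ∑ j ∈ Finset.range (i + 1),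
    (i.choose j : ℝ)) * (2 ^ (n + N) * pnorm (n + N) u) * 2 ^ (n + N) * pnorm (n + N) f) := by
    positivity
  refine pnorm_le h0 fun k hk l hl => SchwartzMap.seminorm_le_bound ℂ k l _ h0 fun x => ?_
  have hfun : (smulS (modulate u a 0) f : ℝ → ℂ) = fun x => u (x - a) * f x := by
    funext x
    simp [modulate_apply]
  rw [hfun, le_inv_mul_iff₀ hpos]
  have hmul := norm_iteratedFDeriv_mul_le (𝕜 := ℝ) (N := ∞) (contDiff_comp_sub u a) (f.smooth ⊤) x
    (n := l) (mod_cast le_top)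
  have hl' : ∑ j ∈ Finset.range (l + 1), (l.choose j : ℝ) ≤
      ∑ i ∈ Finset.range (n + 1), ∑ j ∈ Finset.range (i + 1), (i.choose j : ℝ) :=
    Finset.single_le_sum (f := fun i => ∑ j ∈ Finset.range (i + 1), (i.choose j : ℝ))
      (fun _ _ => by positivity) (Finset.mem_range.mpr (Nat.lt_succ_of_le hl))
  calc (1 + |a|) ^ N * (‖x‖ ^ k * ‖iteratedFDeriv ℝ l (fun x => u (x - a) * f x) x‖)
      ≤ (1 + |a|) ^ N * (‖x‖ ^ k * ∑ i ∈ Finset.range (l + 1), (l.choose i : ℝ) *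
        ‖iteratedFDeriv ℝ i (fun x => u (x - a)) x‖ * ‖iteratedFDeriv ℝ (l - i) f x‖) := by gcongr
    _ ≤ (∑ i ∈ Finset.range (l + 1), (l.choose i : ℝ)) * ((2 ^ (n + N) * pnorm (n + N) u) *
        (2 ^ (n + N) * pnorm (n + N) f)) := by
        rw [Finset.mul_sum, Finset.mul_sum, Finset.sum_mul]
        refine Finset.sum_le_sum fun i hi => ?_
        have hi' : i ≤ n := (Nat.lt_succ_iff.mp (Finset.mem_range.mp hi)).trans hl
        rw [iteratedFDeriv_comp_sub]
        have h1 := one_add_pow_mul_le_pnorm u (k := N) (n := n + N) (Nat.le_add_left _ _)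
          (hi'.trans (Nat.le_add_right _ _)) (x - a)
        have h2 := one_add_pow_mul_le_pnorm f (k := k + N) (n := n + N) (by omega)
          (((Nat.sub_le l i).trans hl).trans (Nat.le_add_right _ _)) x
        have h3 : 1 + |a| ≤ (1 + ‖x - a‖) * (1 + ‖x‖) := by
          have := one_add_norm_le a x
          rw [norm_sub_rev, Real.norm_eq_abs a] at this
          linarith
        calc _ ≤ ((1 + ‖x - a‖) * (1 + ‖x‖)) ^ N * ((1 + ‖x‖) ^ k * ((l.choose i : ℝ) *
              ‖iteratedFDeriv ℝ i u (x - a)‖ * ‖iteratedFDeriv ℝ (l - i) f x‖)) := by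
              gcongr
              linarith [norm_nonneg x]
          _ = (l.choose i : ℝ) * (((1 + ‖x - a‖) ^ N * ‖iteratedFDeriv ℝ i u (x - a)‖) *
              ((1 + ‖x‖) ^ (k + N) * ‖iteratedFDeriv ℝ (l - i) f x‖)) := by rw [mul_pow, pow_add]; ring
          _ ≤ _ := by gcongr
    _ ≤ (∑ i ∈ Finset.range (n + 1), ∑ j ∈ Finset.range (i + 1), (i.choose j : ℝ)) *
        ((2 ^ (n + N) * pnorm (n + N) u) * (2 ^ (n + N) * pnorm (n + N) f)) := by gcongr
    _ = _ := by ring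

/-- A function whose translates by `ℤ / 4` form a partition of unity. -/
def partitionFun (x : ℝ) : ℝ := Real.smoothTransition (4 * x + 1) - Real.smoothTransition (4 * x)

theorem partitionFun_eq_zero {x : ℝ} (hx : 4⁻¹ ≤ |x|) : partitionFun x = 0 := by
  rw [partitionFun]
  rcases le_abs.mp hx with h | h
  · rw [Real.smoothTransition.one_of_one_le (by linarith),
      Real.smoothTransition.one_of_one_le (by linarith), sub_self]
  · rw [Real.smoothTransition.zero_of_nonpos (by linarith),
      Real.smoothTransition.zero_of_nonpos (by linarith), sub_self]

/-- A telescoping sum in which only k = ⌊4x⌋ and k = ⌊4x⌋ + 1 contribute. -/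
theorem hasSum_partitionFun (x : ℝ) : HasSum (fun k : ℤ => partitionFun (x - k / 4)) 1 := by
  have h0 := Int.floor_le (4 * x)
  have h1 := Int.lt_floor_add_one (4 * x)
  have : ∑ k ∈ {⌊4 * x⌋, ⌊4 * x⌋ + 1}, partitionFun (x - k / 4) = 1 := by
    rw [Finset.sum_pair (by simp)]
    simp only [partitionFun]
    rw [Real.smoothTransition.one_of_one_le (by linarith : 1 ≤ 4 * (x - (⌊4 * x⌋ : ℝ) / 4) + 1),
      Real.smoothTransition.zero_of_nonpos
        (by push_cast; linarith : 4 * (x - ((⌊4 * x⌋ + 1 : ℤ) : ℝ) / 4) ≤ 0)]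
    push_cast
    rw [show 4 * (x - ((⌊4 * x⌋ : ℝ) + 1) / 4) + 1 = 4 * (x - (⌊4 * x⌋ : ℝ) / 4) by ring]
    ring
  rw [← this]
  refine hasSum_sum_of_ne_finset_zero fun k hk => partitionFun_eq_zero ?_
  simp only [Finset.mem_insert, Finset.mem_singleton, not_or] at hk
  rcases lt_or_ge k ⌊4 * x⌋ with h | h
  · have : (k : ℝ) + 1 ≤ ⌊4 * x⌋ := by exact_mod_cast h
    exact le_abs.mpr (.inl (by linarith))
  · have : ⌊4 * x⌋ + 2 ≤ k := by omega
    have : (⌊4 * x⌋ : ℝ) + 2 ≤ k := by exact_mod_cast this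
    exact le_abs.mpr (.inr (by linarith))

/-- A cutoff function that is `1` on `[-1/4, 1/4]` and vanishes outside `[-1/2, 1/2]`. -/
def cutoffFun (x : ℝ) : ℝ :=
  Real.smoothTransition (8 * x + 4) * Real.smoothTransition (4 - 8 * x)

theorem cutoffFun_eq_one {x : ℝ} (hx : |x| ≤ 4⁻¹) : cutoffFun x = 1 := by
  rw [abs_le] at hx
  rw [cutoffFun, Real.smoothTransition.one_of_one_le (by linarith),
    Real.smoothTransition.one_of_one_le (by linarith), mul_one]

theorem cutoffFun_eq_zero {x : ℝ} (hx : 2⁻¹ ≤ |x|) : cutoffFun x = 0 := by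
  rw [cutoffFun]
  rcases le_abs.mp hx with h | h
  · rw [Real.smoothTransition.zero_of_nonpos (by linarith : 4 - 8 * x ≤ 0), mul_zero]
  · rw [Real.smoothTransition.zero_of_nonpos (by linarith : 8 * x + 4 ≤ 0), zero_mul]

theorem hasCompactSupport_of_abs {f : ℝ → ℝ} {r : ℝ} (h : ∀ x, r ≤ |x| → f x = 0) :
    HasCompactSupport fun x => (f x : ℂ) :=
  HasCompactSupport.intro (isCompact_closedBall (0 : ℝ) r) fun x hx => by
    rw [mem_closedBall_zero_iff, Real.norm_eq_abs, not_le] at hx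
    rw [h x hx.le, Complex.ofReal_zero]

/-- `partitionFun` as a Schwartz function. -/
def partitionS : 𝓢(ℝ, ℂ) :=
  (hasCompactSupport_of_abs fun _ => partitionFun_eq_zero).toSchwartzMap
    (Complex.ofRealCLM.contDiff.comp ((Real.smoothTransition.contDiff.comp (by fun_prop)).sub
      (Real.smoothTransition.contDiff.comp (by fun_prop))))

/-- `cutoffFun` as a Schwartz function. -/
def cutoffS : 𝓢(ℝ, ℂ) :=
  (hasCompactSupport_of_abs fun _ => cutoffFun_eq_zero).toSchwartzMap
    (Complex.ofRealCLM.contDiff.comp ((Real.smoothTransition.contDiff.comp (by fun_prop)).mul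
      (Real.smoothTransition.contDiff.comp (by fun_prop))))

theorem partitionS_apply (x : ℝ) : partitionS x = partitionFun x := rfl

theorem cutoffS_apply (x : ℝ) : cutoffS x = cutoffFun x := rfl

theorem integral_modulate_mul (u f : 𝓢(ℝ, ℂ)) (a b : ℝ) :
    ∫ x, modulate u a (-b) x * f x = (FourierTransform.fourier (smulS (modulate u a 0) f)) b := by
  rw [SchwartzMap.fourier_coe, Real.fourier_real_eq_integral_exp_smul]
  refine integral_congr_ae (.of_forall fun x => ?_)
  simp only [modulate_apply, smulS_apply, smul_eq_mul]
  push_cast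
  rw [mul_zero, zero_mul, Complex.exp_zero, one_mul, ← mul_assoc]
  congr 3
  ring

/-- By Poisson summation the Fourier series is the 1-periodisation of the localised piece. The piece
vanishes for |x - a| ≥ 1/4, so only its zeroth translate is seen where |x - a| < 1/2; the cutoff
removes the other periods and equals 1 on the piece. -/
theorem tsum_fourier_mul_cutoff (f : 𝓢(ℝ, ℂ)) (a x : ℝ) :
    (∑' m : ℤ, (FourierTransform.fourier (smulS (modulate partitionS a 0) f)) (m : ℝ) *
      Complex.exp (2 * Real.pi * Complex.I * m * x)) * cutoffFun (x - a) =
      partitionFun (x - a) * f x := by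
  have hs : ∀ y, smulS (modulate partitionS a 0) f y = partitionFun (y - a) * f y := fun y => by
    simp [modulate_apply, partitionS_apply]
  rcases le_or_gt 2⁻¹ |x - a| with h | h
  · rw [cutoffFun_eq_zero h, partitionFun_eq_zero (le_trans (by norm_num) h)]
    simp
  · have hP := SchwartzMap.tsum_eq_tsum_fourier (smulS (modulate partitionS a 0) f) x
    simp only [fourier_coe_apply, Complex.ofReal_one, div_one] at hP
    rw [← hP, tsum_eq_single 0, hs]
    · rcases le_or_gt |x - a| 4⁻¹ with h' | h'
      · rw [cutoffFun_eq_one h']; simp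
      · have := partitionFun_eq_zero h'.le
        simp [this]
    · intro k hk
      rw [hs, partitionFun_eq_zero, Complex.ofReal_zero, zero_mul]
      have h1 : (1 : ℝ) ≤ |(k : ℝ)| := by exact_mod_cast Int.one_le_abs hk
      have h2 : |(k : ℝ)| ≤ |x + k - a| + |x - a| := by
        have := abs_sub (x + k - a) (x - a)
        rwa [show x + k - a - (x - a) = (k : ℝ) by ring] at this
      linarith

theorem summable_inv_one_add_abs_sq : Summable fun k : ℤ => ((1 + |(k : ℝ)|) ^ 2)⁻¹ := by
  refine Summable.of_norm_bounded_eventually ((Real.summable_one_div_int_pow (p := 2)).mpr one_lt_two) ?_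
  filter_upwards [(Set.finite_singleton (0 : ℤ)).compl_mem_cofinite] with k hk
  have hk : (k : ℝ) ≠ 0 := by exact_mod_cast hk
  rw [Real.norm_of_nonneg (by positivity), one_div, ← sq_abs (k : ℝ)]
  have := abs_pos.mpr hk
  gcongr
  linarith

theorem summable_inv_one_add_abs_div_sq :
    Summable fun k : ℤ => ((1 + |(k : ℝ) / 4|) ^ 2)⁻¹ := by
  refine Summable.of_nonneg_of_le (fun k => by positivity) (fun k => ?_)
    (summable_inv_one_add_abs_sq.mul_left 16)
  rw [← div_eq_mul_inv, inv_le_comm₀ (by positivity) (by positivity), inv_div, div_le_iff₀ (by norm_num),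
    abs_div, abs_of_pos (by norm_num : (0 : ℝ) < 4)]
  nlinarith [abs_nonneg (k : ℝ)]

/-- The frame on the real line. -/
def SchwartzFrame.real : SchwartzFrame ℝ volume :=
  have hone : ∀ j : ℤ × ℤ, 1 ≤ (1 + |(j.1 : ℝ) / 4|) * (1 + |(j.2 : ℝ)|) := fun j =>
    one_le_mul_of_one_le_of_one_le (by linarith [abs_nonneg ((j.1 : ℝ) / 4)])
      (by linarith [abs_nonneg (j.2 : ℝ)])
  have hsum : Summable fun j : ℤ × ℤ => (((1 + |(j.1 : ℝ) / 4|) * (1 + |(j.2 : ℝ)|)) ^ 2)⁻¹ := by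
    have := summable_inv_one_add_abs_div_sq.mul_of_nonneg summable_inv_one_add_abs_sq
      (fun j => by positivity) (fun j => by positivity)
    simpa only [mul_pow, mul_inv] using this
  have hφ : ∀ n, ∃ (C : ℝ) (N : ℕ), 0 ≤ C ∧ ∀ j : ℤ × ℤ,
      pnorm n (modulate cutoffS (j.1 / 4) j.2) ≤
        C * ((1 + |(j.1 : ℝ) / 4|) * (1 + |(j.2 : ℝ)|)) ^ N := fun n =>
    ⟨_, n, mul_nonneg (modulateConst_nonneg n) (apply_nonneg _ _),
      fun j => pnorm_modulate_le cutoffS (j.1 / 4) j.2 n⟩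
  -- The coefficient is the Fourier transform of a localised piece at an integer: smoothness gives
  -- decay in the frequency `j.2`, localisation gives decay in the position `j.1`.
  have hcoeff : ∀ N : ℕ, ∃ (n : ℕ) (C : ℝ), 0 ≤ C ∧ ∀ (j : ℤ × ℤ) (f : 𝓢(ℝ, ℂ)),
      ((1 + |(j.1 : ℝ) / 4|) * (1 + |(j.2 : ℝ)|)) ^ N *
        ‖∫ x, modulate partitionS (j.1 / 4) (-j.2) x * f x‖ ≤ C * pnorm n f := fun N => by
    obtain ⟨n, C, hC, h⟩ := exists_pnorm_le_pnorm (fourierTransformCLM ℂ : 𝓢(ℝ, ℂ) →L[ℂ] 𝓢(ℝ, ℂ)) N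
    obtain ⟨D, hD, h'⟩ := pnorm_translate_mul_le partitionS n N
    refine ⟨n + N, 2 ^ N * C * D, by positivity, fun j f => ?_⟩
    rw [integral_modulate_mul, mul_pow]
    have h1 := one_add_pow_mul_le_pnorm
      (FourierTransform.fourier (smulS (modulate partitionS (j.1 / 4) 0) f)) (n := N) le_rfl
      (Nat.zero_le _) (j.2 : ℝ)
    rw [norm_iteratedFDeriv_zero, Real.norm_eq_abs] at h1
    have h2 : pnorm N (FourierTransform.fourier (smulS (modulate partitionS (j.1 / 4) 0) f)) ≤ _ :=
      h (smulS (modulate partitionS (j.1 / 4) 0) f)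
    calc _ = (1 + |(j.1 : ℝ) / 4|) ^ N * ((1 + |(j.2 : ℝ)|) ^ N * ‖FourierTransform.fourier
          (smulS (modulate partitionS (j.1 / 4) 0) f) (j.2 : ℝ)‖) := by ring
      _ ≤ (1 + |(j.1 : ℝ) / 4|) ^ N *
          (2 ^ N * (C * pnorm n (smulS (modulate partitionS (j.1 / 4) 0) f))) := by
          exact mul_le_mul_of_nonneg_left (h1.trans (mul_le_mul_of_nonneg_left h2 (by positivity)))
            (by positivity)
      _ = 2 ^ N * C * ((1 + |(j.1 : ℝ) / 4|) ^ N *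
          pnorm n (smulS (modulate partitionS (j.1 / 4) 0) f)) := by ring
      _ ≤ 2 ^ N * C * (D * pnorm (n + N) f) := 
          mul_le_mul_of_nonneg_left (h' _ f) (by positivity)
      _ = _ := by ring
  { index := ℤ × ℤ
    φ := fun j => modulate cutoffS (j.1 / 4) j.2
    θ := fun j => modulate partitionS (j.1 / 4) (-j.2)
    ρ := fun j => (1 + |(j.1 : ℝ) / 4|) * (1 + |(j.2 : ℝ)|)
    one_le := hone
    summable := hsum
    pnorm_φ_le := hφ
    integral_θ_le := by
      refine ⟨∫ x, ‖partitionS x‖, integral_nonneg fun _ => norm_nonneg _, fun j => ?_⟩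
      simp only [norm_modulate_apply]
      exact (integral_sub_right_eq_self (fun x => ‖partitionS x‖) ((j.1 : ℝ) / 4)).le
    coeff_le := hcoeff
    hasSum_apply := fun f x => by
      have hs : Summable fun j : ℤ × ℤ => (∫ y, modulate partitionS (j.1 / 4) (-j.2) y * f y) *
          modulate cutoffS (j.1 / 4) j.2 x := by
        obtain ⟨C, N, hC, h⟩ := hφ 0
        obtain ⟨n, D, hD, h'⟩ := hcoeff (2 + N)
        refine Summable.of_norm_bounded (hsum.mul_left (D * pnorm n f * C)) fun j => ?_
        rw [norm_mul]
        exact mul_le_mul_inv_sq (zero_lt_one.trans_le (hone j)) (norm_nonneg _) (norm_nonneg _)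
          (h' j f) ((norm_apply_le_pnorm _ 0 x).trans (h j))
      have h1 : HasSum (fun k : ℤ => (partitionFun (x - k / 4) : ℂ) * f x) (f x) := by
        have := ((hasSum_partitionFun x).mapL Complex.ofRealCLM).mul_right (f x)
        simpa using this
      refine (hs.hasSum.prod_fiberwise fun k => ?_).unique h1 ▸ hs.hasSum
      have h2 := (hs.prod_factor k).hasSum
      have h3 : ∑' m : ℤ, (∫ y, modulate partitionS ((k : ℝ) / 4) (-m) y * f y) *
          modulate cutoffS (k / 4) m x = partitionFun (x - k / 4) * f x := by
        rw [← tsum_fourier_mul_cutoff, ← tsum_mul_right]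
        refine tsum_congr fun m => ?_
        rw [integral_modulate_mul, modulate_apply, cutoffS_apply, Complex.ofReal_intCast, ← mul_assoc]
      rwa [h3] at h2 }

end RealLine

end SchwartzTensor

namespace SchwartzTensor

/-! ### Existence of frames and convergence of expansions -/

namespace SchwartzFrame

/-- Induction on the dimension: split off a line, transport the product frame by a linear
isomorphism, and rescale because Haar measures are proportional. -/
theorem nonempty_of_finrank_eq (d : ℕ) : ∀ (E : Type) [NormedAddCommGroup E] [NormedSpace ℝ E]
    [FiniteDimensional ℝ E] [MeasurableSpace E] [BorelSpace E] (μ : Measure E) [μ.IsAddHaarMeasure],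
    Module.finrank ℝ E = d → Nonempty (SchwartzFrame E μ) := by
  induction d with
  | zero =>
    intro E _ _ _ _ _ μ _ h
    have : Subsingleton E := Module.finrank_zero_iff.mp h
    refine ⟨ofSubsingleton μ ?_ ?_⟩
    · exact isOpen_univ.measure_ne_zero μ Set.univ_nonempty
    · exact (IsCompact.measure_lt_top (Set.toFinite _).isCompact).ne
  | succ d ih =>
    intro E _ _ _ _ _ μ _ h
    obtain ⟨R⟩ := ih (EuclideanSpace ℝ (Fin d)) volume (by simp)
    let e : (ℝ × EuclideanSpace ℝ (Fin d)) ≃L[ℝ] E := ContinuousLinearEquiv.ofFinrankEq (by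
      rw [h, Module.finrank_prod, Module.finrank_self, finrank_euclideanSpace_fin, add_comm])
    have : (((volume : Measure ℝ).prod (volume : Measure (EuclideanSpace ℝ (Fin d)))).map
        e).IsAddHaarMeasure := e.isAddHaarMeasure_map _
    rw [Measure.isAddLeftInvariant_eq_smul μ
      (((volume : Measure ℝ).prod (volume : Measure (EuclideanSpace ℝ (Fin d)))).map e)]
    exact ⟨((real.prod R).map e).smul _ (ENNReal.coe_ne_zero.mpr
      (Measure.addHaarScalarFactor_pos_of_isAddHaarMeasure _ _).ne') ENNReal.coe_ne_top⟩

instance {E : Type} [NormedAddCommGroup E] [NormedSpace ℝ E] [FiniteDimensional ℝ E]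
    [MeasurableSpace E] [BorelSpace E] (μ : Measure E) [μ.IsAddHaarMeasure] :
    Nonempty (SchwartzFrame E μ) :=
  nonempty_of_finrank_eq _ E μ rfl

section Expansion
variable {E G : Type} [NormedAddCommGroup E] [NormedSpace ℝ E] [MeasurableSpace E] [BorelSpace E]
  [SecondCountableTopology E] {μ : Measure E} [hμ : μ.HasTemperateGrowth]
  [NormedAddCommGroup G] [NormedSpace ℝ G] (S : SchwartzFrame E μ)

/-- The coefficients of an expansion, as linear forms. -/
def coeff (j : S.index) : 𝓢(E, ℂ) →L[ℂ] ℂ :=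
  (integralCLM ℂ μ).comp (SchwartzMap.pairing (ContinuousLinearMap.mul ℂ ℂ) (S.θ j))

theorem coeff_apply (j : S.index) (f : 𝓢(E, ℂ)) : S.coeff j f = ∫ x, S.θ j x * f x ∂μ := by
  change integralCLM ℂ μ _ = _
  rw [integralCLM_apply]
  exact integral_congr_ae (.of_forall fun x => smulS_apply _ _ x)

theorem pow_mul_norm_coeff_le (N : ℕ) : ∃ (n : ℕ) (C : ℝ), 0 ≤ C ∧
    ∀ j f, S.ρ j ^ N * ‖S.coeff j f‖ ≤ C * pnorm n f := by
  simpa only [coeff_apply] using S.coeff_le N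

theorem ρ_pos (j : S.index) : 0 < S.ρ j := zero_lt_one.trans_le (S.one_le j)

/-- A family of Schwartz functions whose seminorms grow at most polynomially. -/
def Moderate (b : S.index → 𝓢(G, ℂ)) : Prop :=
  ∀ n, ∃ (C : ℝ) (N : ℕ), 0 ≤ C ∧ ∀ j, pnorm n (b j) ≤ C * S.ρ j ^ N

variable {S}

/-- `N` and `D` do not depend on the coefficients, and the bound is linear in `A`; this is what
makes maps defined by such series continuous. -/
theorem Moderate.summable {b : S.index → 𝓢(G, ℂ)} (hb : S.Moderate b) (n : ℕ) :
    ∃ (N : ℕ) (D : ℝ), 0 ≤ D ∧ ∀ (a : S.index → ℂ) (A : ℝ), (∀ j, S.ρ j ^ N * ‖a j‖ ≤ A) →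
      Summable (fun j => pnorm n (a j • b j)) ∧ ∑' j, pnorm n (a j • b j) ≤ D * A := by
  obtain ⟨C, N, hC, h⟩ := hb n
  refine ⟨2 + N, C * ∑' j, (S.ρ j ^ 2)⁻¹,
    mul_nonneg hC (tsum_nonneg fun j => inv_nonneg.mpr (sq_nonneg _)), fun a A ha => ?_⟩
  have hle : ∀ j, pnorm n (a j • b j) ≤ A * C * (S.ρ j ^ 2)⁻¹ := fun j => by
    rw [map_smul_eq_mul]
    exact mul_le_mul_inv_sq (S.ρ_pos j) (norm_nonneg _) (apply_nonneg _ _) (ha j) (h j)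
  have hs := S.summable.mul_left (A * C)
  have hs' := Summable.of_nonneg_of_le (fun j => apply_nonneg _ _) hle hs
  refine ⟨hs', (hs'.tsum_le_tsum hle hs).trans_eq ?_⟩
  rw [tsum_mul_left]
  ring

/-- A series with rapidly decreasing coefficients converges in the Schwartz space. -/
theorem Moderate.exists_hasSum {b : S.index → 𝓢(G, ℂ)} (hb : S.Moderate b) {a : S.index → ℂ}
    (ha : ∀ N : ℕ, ∃ A, ∀ j, S.ρ j ^ N * ‖a j‖ ≤ A) :
    ∃ f, HasSum (fun j => a j • b j) f ∧ ∀ n, pnorm n f ≤ ∑' j, pnorm n (a j • b j) :=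
  exists_hasSum_of_summable_pnorm fun n => by
    obtain ⟨N, D, -, h⟩ := hb.summable n
    obtain ⟨A, hA⟩ := ha N
    exact (h a A hA).1

theorem exists_coeff_bound (f : 𝓢(E, ℂ)) (N : ℕ) : ∃ A, ∀ j, S.ρ j ^ N * ‖S.coeff j f‖ ≤ A := by
  obtain ⟨n, C, -, h⟩ := S.pow_mul_norm_coeff_le N
  exact ⟨_, fun j => h j f⟩

theorem Moderate.exists_clm {b : S.index → 𝓢(G, ℂ)} (hb : S.Moderate b) :
    ∃ L : 𝓢(E, ℂ) →L[ℂ] 𝓢(G, ℂ), ∀ f, HasSum (fun j => S.coeff j f • b j) (L f) := by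
  choose L hL hLn using fun f : 𝓢(E, ℂ) => hb.exists_hasSum (exists_coeff_bound (S := S) f)
  let L' : 𝓢(E, ℂ) →ₗ[ℂ] 𝓢(G, ℂ) :=
    { toFun := L
      map_add' := fun f g => (hL (f + g)).unique (by
        simpa only [map_add, add_smul] using (hL f).add (hL g))
      map_smul' := fun c f => (hL (c • f)).unique (by
        simpa only [map_smul, smul_eq_mul, mul_smul, RingHom.id_apply] using (hL f).const_smul c) }
  refine ⟨⟨L', continuous_of_pnorm_le_pnorm L' fun m => ?_⟩, hL⟩
  obtain ⟨N, D, hD, h⟩ := hb.summable m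
  obtain ⟨n, C, hC, h'⟩ := S.pow_mul_norm_coeff_le N
  refine ⟨n, D * C, fun f => (hLn f m).trans (((h _ _ fun j => h' j f).2).trans_eq ?_)⟩
  ring

variable (S)

theorem moderate_φ : S.Moderate S.φ := S.pnorm_φ_le

theorem hasSum_coeff_smul (f : 𝓢(E, ℂ)) : HasSum (fun j => S.coeff j f • S.φ j) f := by
  refine hasSum_of_summable_pnorm (fun n => ?_) fun x => ?_
  · obtain ⟨N, D, -, h⟩ := S.moderate_φ.summable n
    obtain ⟨A, hA⟩ := exists_coeff_bound (S := S) f N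
    exact (h _ A hA).1
  · simpa only [coeff_apply, smul_apply, smul_eq_mul] using S.hasSum_apply f x

theorem hasSum_coeff_mul (T : 𝓢(E, ℂ) →L[ℂ] ℂ) (f : 𝓢(E, ℂ)) :
    HasSum (fun j => S.coeff j f * T (S.φ j)) (T f) := by
  simpa using (S.hasSum_coeff_smul f).mapL T

end Expansion

/-! ### Continuous maps and elementary tensors -/

section Tensor
variable {E F G : Type} [NormedAddCommGroup E] [NormedSpace ℝ E] [MeasurableSpace E] [BorelSpace E]
  [SecondCountableTopology E] [NormedAddCommGroup F] [NormedSpace ℝ F] [MeasurableSpace F]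
  [BorelSpace F] [SecondCountableTopology F] {μ : Measure E} {ν : Measure F} [SFinite μ] [SFinite ν]
  [hμ : μ.HasTemperateGrowth] [hν : ν.HasTemperateGrowth] [hμν : (μ.prod ν).HasTemperateGrowth]
  [NormedAddCommGroup G] [NormedSpace ℝ G]

theorem coeff_prod_tensor (S : SchwartzFrame E μ) (R : SchwartzFrame F ν) (j : (S.prod R).index) (f : 𝓢(E, ℂ))
    (g : 𝓢(F, ℂ)) : (S.prod R).coeff j (tensorRight g f) = S.coeff j.1 f * R.coeff j.2 g := by
  rw [coeff_apply, coeff_apply, coeff_apply, ← integral_prod_mul]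
  refine integral_congr_ae (.of_forall fun z => ?_)
  change S.θ j.1 z.1 * R.θ j.2 z.2 * (f z.1 * g z.2) = _
  ring

/-- The expansion in the product frame is a convergent series of multiples of elementary tensors. -/
theorem clm_ext_tensor (S : SchwartzFrame E μ) (R : SchwartzFrame F ν) {M : Type*} [AddCommGroup M] [Module ℂ M] [TopologicalSpace M] [T2Space M]
    [IsTopologicalAddGroup M] {T T' : 𝓢(E × F, ℂ) →L[ℂ] M}
    (h : ∀ f g, T (tensorRight g f) = T' (tensorRight g f)) : T = T' := by
  ext f
  have h1 := ((S.prod R).hasSum_coeff_smul f).mapL T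
  have h2 := ((S.prod R).hasSum_coeff_smul f).mapL T'
  refine h1.unique ?_
  convert h2 using 2 with j
  rw [map_smul, map_smul]
  congr 1
  exact h _ _

/-- The map sends the elements of the product frame to their values under `B`, a moderate family. On
an elementary tensor the coefficients factor, and iterated summation with separate continuity
recovers `B f g`. -/
theorem exists_clm_tensor (S : SchwartzFrame E μ) (R : SchwartzFrame F ν)
    (B : 𝓢(E, ℂ) →ₗ[ℂ] 𝓢(F, ℂ) →ₗ[ℂ] 𝓢(G, ℂ))
    (hB : ∀ m, ∃ (n : ℕ) (C : ℝ), 0 ≤ C ∧ ∀ f g, pnorm m (B f g) ≤ C * pnorm n f * pnorm n g) :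
    ∃ L : 𝓢(E × F, ℂ) →L[ℂ] 𝓢(G, ℂ), ∀ f g, L (tensorRight g f) = B f g := by
  have hb : (S.prod R).Moderate fun j => B (S.φ j.1) (R.φ j.2) := fun m => by
    obtain ⟨n, C, hC, h⟩ := hB m
    obtain ⟨C₁, N₁, hC₁, h₁⟩ := S.pnorm_φ_le n
    obtain ⟨C₂, N₂, hC₂, h₂⟩ := R.pnorm_φ_le n
    refine ⟨C * (C₁ * C₂), max N₁ N₂, by positivity, fun j => (h _ _).trans ?_⟩
    have b₁ := (h₁ j.1).trans (mul_le_mul_of_nonneg_left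
      (pow_le_pow_right₀ (S.one_le j.1) (le_max_left N₁ N₂)) hC₁)
    have b₂ := (h₂ j.2).trans (mul_le_mul_of_nonneg_left
      (pow_le_pow_right₀ (R.one_le j.2) (le_max_right N₁ N₂)) hC₂)
    have p₁ := S.ρ_pos j.1
    calc _ ≤ C * (C₁ * S.ρ j.1 ^ max N₁ N₂) * (C₂ * R.ρ j.2 ^ max N₁ N₂) := by gcongr
      _ = C * (C₁ * C₂) * (S.ρ j.1 * R.ρ j.2) ^ max N₁ N₂ := by ring
  obtain ⟨L, hL⟩ := hb.exists_clm
  refine ⟨L, fun f g => ?_⟩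
  have hl : ∀ g, Continuous (B.flip g) := fun g => continuous_of_pnorm_le_pnorm _ fun m => by
    obtain ⟨n, C, -, h⟩ := hB m
    exact ⟨n, C * pnorm n g, fun f => (h f g).trans_eq (by ring)⟩
  have hr : ∀ f, Continuous (B f) := fun f => continuous_of_pnorm_le_pnorm _ fun m => by
    obtain ⟨n, C, -, h⟩ := hB m
    exact ⟨n, C * pnorm n f, fun g => h f g⟩
  have h1 : HasSum (fun j => S.coeff j f • B (S.φ j) g) (B f g) := by
    simpa using (S.hasSum_coeff_smul f).mapL ⟨B.flip g, hl g⟩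
  refine ((hL (tensorRight g f)).prod_fiberwise fun j => ?_).unique h1
  have h2 : HasSum (fun k => R.coeff k g • B (S.φ j) (R.φ k)) (B (S.φ j) g) := by
    simpa using (R.hasSum_coeff_smul g).mapL ⟨B (S.φ j), hr _⟩
  have h3 := h2.const_smul (S.coeff j f)
  convert h3 using 2 with k
  rw [smul_smul]
  congr 1
  exact coeff_prod_tensor S R (j, k) f g

end Tensor

end SchwartzFrame

end SchwartzTensor

namespace SchwartzTensor

/-! ### Joint rapid decrease by uniform boundedness on ℓ¹ -/

section SummableSequences
variable {ι : Type}

theorem summable_norm_lp_one (t : lp (fun _ : ι => ℂ) 1) : Summable fun j => ‖t j‖ := by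
  simpa using (memℓp_gen_iff (p := 1) (by simp)).mp (lp.memℓp t)

theorem norm_lp_one_eq_tsum (t : lp (fun _ : ι => ℂ) 1) : ‖t‖ = ∑' j, ‖t j‖ := by
  simpa using lp.norm_eq_tsum_rpow (p := 1) (by simp) t

theorem summable_lp_one_mul {c : ι → ℂ} {B : ℝ} (hc : ∀ j, ‖c j‖ ≤ B) (t : lp (fun _ : ι => ℂ) 1) :
    Summable fun j => t j * c j :=
  Summable.of_norm_bounded ((summable_norm_lp_one t).mul_right B) fun j => by
    rw [norm_mul]
    gcongr
    exact hc j

theorem norm_tsum_lp_one_mul_le {c : ι → ℂ} {B : ℝ} (hc : ∀ j, ‖c j‖ ≤ B)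
    (t : lp (fun _ : ι => ℂ) 1) : ‖∑' j, t j * c j‖ ≤ B * ‖t‖ := by
  rw [norm_lp_one_eq_tsum, mul_comm, ← tsum_mul_right]
  exact tsum_of_norm_bounded ((summable_norm_lp_one t).mul_right B).hasSum fun j => by
    rw [norm_mul]
    gcongr
    exact hc j

/-- The linear form on `ℓ¹` given by a bounded family. -/
def lpOnePairing (c : ι → ℂ) (B : ℝ) (hc : ∀ j, ‖c j‖ ≤ B) : lp (fun _ : ι => ℂ) 1 →L[ℂ] ℂ :=
  LinearMap.mkContinuous
    { toFun := fun t => ∑' j, t j * c j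
      map_add' := fun t s => by
        simp only [lp.coeFn_add, Pi.add_apply, add_mul]
        exact (summable_lp_one_mul hc t).tsum_add (summable_lp_one_mul hc s)
      map_smul' := fun a t => by
        simp only [lp.coeFn_smul, Pi.smul_apply, smul_eq_mul, mul_assoc, tsum_mul_left,
          RingHom.id_apply] }
    B (norm_tsum_lp_one_mul_le hc)

theorem lpOnePairing_apply (c : ι → ℂ) (B : ℝ) (hc : ∀ j, ‖c j‖ ≤ B) (t : lp (fun _ : ι => ℂ) 1) :
    lpOnePairing c B hc t = ∑' j, t j * c j := rfl

end SummableSequences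

namespace SchwartzFrame

section Rapid
variable {E : Type} [NormedAddCommGroup E] [NormedSpace ℝ E] [MeasurableSpace E] [BorelSpace E]
  [SecondCountableTopology E] {μ : Measure E} [hμ : μ.HasTemperateGrowth]

/-- The superposition `∑ⱼ tⱼ ρⱼᴺ θⱼ` as a tempered distribution. -/
theorem exists_superposition (S : SchwartzFrame E μ) (N : ℕ) (t : lp (fun _ : S.index => ℂ) 1) :
    ∃ T : 𝓢(E, ℂ) →L[ℂ] ℂ, ∀ f, T f = ∑' j, t j * ((S.ρ j ^ N : ℝ) * S.coeff j f) := by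
  obtain ⟨n, C, hC, h⟩ := S.pow_mul_norm_coeff_le N
  have h' : ∀ f j, ‖((S.ρ j ^ N : ℝ) : ℂ) * S.coeff j f‖ ≤ C * pnorm n f := fun f j => by
    rw [norm_mul, Complex.norm_real, Real.norm_of_nonneg (pow_nonneg (S.ρ_pos j).le _)]
    exact h j f
  let T : 𝓢(E, ℂ) →ₗ[ℂ] ℂ :=
    { toFun := fun f => ∑' j, t j * ((S.ρ j ^ N : ℝ) * S.coeff j f)
      map_add' := fun f g => by
        simp only [map_add, mul_add]
        exact (summable_lp_one_mul (h' f) t).tsum_add (summable_lp_one_mul (h' g) t)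
      map_smul' := fun a f => by
        simp only [map_smul, smul_eq_mul, RingHom.id_apply]
        rw [← tsum_mul_left]
        exact tsum_congr fun j => by ring }
  refine ⟨⟨T, continuous_of_norm_le_pnorm T (n := n) (C := C * ‖t‖) fun f => ?_⟩, fun f => rfl⟩
  exact (norm_tsum_lp_one_mul_le (h' f) t).trans_eq (by ring)

/-- If `⟨T, uₖ⟩` is rapidly decreasing for every tempered distribution `T`, then the coefficients of
the `uₖ` are jointly rapidly decreasing. -/
theorem exists_pow_mul_norm_coeff_le (S : SchwartzFrame E μ) {κ : Type} (r : κ → ℝ)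
    (hr : ∀ k, 0 < r k) (u : κ → 𝓢(E, ℂ))
    (h : ∀ (T : 𝓢(E, ℂ) →L[ℂ] ℂ) (N : ℕ), ∃ A, ∀ k, r k ^ N * ‖T (u k)‖ ≤ A) (N : ℕ) :
    ∃ A, ∀ j k, (S.ρ j * r k) ^ N * ‖S.coeff j (u k)‖ ≤ A := by
  classical
  obtain ⟨n, C, hC, hn⟩ := S.pow_mul_norm_coeff_le N
  have hc : ∀ k j, ‖((r k ^ N : ℝ) : ℂ) * (((S.ρ j ^ N : ℝ) : ℂ) * S.coeff j (u k))‖ ≤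
      r k ^ N * (C * pnorm n (u k)) := fun k j => by
    rw [norm_mul, norm_mul, Complex.norm_real, Complex.norm_real,
      Real.norm_of_nonneg (pow_nonneg (S.ρ_pos j).le _), Real.norm_of_nonneg (pow_nonneg (hr k).le _)]
    exact mul_le_mul_of_nonneg_left (hn j _) (pow_nonneg (hr k).le _)
  -- At `t` the form takes the value `r k ^ N * T (u k)`, where `T` is the superposition belonging
  -- to `t`; so the hypothesis on single distributions gives pointwise bounds.
  obtain ⟨A, hA⟩ := banach_steinhaus (g := fun k => lpOnePairing _ _ (hc k)) fun t => by
    obtain ⟨T, hT⟩ := S.exists_superposition N t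
    obtain ⟨A, hA⟩ := h T N
    refine ⟨A, fun k => le_trans (le_of_eq ?_) (hA k)⟩
    have hrk : r k ^ N = ‖((r k ^ N : ℝ) : ℂ)‖ := by
      rw [Complex.norm_real, Real.norm_of_nonneg (pow_nonneg (hr k).le N)]
    rw [lpOnePairing_apply, hT, hrk, ← norm_mul, ← tsum_mul_left, ← hrk]
    congr 1
    exact tsum_congr fun j => by ring
  refine ⟨A, fun j k => ?_⟩
  -- Unit vectors of ℓ¹ recover the individual coefficients, now with one bound for all `j` and `k`.
  have h1 := (lpOnePairing _ _ (hc k)).le_of_opNorm_le (hA k) (lp.single 1 j (1 : ℂ))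
  rw [lpOnePairing_apply, tsum_eq_single j (fun i hi => by simp [lp.single_apply, hi]),
    lp.norm_single (by simp), lp.single_apply_self, one_mul, norm_mul, norm_mul, Complex.norm_real, Complex.norm_real,
      Real.norm_of_nonneg (pow_nonneg (S.ρ_pos j).le _), Real.norm_of_nonneg (pow_nonneg (hr k).le _)]
    at h1
  simp only [norm_one, mul_one] at h1
  rw [mul_pow]
  linarith

end Rapid

end SchwartzFrame

end SchwartzTensor

/-! ### The Schwartz kernel of T ↦ f₁ # T # f₂ -/

namespace PhaseSpace

open SchwartzTensor

variable {n : ℕ}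

/-- A frame on phase space. -/
def frame (n : ℕ) : SchwartzFrame (Xi n) (dX n) := Classical.choice inferInstance

/-- The product frame on `Ξ × Ξ`. -/
def frame₂ (n : ℕ) : SchwartzFrame (Xi n × Xi n) (dXdY n) := (frame n).prod (frame n)

theorem coeff_eq_pair (j : (frame n).index) (f : 𝓢(Xi n, ℂ)) :
    (frame n).coeff j f = pair ((frame n).θ j) f := (frame n).coeff_apply j f

theorem clm_ext {M : Type*} [AddCommGroup M] [Module ℂ M] [TopologicalSpace M] [T2Space M]
    [IsTopologicalAddGroup M] {T T' : 𝓢(Xi n × Xi n, ℂ) →L[ℂ] M}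
    (h : ∀ f g, T (tensor f g) = T' (tensor f g)) : T = T' :=
  SchwartzFrame.clm_ext_tensor (frame n) (frame n) h

theorem pair_comm (f g : 𝓢(Xi n, ℂ)) : pair f g = pair g f := by
  simp only [pair, mul_comm]

/-- `f ↦ ⟨g, f⟩` is linear and continuous. -/
def pairCLM (g : 𝓢(Xi n, ℂ)) : 𝓢(Xi n, ℂ) →L[ℂ] ℂ :=
  (integralCLM ℂ (dX n)).comp (SchwartzMap.pairing (ContinuousLinearMap.mul ℂ ℂ) g)

theorem pairCLM_apply (g f : 𝓢(Xi n, ℂ)) : pairCLM g f = pair g f := by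
  change integralCLM ℂ (dX n) _ = _
  rw [integralCLM_apply]
  exact integral_congr_ae (.of_forall fun x => smulS_apply _ _ x)

namespace CompositionLaw

variable (P : CompositionLaw n)

/-- Both sides are ∫ f # g # h. -/
theorem pair_mul_left (f g h : 𝓢(Xi n, ℂ)) : pair (P.mul f g) h = pair f (P.mul g h) := by
  rw [pair, ← P.integral_mul, P.assoc, P.integral_mul, pair]

theorem pair_mul_cycle (f g h : 𝓢(Xi n, ℂ)) : pair f (P.mul g h) = pair g (P.mul h f) := by
  rw [pair_comm, P.pair_mul_left]

/-- The form `∫ f₁ # g # f₂ # h`. -/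
def quad (f₁ g f₂ h : 𝓢(Xi n, ℂ)) : ℂ := pair (P.mul f₁ g) (P.mul f₂ h)

theorem quad_eq (f₁ g f₂ h : 𝓢(Xi n, ℂ)) :
    P.quad f₁ g f₂ h = pair g (P.mul (P.mul f₂ h) f₁) := by
  rw [quad, P.pair_mul_left, P.pair_mul_cycle]

theorem quad_cycle (f₁ g f₂ h : 𝓢(Xi n, ℂ)) : P.quad f₁ g f₂ h = P.quad g f₂ h f₁ := by
  rw [quad_eq, quad, P.pair_mul_left, P.assoc]

theorem continuous_quad_first (g f₂ h : 𝓢(Xi n, ℂ)) : Continuous fun f₁ => P.quad f₁ g f₂ h := by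
  simp only [quad, pair_comm _ (P.mul f₂ h)]
  simp only [← pairCLM_apply]
  exact (pairCLM _).continuous.comp (P.continuous_left g)

theorem continuous_quad_third (f₁ g h : 𝓢(Xi n, ℂ)) : Continuous fun f₂ => P.quad f₁ g f₂ h := by
  simp only [quad]
  simp only [← pairCLM_apply]
  exact (pairCLM _).continuous.comp (P.continuous_left h)

/-- `quad` as a bilinear form in the first and third variables. -/
def quadBilin (g h : 𝓢(Xi n, ℂ)) : 𝓢(Xi n, ℂ) →ₗ[ℂ] 𝓢(Xi n, ℂ) →ₗ[ℂ] ℂ :=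
  LinearMap.mk₂ ℂ (fun f₁ f₂ => P.quad f₁ g f₂ h)
    (fun f f' f₂ => by
      simp only [quad, pair_comm _ (P.mul f₂ h)]
      simp only [← pairCLM_apply, map_add, LinearMap.add_apply])
    (fun c f f₂ => by
      simp only [quad, pair_comm _ (P.mul f₂ h)]
      simp only [← pairCLM_apply, map_smul, LinearMap.smul_apply])
    (fun f₁ f f' => by
      simp only [quad]
      simp only [← pairCLM_apply, map_add, LinearMap.add_apply])
    (fun c f₁ f => by
      simp only [quad]
      simp only [← pairCLM_apply, map_smul, LinearMap.smul_apply])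

theorem quadBilin_apply (f₁ g f₂ h : 𝓢(Xi n, ℂ)) : P.quadBilin g h f₁ f₂ = P.quad f₁ g f₂ h := rfl

variable {P}

theorem pair_sandwich (hB : P.Regularizing) (f : 𝓢(Xi n, ℂ)) (T : 𝓢'(Xi n, ℂ)) (g h : 𝓢(Xi n, ℂ)) :
    pair (sandwich hB f T g) h = T (P.mul (P.mul g h) f) := by
  rw [← toDist_apply, sandwich, (hB f g T).choose_spec]
  rfl

/-- For fixed `f₁`, `f₂` the form is the coefficient of f₂ # θₖ # f₁ at `j.1`, with k = `j.2`. Any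
`T` sends these functions to the coefficients of f₁ # T # f₂, which is a Schwartz function by (B);
hence joint rapid decrease. Bilinear Banach–Steinhaus then makes the bound uniform in `f₁`, `f₂`. -/
theorem exists_quad_bound (hB : P.Regularizing) (N : ℕ) : ∃ (m : ℕ) (C : ℝ), 0 < C ∧
    ∀ (j : (frame₂ n).index) (f₁ f₂ : 𝓢(Xi n, ℂ)), (frame₂ n).ρ j ^ N *
      ‖P.quad f₁ ((frame n).θ j.1) f₂ ((frame n).θ j.2)‖ ≤ C * pnorm m f₁ * pnorm m f₂ := by
  have hρ : ∀ j : (frame₂ n).index, ‖((((frame₂ n).ρ j) ^ N : ℝ) : ℂ)‖ = (frame₂ n).ρ j ^ N :=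
    fun j => by rw [Complex.norm_real, Real.norm_of_nonneg (pow_nonneg ((frame₂ n).ρ_pos j).le _)]
  obtain ⟨m, C, hC, h⟩ := exists_norm_le_pnorm_mul_pnorm (fun j : (frame₂ n).index =>
      (((frame₂ n).ρ j ^ N : ℝ) : ℂ) • P.quadBilin ((frame n).θ j.1) ((frame n).θ j.2))
    (fun j g => (P.continuous_quad_first _ _ _).const_smul _)
    (fun j f => (P.continuous_quad_third _ _ _).const_smul _) fun f₁ f₂ => by
      obtain ⟨A, hA⟩ := (frame n).exists_pow_mul_norm_coeff_le (frame n).ρ (frame n).ρ_pos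
        (fun k => P.mul (P.mul f₂ ((frame n).θ k)) f₁) (fun T N => by
          obtain ⟨A, hA⟩ := SchwartzFrame.exists_coeff_bound (S := frame n)
            (sandwich hB f₁ T f₂) N
          refine ⟨A, fun k => le_trans (le_of_eq ?_) (hA k)⟩
          have hp : pair (sandwich hB f₁ T f₂) ((frame n).θ k) =
            T (P.mul (P.mul f₂ ((frame n).θ k)) f₁) := pair_sandwich hB f₁ T f₂ _
          rw [coeff_eq_pair, pair_comm, hp]) N
      refine ⟨A, fun j => ?_⟩
      rw [LinearMap.smul_apply, LinearMap.smul_apply, norm_smul, hρ, quadBilin_apply, quad_eq,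
        ← coeff_eq_pair]
      exact hA j.1 j.2
  refine ⟨m, C, hC, fun j f₁ f₂ => ?_⟩
  have := h j f₁ f₂
  rwa [LinearMap.smul_apply, LinearMap.smul_apply, norm_smul, hρ] at this

/-- The map `𝐖` with `⟪𝐖 (f₁ ⊗ f₂), g ⊗ h⟫ = ∫ f₁ # g # f₂ # h`, by its expansion. -/
theorem exists_wMap (hB : P.Regularizing) :
    ∃ W : 𝓢(Xi n × Xi n, ℂ) →L[ℂ] 𝓢(Xi n × Xi n, ℂ), ∀ f₁ f₂,
    HasSum (fun j : (frame₂ n).index => P.quad f₁ ((frame n).θ j.1) f₂ ((frame n).θ j.2) •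
      tensor ((frame n).φ j.1) ((frame n).φ j.2)) (W (tensor f₁ f₂)) := by
  have hφ : (frame₂ n).Moderate fun j => tensor ((frame n).φ j.1) ((frame n).φ j.2) :=
    (frame₂ n).moderate_φ
  choose K hK hKn using fun f₁ f₂ : 𝓢(Xi n, ℂ) => hφ.exists_hasSum
    (a := fun j => P.quad f₁ ((frame n).θ j.1) f₂ ((frame n).θ j.2)) fun N => by
      obtain ⟨m, C, -, h⟩ := exists_quad_bound hB N
      exact ⟨_, fun j => h j f₁ f₂⟩
  let B : 𝓢(Xi n, ℂ) →ₗ[ℂ] 𝓢(Xi n, ℂ) →ₗ[ℂ] 𝓢(Xi n × Xi n, ℂ) :=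
    LinearMap.mk₂ ℂ K
      (fun f f' g => (hK _ _).unique (by
        simpa only [← quadBilin_apply, map_add, LinearMap.add_apply, add_smul]
          using (hK f g).add (hK f' g)))
      (fun c f g => (hK _ _).unique (by
        simpa only [← quadBilin_apply, map_smul, LinearMap.smul_apply, smul_eq_mul, mul_smul]
          using (hK f g).const_smul c))
      (fun f g g' => (hK _ _).unique (by
        simpa only [← quadBilin_apply, map_add, LinearMap.add_apply, add_smul]
          using (hK f g).add (hK f g')))
      (fun c f g => (hK _ _).unique (by
        simpa only [← quadBilin_apply, map_smul, LinearMap.smul_apply, smul_eq_mul, mul_smul]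
          using (hK f g).const_smul c))
  obtain ⟨W, hW⟩ := SchwartzFrame.exists_clm_tensor (frame n) (frame n) B fun m => by
    obtain ⟨N, D, hD, h⟩ := hφ.summable m
    obtain ⟨m', C, hC, h'⟩ := exists_quad_bound hB N
    refine ⟨m', D * C, by positivity, fun f g => (hKn f g m).trans ?_⟩
    exact (h _ _ fun j => h' j f g).2.trans_eq (by ring)
  refine ⟨W, fun f₁ f₂ => ?_⟩
  have : W (tensor f₁ f₂) = K f₁ f₂ := hW f₁ f₂
  rw [this]
  exact hK f₁ f₂

/-- The map `𝐖` of `𝓢(Ξ × Ξ)` with `⟪𝐖 (f₁ ⊗ f₂), g ⊗ h⟫ = ∫ f₁ # g # f₂ # h`. -/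
def wMap (hB : P.Regularizing) : 𝓢(Xi n × Xi n, ℂ) →L[ℂ] 𝓢(Xi n × Xi n, ℂ) := (exists_wMap hB).choose

/-- `𝐖 (f₁ ⊗ f₂)` is the kernel of the map `T ↦ f₁ # T # f₂`. -/
theorem apply_wMap (hB : P.Regularizing) (f₁ f₂ : 𝓢(Xi n, ℂ)) (T T' : 𝓢'(Xi n, ℂ))
    (Λ : 𝓢(Xi n × Xi n, ℂ) →L[ℂ] ℂ)
    (hΛ : ∀ u v, Λ (tensor u v) = T u * T' v) :
    Λ (wMap hB (tensor f₁ f₂)) = T' (sandwich hB f₁ T f₂) := by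
  have h1 := ((exists_wMap hB).choose_spec f₁ f₂).mapL Λ
  -- Summing over the first index reconstructs T(f₂ # θₖ # f₁), the k-th coefficient of f₁ # T # f₂;
  -- summing over `k` then reconstructs the value of `T'`.
  have h2 := ((Equiv.prodComm (frame n).index (frame n).index).hasSum_iff).mpr h1
  refine HasSum.unique (h2.prod_fiberwise fun k => ?_)
    ((frame n).hasSum_coeff_mul T' (sandwich hB f₁ T f₂))
  have h3 := ((frame n).hasSum_coeff_mul T (P.mul (P.mul f₂ ((frame n).θ k)) f₁)).mul_right
    (T' ((frame n).φ k))
  have h4 : (frame n).coeff k (sandwich hB f₁ T f₂) = T (P.mul (P.mul f₂ ((frame n).θ k)) f₁) := by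
    rw [coeff_eq_pair, pair_comm, pair_sandwich]
  rw [h4]
  refine Eq.mpr (congrArg (fun c => HasSum c _) (funext fun j => ?_)) h3
  simp only [map_smul, smul_eq_mul, hΛ, quad_eq, ← coeff_eq_pair, ← mul_assoc]
  rfl

end CompositionLaw

end PhaseSpace

/-! ### Bilinear pairings, transposes and the symplectic Fourier transformation -/

namespace SchwartzTensor

variable {E : Type} [NormedAddCommGroup E] [NormedSpace ℝ E] [MeasurableSpace E] [BorelSpace E]
  [SecondCountableTopology E] {μ : Measure E} [hμ : μ.HasTemperateGrowth]

/-- Complex conjugation on Schwartz space. -/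
def conjugate (f : 𝓢(E, ℂ)) : 𝓢(E, ℂ) := postcompCLM (Complex.conjCLE : ℂ →L[ℝ] ℂ) f

theorem eq_zero_of_integral_mul_conjugate [SFinite μ] [μ.IsOpenPosMeasure] (f : 𝓢(E, ℂ))
    (h : ∫ x, f x * conjugate f x ∂μ = 0) : f = 0 := by
  have h1 : ∀ x, f x * conjugate f x = ((‖f x‖ ^ 2 : ℝ) : ℂ) := fun x => by
    change f x * (starRingEnd ℂ) (f x) = _
    rw [Complex.mul_conj, Complex.normSq_eq_norm_sq]
  have hint : Integrable (fun x => ‖f x‖ ^ 2) μ := by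
    have := (SchwartzFrame.integrable_mul (μ := μ) f (conjugate f)).norm
    refine this.congr (.of_forall fun x => ?_)
    simp only [h1, Complex.norm_real, norm_pow, norm_norm]
  simp only [h1] at h
  rw [integral_complex_ofReal, Complex.ofReal_eq_zero,
    integral_eq_zero_iff_of_nonneg (fun x => by positivity) hint] at h
  have h2 := (Continuous.ae_eq_iff_eq μ (f := fun x => ‖f x‖ ^ 2) (g := 0)
    (f.continuous.norm.pow 2) continuous_const).mp h
  ext x
  simpa using congrFun h2 x

/-- Test with the conjugate of the difference. -/
theorem ext_of_integral_mul [SFinite μ] [μ.IsOpenPosMeasure] {f g : 𝓢(E, ℂ)}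
    (h : ∀ u : 𝓢(E, ℂ), ∫ x, f x * u x ∂μ = ∫ x, g x * u x ∂μ) : f = g := by
  refine sub_eq_zero.mp (eq_zero_of_integral_mul_conjugate (μ := μ) (f - g) ?_)
  simp only [sub_apply, sub_mul]
  rw [integral_sub (SchwartzFrame.integrable_mul _ _) (SchwartzFrame.integrable_mul _ _), h, sub_self]

theorem integrable_exp_mul {φ : E → ℝ} (hφ : Continuous φ) (f : 𝓢(E, ℂ)) :
    Integrable (fun x => Complex.exp (Complex.I * φ x) * f x) μ := by
  refine f.integrable.bdd_mul (c := 1) (by fun_prop) (.of_forall fun x => ?_)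
  rw [mul_comm, Complex.norm_exp_ofReal_mul_I]

end SchwartzTensor

namespace PhaseSpace

open SchwartzTensor

variable {n : ℕ}

/-- The pairing is ∫ |h|², whereas ∫ h² may vanish for a complex window; hence the conjugate window
in the general statements. -/
theorem pair_conjS_ne_zero {h : 𝓢(Xi n, ℂ)} (hh : h ≠ 0) : pair (conjS h) h ≠ 0 := fun h0 =>
  hh (eq_zero_of_integral_mul_conjugate (μ := dX n) h (by rw [pair_comm] at h0; exact h0))

theorem conjS_ne_zero {h : 𝓢(Xi n, ℂ)} (hh : h ≠ 0) : conjS h ≠ 0 := fun h0 =>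
  pair_conjS_ne_zero hh (by simp [h0, pair])

theorem pair₂_comm (F G : 𝓢(Xi n × Xi n, ℂ)) : pair₂ F G = pair₂ G F := by
  simp only [pair₂, mul_comm]

/-- `F ↦ ⟪G, F⟫` is linear and continuous. -/
def pair₂CLM (G : 𝓢(Xi n × Xi n, ℂ)) : 𝓢(Xi n × Xi n, ℂ) →L[ℂ] ℂ :=
  (integralCLM ℂ (dXdY n)).comp (SchwartzMap.pairing (ContinuousLinearMap.mul ℂ ℂ) G)

theorem pair₂CLM_apply (G F : 𝓢(Xi n × Xi n, ℂ)) : pair₂CLM G F = pair₂ G F := by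
  change integralCLM ℂ (dXdY n) _ = _
  rw [integralCLM_apply]
  exact integral_congr_ae (.of_forall fun x => smulS_apply _ _ x)

theorem pair₂_tensor (f g u v : 𝓢(Xi n, ℂ)) :
    pair₂ (tensor f g) (tensor u v) = pair f u * pair g v := by
  simp only [pair₂, pair, tensor, tensorRight_apply]
  rw [← integral_prod_mul]
  exact integral_congr_ae (.of_forall fun x => by ring)

theorem pair₂_ext {F F' : 𝓢(Xi n × Xi n, ℂ)}
    (h : ∀ u v, pair₂ F (tensor u v) = pair₂ F' (tensor u v)) : F = F' := by
  have : pair₂CLM F = pair₂CLM F' := clm_ext fun u v => by simpa only [pair₂CLM_apply] using h u v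
  refine ext_of_integral_mul (μ := dXdY n) fun G => ?_
  have := DFunLike.congr_fun this G
  rwa [pair₂CLM_apply, pair₂CLM_apply] at this

/-- Two continuous maps are transposes of each other if they are so on elementary tensors. -/
theorem pair₂_transpose {A B : 𝓢(Xi n × Xi n, ℂ) →L[ℂ] 𝓢(Xi n × Xi n, ℂ)}
    (h : ∀ f g u v, pair₂ (A (tensor f g)) (tensor u v) = pair₂ (tensor f g) (B (tensor u v)))
    (F G : 𝓢(Xi n × Xi n, ℂ)) : pair₂ (A F) G = pair₂ F (B G) := by
  have h1 : ∀ f g, pair₂CLM (A (tensor f g)) = (pair₂CLM (tensor f g)).comp B := fun f g =>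
    clm_ext fun u v => by simpa only [pair₂CLM_apply, ContinuousLinearMap.comp_apply] using h f g u v
  have h2 : (pair₂CLM G).comp A = pair₂CLM (B G) := clm_ext fun f g => by
    have := DFunLike.congr_fun (h1 f g) G
    rw [ContinuousLinearMap.comp_apply, pair₂CLM_apply, pair₂CLM_apply] at this
    rw [ContinuousLinearMap.comp_apply, pair₂CLM_apply, pair₂CLM_apply, pair₂_comm, this, pair₂_comm]
  have := DFunLike.congr_fun h2 F
  rw [ContinuousLinearMap.comp_apply, pair₂CLM_apply, pair₂CLM_apply] at this
  rw [pair₂_comm, this, pair₂_comm]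

/-- The flip `(X, Y) ↦ (Y, X)` on `𝓢(Ξ × Ξ)`. -/
def flip : 𝓢(Xi n × Xi n, ℂ) →L[ℂ] 𝓢(Xi n × Xi n, ℂ) :=
  compCLMOfContinuousLinearEquiv ℂ (ContinuousLinearEquiv.prodComm ℝ (Xi n) (Xi n))

@[simp]
theorem flip_tensor (f g : 𝓢(Xi n, ℂ)) : flip (tensor f g) = tensor g f := by
  ext Z
  exact mul_comm (f Z.2) (g Z.1)

@[simp]
theorem flip_flip (F : 𝓢(Xi n × Xi n, ℂ)) : flip (flip F) = F := rfl

theorem pair₂_flip (F G : 𝓢(Xi n × Xi n, ℂ)) : pair₂ (flip F) G = pair₂ F (flip G) :=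
  pair₂_transpose (fun f g u v => by simp only [flip_tensor, pair₂_tensor, mul_comm]) F G

theorem exists_tensorMap (A B : 𝓢(Xi n, ℂ) →L[ℂ] 𝓢(Xi n, ℂ)) :
    ∃ L : 𝓢(Xi n × Xi n, ℂ) →L[ℂ] 𝓢(Xi n × Xi n, ℂ), ∀ f g,
      L (tensor f g) = tensor (A f) (B g) := by
  refine SchwartzFrame.exists_clm_tensor (frame n) (frame n) (LinearMap.mk₂ ℂ
    (fun f g => tensor (A f) (B g)) ?_ ?_ ?_ ?_) fun m => ?_
  · intro f f' g; ext Z; simp [tensor]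
  · intro c f g; ext Z; simp [tensor]
  · intro f g g'; ext Z; simp [tensor, mul_add]
  · intro c f g; ext Z; simp [tensor, mul_left_comm]
  · obtain ⟨C, hC, h⟩ := pnorm_tensorRight_le (E := Xi n) (F := Xi n) m
    obtain ⟨a, D, hD, hA⟩ := exists_pnorm_le_pnorm A m
    obtain ⟨b, D', hD', hB⟩ := exists_pnorm_le_pnorm B m
    refine ⟨max a b, C * (D * D'), by positivity, fun f g => (h _ _).trans ?_⟩
    have h1 := (hA f).trans (mul_le_mul_of_nonneg_left (pnorm_mono (le_max_left a b) f) hD.le)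
    have h2 := (hB g).trans (mul_le_mul_of_nonneg_left (pnorm_mono (le_max_right a b) g) hD'.le)
    have h3 := mul_le_mul h1 h2 (apply_nonneg _ _) (mul_nonneg hD.le (apply_nonneg _ _))
    exact (mul_le_mul_of_nonneg_left h3 hC).trans_eq (by ring)

/-- The tensor product of two continuous maps. -/
def tensorMap (A B : 𝓢(Xi n, ℂ) →L[ℂ] 𝓢(Xi n, ℂ)) :
    𝓢(Xi n × Xi n, ℂ) →L[ℂ] 𝓢(Xi n × Xi n, ℂ) := (exists_tensorMap A B).choose

@[simp]
theorem tensorMap_tensor (A B : 𝓢(Xi n, ℂ) →L[ℂ] 𝓢(Xi n, ℂ)) (f g : 𝓢(Xi n, ℂ)) :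
    tensorMap A B (tensor f g) = tensor (A f) (B g) := (exists_tensorMap A B).choose_spec f g

theorem pair₂_tensorMap {A A' B B' : 𝓢(Xi n, ℂ) →L[ℂ] 𝓢(Xi n, ℂ)}
    (hA : ∀ f g, pair (A f) g = pair f (A' g)) (hB : ∀ f g, pair (B f) g = pair f (B' g))
    (F G : 𝓢(Xi n × Xi n, ℂ)) : pair₂ (tensorMap A B F) G = pair₂ F (tensorMap A' B' G) :=
  pair₂_transpose (fun f g u v => by simp only [tensorMap_tensor, pair₂_tensor, hA, hB]) F G

theorem tensorMap_leftInverse {A A' : 𝓢(Xi n, ℂ) →L[ℂ] 𝓢(Xi n, ℂ)} (h : ∀ f, A (A' f) = f) :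
    Function.LeftInverse (tensorMap A A) (tensorMap A' A') := by
  have : (tensorMap A A).comp (tensorMap A' A') = ContinuousLinearMap.id ℂ _ :=
    clm_ext fun f g => by simp [h]
  exact fun F => DFunLike.congr_fun this F

/-- The shear `(V, Y) ↦ (Y + V, Y)`. -/
def shear (n : ℕ) : (Xi n × Xi n) ≃L[ℝ] (Xi n × Xi n) :=
  LinearEquiv.toContinuousLinearEquiv
    { toFun := fun Z : Xi n × Xi n => (Z.2 + Z.1, Z.2)
      invFun := fun Z => (Z.1 - Z.2, Z.2)
      map_add' := fun Z W => by simp only [Prod.fst_add, Prod.snd_add, Prod.mk_add_mk]; abel_nf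
      map_smul' := fun c Z => by simp
      left_inv := fun Z => by simp
      right_inv := fun Z => by simp }

/-- The map `K ↦ (V ↦ ∫ K(Y + V, Y) dY)`. -/
def diagonalIntegral : 𝓢(Xi n × Xi n, ℂ) →L[ℂ] 𝓢(Xi n, ℂ) :=
  (partialIntegral (dX n)).comp (compCLMOfContinuousLinearEquiv ℂ (shear n))

theorem diagonalIntegral_apply (K : 𝓢(Xi n × Xi n, ℂ)) (V : Xi n) :
    diagonalIntegral K V = ∫ Y, K (Y + V, Y) ∂dX n := rfl

/-- The trace `∫ K(Y, Y) dY`. -/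
def traceCLM : 𝓢(Xi n × Xi n, ℂ) →L[ℂ] ℂ :=
  (TemperedDistribution.delta (0 : Xi n) : 𝓢(Xi n, ℂ) →L[ℂ] ℂ).comp diagonalIntegral

theorem traceCLM_eq (K : 𝓢(Xi n × Xi n, ℂ)) : traceCLM K = diagonalIntegral K 0 := rfl

theorem traceCLM_tensor (f g : 𝓢(Xi n, ℂ)) : traceCLM (tensor f g) = pair f g := by
  rw [traceCLM_eq, diagonalIntegral_apply]
  simp [tensor, pair]

theorem sigma_neg_left (X Y : Xi n) : sigma (-X) Y = -sigma X Y := by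
  rw [sigma, sigma, ← Finset.sum_neg_distrib]
  refine Finset.sum_congr rfl fun i _ => ?_
  simp only [PiLp.neg_apply]
  ring

theorem sigma_comm (X Y : Xi n) : sigma X Y = -sigma Y X := by
  rw [sigma, sigma, ← Finset.sum_neg_distrib]
  exact Finset.sum_congr rfl fun i _ => by ring

theorem sigma_add_right (X Y Z : Xi n) : sigma X (Y + Z) = sigma X Y + sigma X Z := by
  rw [sigma, sigma, sigma, ← Finset.sum_add_distrib]
  refine Finset.sum_congr rfl fun i _ => ?_
  simp only [PiLp.add_apply]
  ring

theorem continuous_sigma : Continuous fun Z : Xi n × Xi n => sigma Z.1 Z.2 := by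
  unfold sigma
  fun_prop

theorem symplecticFourier_neg_apply (f : 𝓢(Xi n, ℂ)) (Y : Xi n) :
    symplecticFourier f (-Y) = ∫ Z, Complex.exp (Complex.I * sigma Y Z) * f Z ∂dX n := by
  rw [symplecticFourier_apply]
  simp [sigma_neg_left]

/-- The transpose of the symplectic Fourier transformation. -/
def symplecticFourierTranspose : 𝓢(Xi n, ℂ) →L[ℂ] 𝓢(Xi n, ℂ) :=
  (compCLMOfContinuousLinearEquiv ℂ (ContinuousLinearEquiv.neg ℝ)).comp symplecticFourier

theorem pair_symplecticFourierTranspose (f g : 𝓢(Xi n, ℂ)) :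
    pair (symplecticFourierTranspose f) g = pair f (symplecticFourier g) := by
  have h : ∀ X, symplecticFourierTranspose f X =
    ∫ Y, Complex.exp (Complex.I * sigma X Y) * f Y ∂dX n := symplecticFourier_neg_apply f
  have hint : Integrable (Function.uncurry fun X Y =>
      Complex.exp (Complex.I * sigma X Y) * (g X * f Y)) (dXdY n) :=
    integrable_exp_mul (continuous_sigma) (tensor g f)
  simp only [pair, h, symplecticFourier_apply]
  calc _ = ∫ X, ∫ Y, Complex.exp (Complex.I * sigma X Y) * (g X * f Y) ∂dX n ∂dX n := by
        refine integral_congr_ae (.of_forall fun X => ?_)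
        simp only [← integral_mul_const]
        exact integral_congr_ae (.of_forall fun Y => by ring)
    _ = ∫ Y, ∫ X, Complex.exp (Complex.I * sigma X Y) * (g X * f Y) ∂dX n ∂dX n :=
        integral_integral_swap hint
    _ = _ := by
        refine integral_congr_ae (.of_forall fun Y => ?_)
        simp only [← integral_const_mul]
        refine integral_congr_ae (.of_forall fun X => ?_)
        simp only [sigma_comm X Y, Complex.ofReal_neg]
        ring_nf

/-- Fourier inversion at 0. As 2π times `symplecticJ` is an isometry, the substitution has Jacobian
(2π)²ⁿ, which cancels the factors (2π)⁻ⁿ of the transformation and of the measure. -/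
theorem integral_symplecticFourier (f : 𝓢(Xi n, ℂ)) : ∫ Z, symplecticFourier f Z ∂dX n = f 0 := by
  have hp : (2 * Real.pi) ≠ 0 := by positivity
  let R : Xi n ≃ₗᵢ[ℝ] Xi n :=
    { toLinearEquiv := (symplecticJ n).toLinearEquiv.trans
        (LinearEquiv.smulOfNeZero ℝ (Xi n) (2 * Real.pi) hp)
      norm_map' := fun Y => by
        rw [EuclideanSpace.norm_eq, EuclideanSpace.norm_eq, Fintype.sum_sum_type, Fintype.sum_sum_type,
          add_comm]
        simp [symplecticJ]
        field_simp
        simp only [sq_abs] }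
  have hR : ∀ Y, symplecticJ n Y = (2 * Real.pi)⁻¹ • R Y := fun Y => by
    change _ = (2 * Real.pi)⁻¹ • ((2 * Real.pi) • symplecticJ n Y)
    rw [inv_smul_smul₀ hp]
  have h : ∀ Y, symplecticFourier f Y =
      (((2 * Real.pi) ^ n)⁻¹ : ℂ) * (FourierTransform.fourier (f : Xi n → ℂ)) ((2 * Real.pi)⁻¹ • R Y) :=
    fun Y => by rw [← hR]; rfl
  have hF : ∫ Y, (FourierTransform.fourier (f : Xi n → ℂ)) Y = f 0 := by
    have h1 : FourierTransformInv.fourierInv (FourierTransform.fourier f) 0 = f 0 := by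
      rw [FourierTransform.fourierInv_fourier_eq]
    rw [← h1, fourierInv_coe, Real.fourierInv_eq']
    simp [fourier_coe]
  simp only [h]
  rw [integral_const_mul, dX, integral_smul_measure,
    R.measurePreserving.integral_comp R.toHomeomorph.measurableEmbedding
      (fun Y => (FourierTransform.fourier (f : Xi n → ℂ)) ((2 * Real.pi)⁻¹ • Y)),
    Measure.integral_comp_smul, hF]
  rw [ENNReal.toReal_ofReal (by positivity), Complex.real_smul, Complex.real_smul,
    abs_of_nonneg (by positivity)]
  simp
  field_simp
  rw [one_div, inv_pow, pow_add, ← sq, mul_inv_cancel₀ (by simp [Real.pi_ne_zero]), one_mul]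

/-- The pairing of a kernel with `e_Z ⊗ e_{-Z}`. -/
theorem expDist_mul_expDist (Z : Xi n) (u v : 𝓢(Xi n, ℂ)) :
    symplecticFourier (diagonalIntegral (tensor u v)) (-Z) = expDist Z u * expDist (-Z) v := by
  have hint : Integrable (Function.uncurry fun V Y =>
      Complex.exp (Complex.I * sigma Z V) * tensor u v (Y + V, Y)) (dXdY n) :=
    integrable_exp_mul (φ := fun W : Xi n × Xi n => sigma Z W.1)
      (continuous_sigma.comp (by fun_prop : Continuous fun W : Xi n × Xi n => (Z, W.1)))
      (compCLMOfContinuousLinearEquiv ℂ (shear n) (tensor u v))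
  rw [symplecticFourier_neg_apply, expDist_apply, expDist_apply]
  simp only [diagonalIntegral_apply, ← integral_const_mul]
  rw [integral_integral_swap hint]
  refine integral_congr_ae (.of_forall fun Y => ?_)
  simp only [← integral_mul_const]
  -- Translating by `Y` splits the phase: σ(Z, V) = σ(Z, Y + V) - σ(Z, Y).
  refine Eq.trans ?_ (integral_add_left_eq_self _ Y)
  refine integral_congr_ae (.of_forall fun V => ?_)
  simp only [tensor, tensorRight_apply, sigma_add_right, sigma_neg_left, Complex.ofReal_add,
    Complex.ofReal_neg, mul_add, Complex.exp_add, mul_neg, Complex.exp_neg]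
  field_simp

end PhaseSpace

/-! ### The modulation mapping is an isomorphism -/

namespace PhaseSpace

open SchwartzTensor

variable {n : ℕ}

/-- The inverse of the symplectic Fourier transformation. -/
def symplecticFourierInv : 𝓢(Xi n, ℂ) →L[ℂ] 𝓢(Xi n, ℂ) :=
  ((2 * Real.pi) ^ n : ℂ) • ((FourierTransform.fourierCLE ℂ 𝓢(Xi n, ℂ)).symm.toContinuousLinearMap.comp
    (compCLMOfContinuousLinearEquiv ℂ (symplecticJ n).symm))

theorem symplecticFourierInv_symplecticFourier (f : 𝓢(Xi n, ℂ)) :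
    symplecticFourierInv (symplecticFourier f) = f := by
  have h : compCLMOfContinuousLinearEquiv ℂ (symplecticJ n).symm (symplecticFourier f) =
      (((2 * Real.pi) ^ n)⁻¹ : ℂ) • FourierTransform.fourierCLE ℂ 𝓢(Xi n, ℂ) f := by
    ext Y
    change (((2 * Real.pi) ^ n)⁻¹ : ℂ) • (fourierTransformCLM ℂ f) (symplecticJ n ((symplecticJ n).symm Y)) = _
    rw [ContinuousLinearEquiv.apply_symm_apply]
    rfl
  change ((2 * Real.pi) ^ n : ℂ) • (FourierTransform.fourierCLE ℂ 𝓢(Xi n, ℂ)).symm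
    (compCLMOfContinuousLinearEquiv ℂ (symplecticJ n).symm (symplecticFourier f)) = f
  rw [h, map_smul, ContinuousLinearEquiv.symm_apply_apply, smul_smul,
    mul_inv_cancel₀ (by simp [Real.pi_ne_zero]), one_smul]

theorem symplecticFourier_symplecticFourierInv (f : 𝓢(Xi n, ℂ)) :
    symplecticFourier (symplecticFourierInv f) = f := by
  have h : fourierTransformCLM ℂ (symplecticFourierInv f) =
      ((2 * Real.pi) ^ n : ℂ) • compCLMOfContinuousLinearEquiv ℂ (symplecticJ n).symm f := by
    change FourierTransform.fourierCLE ℂ 𝓢(Xi n, ℂ) (((2 * Real.pi) ^ n : ℂ) •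
      (FourierTransform.fourierCLE ℂ 𝓢(Xi n, ℂ)).symm _) = _
    rw [map_smul, ContinuousLinearEquiv.apply_symm_apply]
    rfl
  change (((2 * Real.pi) ^ n)⁻¹ : ℂ) • compCLMOfContinuousLinearEquiv ℂ (symplecticJ n)
    (fourierTransformCLM ℂ (symplecticFourierInv f)) = f
  rw [h, map_smul, smul_smul, inv_mul_cancel₀ (by simp [Real.pi_ne_zero]), one_smul]
  ext Y
  change f ((symplecticJ n).symm (symplecticJ n Y)) = f Y
  rw [ContinuousLinearEquiv.symm_apply_apply]

/-- The change of variables preserves the measure: it is a reflection with translation on each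
fibre, followed by a reflection of the base. -/
theorem pair₂_changeVar (F G : 𝓢(Xi n × Xi n, ℂ)) :
    pair₂ (compCLMOfContinuousLinearEquiv ℂ (changeVar n) F) G =
      pair₂ F (compCLMOfContinuousLinearEquiv ℂ (changeVar n).symm G) := by
  have h : MeasurePreserving (changeVar n) (dXdY n) (dXdY n) := by
    have h1 : MeasurePreserving (fun Z : Xi n × Xi n => (Z.1, Z.1 - Z.2)) (dXdY n) (dXdY n) :=
      (MeasurePreserving.id (dX n)).skew_product (g := fun X Y => X - Y) (by fun_prop)
        (.of_forall fun X => ((dX n).measurePreserving_sub_left X).map_eq)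
    have h2 : MeasurePreserving (Prod.map (fun X : Xi n => -X) id) (dXdY n) (dXdY n) :=
      (Measure.measurePreserving_neg (dX n)).prod (MeasurePreserving.id (dX n))
    exact h2.comp h1
  refine Eq.trans ?_ (h.integral_comp (changeVar n).toHomeomorph.measurableEmbedding
    fun Z => F Z * compCLMOfContinuousLinearEquiv ℂ (changeVar n).symm G Z)
  refine integral_congr_ae (.of_forall fun Z => ?_)
  change F (changeVar n Z) * G Z = F (changeVar n Z) * G ((changeVar n).symm (changeVar n Z))
  rw [ContinuousLinearEquiv.symm_apply_apply]

/-- The transposed frame expansion, convergent in the weak topology. -/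
theorem hasSum_toDist₂ (S : 𝓢'(Xi n × Xi n, ℂ)) :
    HasSum (fun j => S ((frame₂ n).φ j) • toDist₂ ((frame₂ n).θ j)) S := by
  refine PointwiseConvergenceCLM.tendsto_iff_forall_tendsto.mpr fun G => ?_
  refine Tendsto.congr (fun s => ?_) ((frame₂ n).hasSum_coeff_mul S G)
  rw [_root_.sum_apply]
  refine Finset.sum_congr rfl fun j _ => ?_
  rw [_root_.smul_apply, toDist₂_apply, smul_eq_mul]
  beta_reduce
  rw [mul_comm]
  exact congrArg _ (SchwartzFrame.coeff_apply _ j G)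

/-- Schwartz functions are dense among the tempered distributions. -/
theorem ext_toDist₂ {T T' : 𝓢'(Xi n × Xi n, ℂ) →L[ℂ] 𝓢'(Xi n × Xi n, ℂ)}
    (h : ∀ F, T (toDist₂ F) = T' (toDist₂ F)) : T = T' := by
  ext1 S
  have h1 := (hasSum_toDist₂ S).mapL T
  have h2 := (hasSum_toDist₂ S).mapL T'
  simp only [map_smul, h] at h1 h2
  exact h1.unique h2

namespace CompositionLaw

variable {P : CompositionLaw n}

theorem pair₂_wMap (hB : P.Regularizing) (f₁ f₂ g h : 𝓢(Xi n, ℂ)) :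
    pair₂ (wMap hB (tensor f₁ f₂)) (tensor g h) = P.quad f₁ g f₂ h := by
  have := apply_wMap hB f₁ f₂ (toDist g) (toDist h) (pair₂CLM (tensor g h)) fun u v => by
    rw [pair₂CLM_apply, pair₂_tensor, toDist_apply, toDist_apply]
  rw [pair₂CLM_apply, toDist_apply, pair_comm, pair_sandwich, toDist_apply, ← quad_eq] at this
  rw [pair₂_comm, this]

/-- Cyclic invariance of `quad`, read as a formula for the transpose. -/
theorem pair₂_wMap_left (hB : P.Regularizing) (F G : 𝓢(Xi n × Xi n, ℂ)) :
    pair₂ (wMap hB F) G = pair₂ F (flip (wMap hB G)) :=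
  pair₂_transpose (B := flip.comp (wMap hB)) (fun f g u v => by
    rw [ContinuousLinearMap.comp_apply, ← pair₂_flip, flip_tensor, pair₂_comm (tensor g f),
      pair₂_wMap, pair₂_wMap, P.quad_cycle]) F G

/-- The kernel of `T ↦ f₁ # T # f₂` has trace `∫ f₁ ∫ f₂`. -/
theorem traceCLM_wMap {hB : P.Regularizing} (hC : Orthogonality hB) (f₁ f₂ : 𝓢(Xi n, ℂ)) :
    traceCLM (wMap hB (tensor f₁ f₂)) = (∫ X, f₁ X ∂dX n) * ∫ X, f₂ X ∂dX n := by
  -- By the kernel identity with T = e_Z and T' = e_{-Z}, `thetaPair` is the Fourier transform at -Z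
  -- of V ↦ ∫ K(Y + V, Y) dY. Integration over `Z` gives the value at V = 0, that is, the trace.
  rw [← hC, traceCLM_eq, ← integral_symplecticFourier, ← integral_neg_eq_self]
  refine integral_congr_ae (.of_forall fun Z => ?_)
  exact apply_wMap hB f₁ f₂ (expDist Z) (expDist (-Z))
    ((TemperedDistribution.delta (-Z) : 𝓢(Xi n, ℂ) →L[ℂ] ℂ).comp
      (symplecticFourier.comp diagonalIntegral)) (expDist_mul_expDist Z)

/-- T ↦ g # f₁ # T # f₂ # h is T ↦ f₁ # T # f₂ followed by T ↦ g # T # h; the former acts on the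
kernel of the latter through its transpose in the first variable. -/
theorem wMap_mul (hB : P.Regularizing) (f₁ f₂ g h : 𝓢(Xi n, ℂ)) :
    wMap hB (tensor (P.mul g f₁) (P.mul f₂ h)) =
      tensorMap ((P.rightMul f₁).comp (P.leftMul f₂)) (ContinuousLinearMap.id ℂ _)
        (wMap hB (tensor g h)) := by
  refine pair₂_ext fun u v => ?_
  rw [pair₂_tensorMap (A' := (P.leftMul f₁).comp (P.rightMul f₂)) (B' := ContinuousLinearMap.id ℂ _)
    (fun f g => ?_) (fun f g => rfl), tensorMap_tensor, pair₂_wMap, pair₂_wMap]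
  · change pair (P.mul (P.mul g f₁) u) (P.mul (P.mul f₂ h) v) =
      pair (P.mul g (P.mul f₁ (P.mul u f₂))) (P.mul h v)
    simp only [P.pair_mul_left, P.assoc]
  · change pair (P.mul (P.mul f₂ f) f₁) g = pair f (P.mul f₁ (P.mul g f₂))
    rw [P.pair_mul_left, P.pair_mul_left, P.pair_mul_cycle, P.assoc]

/-- For G = u ⊗ v both sides are ∫ f₂ # u # f₁ # v, up to a cyclic permutation. -/
theorem traceCLM_tensorMap (hB : P.Regularizing) (f₁ f₂ : 𝓢(Xi n, ℂ)) (G : 𝓢(Xi n × Xi n, ℂ)) :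
    traceCLM (tensorMap ((P.rightMul f₁).comp (P.leftMul f₂)) (ContinuousLinearMap.id ℂ _) G) =
      pair₂ (wMap hB (tensor f₁ f₂)) (flip G) := by
  rw [← pair₂CLM_apply]
  refine DFunLike.congr_fun (f := traceCLM.comp (tensorMap _ _)) (g := (pair₂CLM _).comp flip)
    (clm_ext fun u v => ?_) G
  rw [ContinuousLinearMap.comp_apply, ContinuousLinearMap.comp_apply, tensorMap_tensor, flip_tensor,
    pair₂CLM_apply, pair₂_wMap, traceCLM_tensor, quad_eq, pair_comm]
  rfl

/-- Polarisation of the trace formula: for g # f₁ and f₂ # h the product of integrals becomes ∫ g f₁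
∫ f₂ h. -/
theorem pair₂_wMap_flip_wMap {hB : P.Regularizing} (hC : Orthogonality hB)
    (F G : 𝓢(Xi n × Xi n, ℂ)) : pair₂ (wMap hB F) (flip (wMap hB G)) = pair₂ F G := by
  refine (pair₂_wMap_left hB F _).trans ?_
  refine (pair₂_transpose (A := ContinuousLinearMap.id ℂ _)
    (B := flip.comp ((wMap hB).comp (flip.comp (wMap hB)))) (fun f₁ f₂ g h => ?_) F G).symm
  change _ = pair₂ (tensor f₁ f₂) (flip (wMap hB (flip (wMap hB (tensor g h)))))
  rw [← pair₂_wMap_left, ← traceCLM_tensorMap, ← wMap_mul, traceCLM_wMap hC, P.integral_mul,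
    P.integral_mul, ContinuousLinearMap.id_apply, pair₂_tensor, pair_comm f₁]
  rfl

theorem flip_wMap_flip_wMap {hB : P.Regularizing} (hC : Orthogonality hB)
    (F : 𝓢(Xi n × Xi n, ℂ)) : flip (wMap hB (flip (wMap hB F))) = F := by
  refine pair₂_ext fun u v => ?_
  rw [pair₂_comm, ← pair₂_wMap_left, pair₂_wMap_flip_wMap hC, pair₂_comm]

theorem wMap_flip_wMap_flip {hB : P.Regularizing} (hC : Orthogonality hB)
    (F : 𝓢(Xi n × Xi n, ℂ)) : wMap hB (flip (wMap hB (flip F))) = F := by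
  have := congrArg flip (flip_wMap_flip_wMap hC (flip F))
  simpa only [flip_flip] using this

/-- An explicit form of the map `𝐍`. -/
def nMap (hB : P.Regularizing) : 𝓢(Xi n × Xi n, ℂ) →L[ℂ] 𝓢(Xi n × Xi n, ℂ) :=
  (tensorMap symplecticFourierTranspose symplecticFourierTranspose).comp (flip.comp (wMap hB))

theorem pair₂_nMap (hB : P.Regularizing) (F G : 𝓢(Xi n × Xi n, ℂ)) :
    pair₂ (nMap hB F) G =
      pair₂ F (flip (wMap hB (flip (tensorMap symplecticFourier symplecticFourier G)))) := by
  rw [← pair₂_wMap_left, ← pair₂_flip, ← pair₂_tensorMap pair_symplecticFourierTranspose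
    pair_symplecticFourierTranspose]
  rfl

theorem isNMap_nMap (hB : P.Regularizing) : P.IsNMap (nMap hB) := fun f₁ f₂ g₁ g₂ => by
  rw [pair₂_nMap, ← pair₂_wMap_left, tensorMap_tensor, flip_tensor, pair₂_wMap, ← P.quad_cycle]
  rfl

theorem IsNMap.unique {N N' : 𝓢(Xi n × Xi n, ℂ) →L[ℂ] 𝓢(Xi n × Xi n, ℂ)} (h : P.IsNMap N)
    (h' : P.IsNMap N') : N = N' :=
  clm_ext fun f g => pair₂_ext fun u v => by rw [h, h']

theorem NMap_eq (hB : P.Regularizing) : P.NMap = nMap hB := by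
  have h : ∃ N, P.IsNMap N := ⟨_, isNMap_nMap hB⟩
  rw [NMap, dif_pos h]
  exact h.choose_spec.unique (isNMap_nMap hB)

/-- The transpose of the modulation mapping. -/
def mTranspose {hB : P.Regularizing} (hC : Orthogonality hB) :
    𝓢(Xi n × Xi n, ℂ) ≃L[ℂ] 𝓢(Xi n × Xi n, ℂ) :=
  ContinuousLinearEquiv.equivOfInverse
    (flip.comp ((wMap hB).comp (flip.comp ((tensorMap symplecticFourier symplecticFourier).comp
      (compCLMOfContinuousLinearEquiv ℂ (changeVar n).symm)))))
    -- Because flip ∘ W is an involution, W itself inverts flip ∘ W ∘ flip.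
    ((compCLMOfContinuousLinearEquiv ℂ (changeVar n)).comp
      ((tensorMap symplecticFourierInv symplecticFourierInv).comp (wMap hB)))
    (fun F => by
      simp only [ContinuousLinearMap.comp_apply, wMap_flip_wMap_flip hC]
      rw [tensorMap_leftInverse symplecticFourierInv_symplecticFourier]
      ext Z
      change F ((changeVar n).symm (changeVar n Z)) = F Z
      rw [ContinuousLinearEquiv.symm_apply_apply])
    (fun F => by
      simp only [ContinuousLinearMap.comp_apply]
      have : ∀ G : 𝓢(Xi n × Xi n, ℂ), compCLMOfContinuousLinearEquiv ℂ (changeVar n).symm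
          (compCLMOfContinuousLinearEquiv ℂ (changeVar n) G) = G := fun G => by
        ext Z
        change G (changeVar n ((changeVar n).symm Z)) = G Z
        rw [ContinuousLinearEquiv.apply_symm_apply]
      rw [this, tensorMap_leftInverse symplecticFourier_symplecticFourierInv, flip_wMap_flip_wMap hC])

theorem pair₂_MMap {hB : P.Regularizing} (hC : Orthogonality hB) (F G : 𝓢(Xi n × Xi n, ℂ)) :
    pair₂ (P.MMap F) G = pair₂ F (mTranspose hC G) := by
  rw [MMap, ContinuousLinearMap.comp_apply, pair₂_changeVar, NMap_eq hB, pair₂_nMap]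
  rfl

/-- The modulation mapping on tempered distributions, as an isomorphism. -/
def mEquiv {hB : P.Regularizing} (hC : Orthogonality hB) :
    𝓢'(Xi n × Xi n, ℂ) ≃L[ℂ] 𝓢'(Xi n × Xi n, ℂ) :=
  ContinuousLinearEquiv.equivOfInverse
    (PointwiseConvergenceCLM.precomp ℂ (mTranspose hC).toContinuousLinearMap)
    (PointwiseConvergenceCLM.precomp ℂ (mTranspose hC).symm.toContinuousLinearMap)
    (fun T => by
      ext1 F
      change T (mTranspose hC ((mTranspose hC).symm F)) = T F
      rw [ContinuousLinearEquiv.apply_symm_apply])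
    (fun T => by
      ext1 F
      change T ((mTranspose hC).symm (mTranspose hC F)) = T F
      rw [ContinuousLinearEquiv.symm_apply_apply])

theorem isMExtension_mEquiv {hB : P.Regularizing} (hC : Orthogonality hB) :
    P.IsMExtension (mEquiv hC).toContinuousLinearMap := fun F => by
  ext1 G
  rw [toDist₂_apply, pair₂_MMap hC, ← toDist₂_apply]
  rfl

theorem M_eq {hB : P.Regularizing} (hC : Orthogonality hB) :
    P.M = (mEquiv hC).toContinuousLinearMap := by
  have h : ∃ T, P.IsMExtension T := ⟨_, isMExtension_mEquiv hC⟩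
  rw [M, dif_pos h]
  exact ext_toDist₂ fun F => by rw [h.choose_spec F, isMExtension_mEquiv hC F]

theorem modulationWellDefined {hB : P.Regularizing} (hC : Orthogonality hB) :
    P.ModulationWellDefined := by
  refine ⟨⟨nMap hB, isNMap_nMap hB, fun N hN => hN.unique (isNMap_nMap hB)⟩,
    ⟨_, isMExtension_mEquiv hC, fun T hT => ext_toDist₂ fun F => ?_⟩, ?_⟩
  · rw [hT F, isMExtension_mEquiv hC F]
  · rw [M_eq hC]
    exact ContinuousLinearMap.isInvertible_equiv

end CompositionLaw

end PhaseSpace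

/-! ### Induced spaces and change of window -/

namespace PhaseSpace

open SchwartzTensor

variable {n : ℕ}

theorem Jt_J (h k : 𝓢(Xi n, ℂ)) (f : 𝓢'(Xi n, ℂ)) : Jt h (J k f) = pair h k • f := by
  ext1 u
  have : slicePairing (dX n) k (tensorRight h u) = pair h k • u := by
    ext X
    rw [slicePairing_apply, _root_.smul_apply, pair, smul_eq_mul, ← integral_mul_const]
    exact integral_congr_ae (.of_forall fun Y => by simp only [tensorRight_apply]; ring)
  change f (slicePairing (dX n) k (tensorRight h u)) = _
  rw [this, map_smul, _root_.smul_apply]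

namespace CompositionLaw

variable {P : CompositionLaw n}

/-- After 𝐌⁻¹𝐌 cancels, only `Jt h (J k f)` remains. -/
theorem Mt_Mw {hB : P.Regularizing} (hC : Orthogonality hB) (h k : 𝓢(Xi n, ℂ)) (f : 𝓢'(Xi n, ℂ)) :
    P.Mt h (P.Mw k f) = pair h k • f := by
  rw [← Jt_J, Mt, Mw, M_eq hC, ContinuousLinearMap.inverse_equiv]
  simp only [ContinuousLinearMap.comp_apply, ContinuousLinearEquiv.coe_coe,
    ContinuousLinearEquiv.symm_apply_apply]

/-- Reconstruct `f` from its transform with window `h` by means of the dual window `h'`, then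
analyse it with `k`. All the inclusions come from this identity. -/
theorem Mw_eq {hB : P.Regularizing} (hC : Orthogonality hB) {h' h : 𝓢(Xi n, ℂ)}
    (hc : pair h' h ≠ 0) (k : 𝓢(Xi n, ℂ)) (f : 𝓢'(Xi n, ℂ)) :
    P.Mw k f = (pair h' h)⁻¹ • P.Mw k (P.Mt h' (P.Mw h f)) := by
  rw [Mt_Mw hC, map_smul, smul_smul, inv_mul_cancel₀ hc, one_smul]

theorem induced_le {hB : P.Regularizing} (hC : Orthogonality hB)
    {L : Submodule ℂ 𝓢'(Xi n × Xi n, ℂ)} {h' h k : 𝓢(Xi n, ℂ)} (hc : pair h' h ≠ 0)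
    (hL : ∀ G ∈ L, P.Mw k (P.Mt h' G) ∈ L) : P.induced L h ≤ P.induced L k := fun f hf => by
  change P.Mw k f ∈ L
  rw [Mw_eq hC hc]
  exact L.smul_mem _ (hL _ hf)

end CompositionLaw

namespace DistEmbedding

open CompositionLaw

variable {𝔏 : Type*} [NormedAddCommGroup 𝔏] [NormedSpace ℂ 𝔏] {P : CompositionLaw n}
  (ι : DistEmbedding n 𝔏)

/-- By the closed graph theorem, a continuous map of `𝓢'(Ξ × Ξ)` that leaves `𝔏` invariant is
continuous on `𝔏`. -/
theorem exists_restrict [CompleteSpace 𝔏] (A : 𝓢'(Xi n × Xi n, ℂ) →L[ℂ] 𝓢'(Xi n × Xi n, ℂ))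
    (hA : ∀ G ∈ ι.space, A G ∈ ι.space) :
    ∃ g : 𝔏 →L[ℂ] 𝔏, ∀ x, ι.toCLM (g x) = A (ι.toCLM x) := by
  choose g hg using fun x : 𝔏 => hA (ι.toCLM x) ⟨x, rfl⟩
  change ∀ x, ι.toCLM (g x) = A (ι.toCLM x) at hg
  let g' : 𝔏 →ₗ[ℂ] 𝔏 :=
    { toFun := g
      map_add' := fun x y => ι.injective (by simp only [map_add, hg])
      map_smul' := fun c x => ι.injective (by simp only [map_smul, hg, RingHom.id_apply]) }
  refine ⟨⟨g', g'.continuous_of_isClosed_graph ?_⟩, hg⟩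
  -- Injectivity of the embedding turns the graph into the coincidence set of two continuous maps to
  -- a Hausdorff space.
  have : (g'.graph : Set (𝔏 × 𝔏)) = {z | ι.toCLM z.2 = A (ι.toCLM z.1)} := by
    ext z
    rw [SetLike.mem_coe, LinearMap.mem_graph_iff, Set.mem_ofPred_eq, ← hg]
    exact ι.injective.eq_iff.symm
  rw [this]
  exact isClosed_eq (ι.toCLM.continuous.comp continuous_snd)
    (A.continuous.comp (ι.toCLM.continuous.comp continuous_fst))

/-- Seen in 𝔏, the inclusion is ⟨h', h⟩⁻¹ times the restriction of 𝐌_k 𝐌̃_{h'}, which is bounded by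
the closed graph theorem. -/
theorem exists_inclusion [CompleteSpace 𝔏] {hB : P.Regularizing} (hC : Orthogonality hB)
    {h' h k : 𝓢(Xi n, ℂ)} (hc : pair h' h ≠ 0)
    (hL : ∀ G ∈ ι.space, P.Mw k (P.Mt h' G) ∈ ι.space) :
    ∃ j : ι.Induced P h →L[ℂ] ι.Induced P k, ∀ f, (j f).toDist = f.toDist := by
  obtain ⟨g, hg⟩ := ι.exists_restrict ((P.Mw k).comp (P.Mt h')) hL
  let j : ι.Induced P h →ₗ[ℂ] ι.Induced P k := Submodule.inclusion (induced_le hC hc hL)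
  have hj : ∀ f, (j f).toDist = f.toDist := fun f => rfl
  refine ⟨j.mkContinuous (‖(pair h' h)⁻¹‖ * ‖g‖) fun f => ?_, hj⟩
  have : (j f).image = (pair h' h)⁻¹ • g f.image := ι.injective (by
    rw [Induced.toCLM_image, hj, map_smul, hg, Induced.toCLM_image]
    exact Mw_eq hC hc k _)
  rw [Induced.norm_def, Induced.norm_def, this, norm_smul, mul_assoc]
  gcongr
  exact g.le_opNorm _

variable {ι}

theorem Induced.toDist_eq {hB : P.Regularizing} (hC : Orthogonality hB) {h' h : 𝓢(Xi n, ℂ)}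
    (hc : pair h' h ≠ 0) (f : ι.Induced P h) :
    f.toDist = (pair h' h)⁻¹ • P.Mt h' (ι.toCLM f.image) := by
  rw [Induced.toCLM_image, Mt_Mw hC, smul_smul, inv_mul_cancel₀ hc, one_smul]

theorem Induced.toDist_injective {h : 𝓢(Xi n, ℂ)} :
    Function.Injective (Induced.toDist : ι.Induced P h → 𝓢'(Xi n, ℂ)) := Subtype.val_injective

theorem Induced.isometry_image {h : 𝓢(Xi n, ℂ)} :
    Isometry (Induced.image : ι.Induced P h → 𝔏) :=
  AddMonoidHomClass.isometry_of_norm _ fun _ => rfl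

theorem Induced.eq_zero_of_norm {hB : P.Regularizing} (hC : Orthogonality hB) {h' h : 𝓢(Xi n, ℂ)}
    (hc : pair h' h ≠ 0) (f : ι.Induced P h) (hf : ‖f‖ = 0) : f = 0 := by
  rw [Induced.norm_def, norm_eq_zero] at hf
  refine Induced.toDist_injective ?_
  rw [Induced.toDist_eq hC hc, hf, map_zero, map_zero, map_zero]
  exact smul_zero (A := 𝓢'(Xi n, ℂ)) (pair h' h)⁻¹

theorem Induced.continuous_toDist {hB : P.Regularizing} (hC : Orthogonality hB)
    {h' h : 𝓢(Xi n, ℂ)} (hc : pair h' h ≠ 0) :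
    Continuous (Induced.toDist : ι.Induced P h → 𝓢'(Xi n, ℂ)) := by
  refine Continuous.congr ?_ fun f => (Induced.toDist_eq hC hc f).symm
  exact (continuous_const_smul (pair h' h)⁻¹).comp ((P.Mt h').continuous.comp
    (ι.toCLM.continuous.comp Induced.isometry_image.continuous))

/-- ⟨h', h⟩⁻¹ 𝐌_h 𝐌̃_{h'} is a projection onto the range of 𝐌_h, so the image consists of its fixed
points in 𝔏. This set is closed, which gives completeness of the induced space without any
invariance of 𝔏. -/
theorem Induced.range_image {hB : P.Regularizing} (hC : Orthogonality hB) {h' h : 𝓢(Xi n, ℂ)}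
    (hc : pair h' h ≠ 0) : Set.range (Induced.image : ι.Induced P h → 𝔏) =
      {x | P.Mw h (P.Mt h' (ι.toCLM x)) = pair h' h • ι.toCLM x} := by
  ext x
  constructor
  · rintro ⟨f, rfl⟩
    change P.Mw h (P.Mt h' (ι.toCLM f.image)) = pair h' h • ι.toCLM f.image
    rw [Induced.toCLM_image, Mt_Mw hC, map_smul]
  · intro hx
    have hf : P.Mw h ((pair h' h)⁻¹ • P.Mt h' (ι.toCLM x)) = ι.toCLM x := by
      rw [map_smul, hx, smul_smul, inv_mul_cancel₀ hc, one_smul]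
    let f : ι.Induced P h := ⟨(pair h' h)⁻¹ • P.Mt h' (ι.toCLM x), x, hf.symm⟩
    exact ⟨f, ι.injective ((Induced.toCLM_image f).trans hf)⟩

theorem Induced.completeSpace [CompleteSpace 𝔏] {hB : P.Regularizing} (hC : Orthogonality hB)
    {h' h : 𝓢(Xi n, ℂ)} (hc : pair h' h ≠ 0) : CompleteSpace (ι.Induced P h) := by
  refine (completeSpace_iff_isComplete_range Induced.isometry_image.isUniformInducing).mpr ?_
  rw [Induced.range_image hC hc]
  exact (isClosed_eq ((P.Mw h).continuous.comp ((P.Mt h').continuous.comp ι.toCLM.continuous))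
    ((continuous_const_smul (pair h' h)).comp ι.toCLM.continuous)).isComplete

variable (ι)

/-- Admissibility with the conjugate windows gives continuous inclusions both ways; neither changes
the underlying distribution, so they are mutually inverse. -/
theorem exists_equiv [CompleteSpace 𝔏] {hB : P.Regularizing} (hC : Orthogonality hB)
    (hι : ι.Admissible P) {h k : 𝓢(Xi n, ℂ)} (hh : h ≠ 0) (hk : k ≠ 0) :
    ∃ e : ι.Induced P h ≃L[ℂ] ι.Induced P k, ∀ f, (e f).toDist = f.toDist := by
  obtain ⟨i, hi⟩ := ι.exists_inclusion hC (pair_conjS_ne_zero hh) (hι (conjS h) k (conjS_ne_zero hh) hk)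
  obtain ⟨j, hj⟩ := ι.exists_inclusion hC (pair_conjS_ne_zero hk) (hι (conjS k) h (conjS_ne_zero hk) hh)
  exact ⟨ContinuousLinearEquiv.equivOfInverse i j
    (fun f => Induced.toDist_injective (by rw [hj, hi]))
    (fun f => Induced.toDist_injective (by rw [hi, hj])), hi⟩

end DistEmbedding

end PhaseSpace

end

theorem mainTheorem7 {n : ℕ} (P : CompositionLaw n) (hB : P.Regularizing)
    (hC : CompositionLaw.Orthogonality hB) :
    -- the modulation mapping exists and is a topological isomorphism
    P.ModulationWellDefined ∧
    -- inclusion of the induced spaces of an arbitrary vector subspace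
    (∀ (L : Submodule ℂ 𝓢'(Xi n × Xi n, ℂ)) (h k : 𝓢(Xi n, ℂ)), h ≠ 0 → k ≠ 0 → pair h h ≠ 0 →
      (∀ G ∈ L, P.Mw k (P.Mt h G) ∈ L) → P.induced L h ≤ P.induced L k) ∧
    -- continuity of the inclusion for a continuously embedded Banach space
    (∀ (𝔏 : Type*) [NormedAddCommGroup 𝔏] [NormedSpace ℂ 𝔏] [CompleteSpace 𝔏]
      (ι : DistEmbedding n 𝔏) (h k : 𝓢(Xi n, ℂ)), h ≠ 0 → k ≠ 0 → pair h h ≠ 0 →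
      (∀ G ∈ ι.space, P.Mw k (P.Mt h G) ∈ ι.space) →
      ∃ j : ι.Induced P h →L[ℂ] ι.Induced P k, ∀ f, (j f).toDist = f.toDist) ∧
    -- the same for every window `h`, with the conjugate window in the hypothesis
    (∀ (L : Submodule ℂ 𝓢'(Xi n × Xi n, ℂ)) (h k : 𝓢(Xi n, ℂ)), h ≠ 0 → k ≠ 0 →
      (∀ G ∈ L, P.Mw k (P.Mt (conjS h) G) ∈ L) → P.induced L h ≤ P.induced L k) ∧
    (∀ (𝔏 : Type*) [NormedAddCommGroup 𝔏] [NormedSpace ℂ 𝔏] [CompleteSpace 𝔏]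
      (ι : DistEmbedding n 𝔏) (h k : 𝓢(Xi n, ℂ)), h ≠ 0 → k ≠ 0 →
      (∀ G ∈ ι.space, P.Mw k (P.Mt (conjS h) G) ∈ ι.space) →
      ∃ j : ι.Induced P h →L[ℂ] ι.Induced P k, ∀ f, (j f).toDist = f.toDist) ∧
    -- independence of the window for an admissible Banach space
    (∀ (𝔏 : Type*) [NormedAddCommGroup 𝔏] [NormedSpace ℂ 𝔏] [CompleteSpace 𝔏]
      (ι : DistEmbedding n 𝔏), ι.Admissible P →
      (∀ h : 𝓢(Xi n, ℂ), h ≠ 0 →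
        (∀ f : ι.Induced P h, ‖f‖ = 0 → f = 0) ∧ CompleteSpace (ι.Induced P h) ∧
        Continuous (DistEmbedding.Induced.toDist : ι.Induced P h → 𝓢'(Xi n, ℂ))) ∧
      ∀ h k : 𝓢(Xi n, ℂ), h ≠ 0 → k ≠ 0 →
        P.induced ι.space h = P.induced ι.space k ∧
        ∃ e : ι.Induced P h ≃L[ℂ] ι.Induced P k, ∀ f, (e f).toDist = f.toDist) := by
  refine ⟨CompositionLaw.modulationWellDefined hC,
    fun L h k _ _ hc hL => CompositionLaw.induced_le hC hc hL,
    fun 𝔏 _ _ _ ι h k _ _ hc hL => ι.exists_inclusion hC hc hL,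
    fun L h k hh _ hL => CompositionLaw.induced_le hC (pair_conjS_ne_zero hh) hL,
    fun 𝔏 _ _ _ ι h k hh _ hL => ι.exists_inclusion hC (pair_conjS_ne_zero hh) hL,
    fun 𝔏 _ _ _ ι hι => ⟨fun h hh => ?_, fun h k hh hk => ⟨le_antisymm ?_ ?_,
      ι.exists_equiv hC hι hh hk⟩⟩⟩
  · have hc := pair_conjS_ne_zero hh
    exact ⟨DistEmbedding.Induced.eq_zero_of_norm hC hc, DistEmbedding.Induced.completeSpace hC hc,
      DistEmbedding.Induced.continuous_toDist hC hc⟩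
  -- Admissibility is applied to the conjugate of the window, whose pairing with the window never
  -- vanishes.
  · exact CompositionLaw.induced_le hC (pair_conjS_ne_zero hh) (hι _ _ (conjS_ne_zero hh) hk)
  · exact CompositionLaw.induced_le hC (pair_conjS_ne_zero hk) (hι _ _ (conjS_ne_zero hk) hh)
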